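/- **Setting.** Let $P=(p_1,\dots,p_n)$ be a dataset of $n$ points in $\mathbb{R}^d$, $d\ge 1$ (repetitions allowed), and let $k\ge 2$. For a dataset $X$ with nonnegative weights $w$ (all weights $1$ if none are given) and a center set $C\subset\mathbb{R}^d$ put $\mathrm{cost}(X,C)=\sum_{x\in X}w(x)\min_{c\in C}\|x-c\|_2^2$, $\mathrm{OPT}_X(m)=\inf_{|C|=m}\mathrm{cost}(X,C)$, $\mathrm{OPT}_X=\mathrm{OPT}_X(k)$ and, for $|C|=k$, $r_X(C)=\mathrm{cost}(X,C)/\mathrm{OPT}_X$ (if $\mathrm{OPT}_X=0$: $r_X(C)=1$ when $\mathrm{cost}(X,C)=0$, and $\infty$ otherwise). For $\alpha\ge1$ let $\mathcal{C}_\alpha(S)=\{C:|C|=k,\ r_S(C)\le\alpha\}$ and $$\mathrm{Err}_\alpha(S,X)=\sup_{C\in\mathcal{C}_\alpha(S)}\frac{r_X(C)}{r_S(C)}-1,\qquad r_P(S,\alpha)=\sup_{C\in\mathcal{C}_\alpha(S)}r_P(C).$$ **Noise model.** For $\sigma\ge0$ let $D_1,\dots,D_d$ be probability distributions on $\mathbb{R}$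 with mean $0$ and variance $\sigma^2$ satisfying the Bernstein condition with parameter $b=\kappa\sigma$, that is, $\mathbb{E}_{X\sim D_j}|X|^i\le\frac12\,i!\,\sigma^2b^{\,i-2}$ for all integers $i\ge3$. The observed dataset $\widehat P$ consists of the points $\widehat p=p+\xi_p$, where all coordinates $\xi_{p,j}$ ($p\in P$, $j\in[d]$) are independent and $\xi_{p,j}\sim D_j$. **Data assumption** (with constant $A$). $\mathrm{OPT}_P(k-1)/\mathrm{OPT}_P(k)\ge1+\gamma$ with $$\gamma=A\,\alpha\left(1+\frac{\sigma^2nd\,\log^2\!\big(kd/\sqrt{\alpha-1}\big)}{\mathrm{OPT}_P}\right)$$ (for $\alpha=1$ the logarithm is $\infty$, and $0\cdot\infty=0$); moreover there is an optimal center set of $P$ such that in each of its $k$ clusters $P_i$ (with center $c_i$) the maximum radius $r_i=\max_{p\in P_i}\|p-c_i\|_2$ is at most $8\,\overline r_i$, where $\overline r_i=\big(\frac1{|P_i|}\sum_{p\in P_i}\|p-c_i\|_2^2\big)^{1/2}$. **Theorem.** For every $\kappa>0$ there are constants $A,K,L>0$ depending only on $\kappa$ such that for all $n$, $d\ge1$,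 $k\ge2$, $\varepsilon\in(0,1)$, $\alpha\in[1,2]$ and $\sigma\ge0$ there is a randomized algorithm (a finite procedure that branches on signs of polynomials in the input coordinates and draws uniform elements of finite sets) which, given a dataset of $n$ points of $\mathbb{R}^d$, returns a weighted subset of it, with the following property. Let $P$ and $D_1,\dots,D_d$ be as above, with $\mathrm{OPT}_P>0$ and $\sigma^2\le\frac{\mathrm{OPT}_P}{nd}$, let $P$ satisfy the data assumption with constant $A$, and let $s:=\varepsilon-\frac{\sqrt{\alpha-1}\,\sigma^2nd}{\alpha\,\mathrm{OPT}_P}>0$. Then the weighted set $S\subset\widehat P$ returned on input $\widehat P$ always has size $$|S|\le K\left(\frac{k\log k}{s}+\frac{(\alpha-1)\,k\log k}{s^2}\right),$$ and with probability at least $0.99$ over the noise and the randomness of the algorithm, simultaneously, $$\mathrm{Err}_\alpha(S,\widehat P)\le\varepsilon,\qquad \mathrm{Err}_\alpha(S,P)\le\varepsilon+L\,\Delta,\qquad r_P(S,\alpha)\le(1+\varepsilon+L\,\Delta)\,\alpha,$$ where $$\Delta=\frac{\sigma^2kd}{\mathrm{OPT}_P}+\frac{\sqrt{\alpha-1}}{\alpha}\cdot\frac{\sqrt{\sigma^2kd\,\mathrm{OPT}_P}+\sigma^2nd}{\mathrm{OPT}_P}.$$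 -/

import Mathlib

open MeasureTheory ProbabilityTheory
open scoped ENNReal NNReal

namespace NoisyCoreset

/-! ### Data sets, clustering cost and the coreset metrics -/

/-- Points of `ℝ^d` with the Euclidean distance. -/
abbrev Pt (d : ℕ) : Type := EuclideanSpace ℝ (Fin d)

/-- A data set of `n` points of `ℝ^d`; repeated points are allowed. -/
abbrev Dataset (n d : ℕ) : Type := Fin n → Pt d

/-- The `k`-means cost `∑ w(x) d(x, C)²` of the points `X i` with weights `w i`. A weighted subset of
a data set `X` is given by its weights `w`: it consists of the points `X i` with `w i ≠ 0`. The
unweighted data set is the case `w = 1`. -/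
noncomputable def cost {n d : ℕ} (w : Fin n → ℝ≥0) (X : Dataset n d) (C : Finset (Pt d)) : ℝ≥0∞ :=
  ∑ i, (w i : ℝ≥0∞) * Metric.infEDist (X i) (C : Set (Pt d)) ^ 2

/-- The optimal `k`-means cost, over all center sets of exactly `k` points. -/
noncomputable def opt {n d : ℕ} (w : Fin n → ℝ≥0) (X : Dataset n d) (k : ℕ) : ℝ≥0∞ :=
  ⨅ (C : Finset (Pt d)) (_ : C.card = k), cost w X C

/-- The number of points of the weighted subset with weights `w`. -/
noncomputable def size {n : ℕ} (w : Fin n → ℝ≥0) : ℕ := (Finset.univ.filter fun i => w i ≠ 0).card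

open Classical in
/-- The approximation ratio `r_X(C) = cost(X, C) / OPT_X`. In the degenerate case `OPT_X = 0` it is
`1` for an optimal `C` and `∞` for every other `C`. -/
noncomputable def ratio {n d : ℕ} (w : Fin n → ℝ≥0) (X : Dataset n d) (k : ℕ)
    (C : Finset (Pt d)) : ℝ≥0∞ :=
  if cost w X C = opt w X k then 1 else cost w X C / opt w X k

/-- The set `𝒞_α(S)` of `α`-approximate center sets. -/
def approxCenters {n d : ℕ} (w : Fin n → ℝ≥0) (X : Dataset n d) (k : ℕ) (α : ℝ) :
    Set (Finset (Pt d)) :=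
  {C | C.card = k ∧ ratio w X k C ≤ ENNReal.ofReal α}

/-- `Err_α(S, Y) = sup_{C ∈ 𝒞_α(S)} r_Y(C) / r_S(C) - 1`, where `S` is the subset of `X` with
weights `w`. -/
noncomputable def errAlpha {n d : ℕ} (w : Fin n → ℝ≥0) (X Y : Dataset n d) (k : ℕ) (α : ℝ) :
    EReal :=
  ((⨆ C ∈ approxCenters w X k α, ratio 1 Y k C / ratio w X k C : ℝ≥0∞) : EReal) - 1

/-- `r_Y(S, α) = sup_{C ∈ 𝒞_α(S)} r_Y(C)`, where `S` is the subset of `X` with weights `w`. -/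
noncomputable def quality {n d : ℕ} (w : Fin n → ℝ≥0) (X Y : Dataset n d) (k : ℕ) (α : ℝ) :
    ℝ≥0∞ :=
  ⨆ C ∈ approxCenters w X k α, ratio 1 Y k C

/-! ### The assumption on the data -/

/-- `γ`-cost-stability (with `γ = ∞` allowed). -/
def CostStable {n d : ℕ} (P : Dataset n d) (k : ℕ) (γ : ℝ≥0∞) : Prop :=
  1 + γ ≤ opt 1 P (k - 1) / opt 1 P k

open Classical in
/-- The cluster of the center `c ∈ C`: the points of `P` that have `c` as a nearest center. -/
noncomputable def cluster {n d : ℕ} (P : Dataset n d) (C : Finset (Pt d)) (c : Pt d) :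
    Finset (Fin n) :=
  Finset.univ.filter fun i => ∀ c' ∈ C, dist (P i) c ≤ dist (P i) c'

/-- The average (root mean square) radius of the cluster of `c`. -/
noncomputable def avgRadius {n d : ℕ} (P : Dataset n d) (C : Finset (Pt d)) (c : Pt d) : ℝ :=
  √((∑ i ∈ cluster P C c, dist (P i) c ^ 2) / (cluster P C c).card)

/-- For an optimal center set, the maximum radius of every cluster is at most `8` times its average
radius. -/
def LimitedOutliers {n d : ℕ} (P : Dataset n d) (k : ℕ) : Prop :=
  ∃ C : Finset (Pt d), C.card = k ∧ cost 1 P C = opt 1 P k ∧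
    ∀ c ∈ C, ∀ i ∈ cluster P C c, dist (P i) c ≤ 8 * avgRadius P C c

open Classical in
/-- `log²(kd / √(α - 1))`, which is `∞` for `α = 1`. -/
noncomputable def logSq (k d : ℕ) (α : ℝ) : ℝ≥0∞ :=
  if α = 1 then ⊤ else ENNReal.ofReal (Real.log (k * d / √(α - 1)) ^ 2)

/-- The stability parameter `γ = A α (1 + σ² n d log²(kd / √(α - 1)) / OPT_P)`, where `0 · ∞ = 0`. -/
noncomputable def stabilityParam {n d : ℕ} (A α σ : ℝ) (P : Dataset n d) (k : ℕ) : ℝ≥0∞ :=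
  ENNReal.ofReal (A * α) *
    (1 + ENNReal.ofReal (σ ^ 2 * n * d) * logSq k d α / opt 1 P k)

/-- The data assumption with the constant `A` in `γ = O(α) · (…)`. -/
def DataAssumption {n d : ℕ} (A α σ : ℝ) (P : Dataset n d) (k : ℕ) : Prop :=
  CostStable P k (stabilityParam A α σ P k) ∧ LimitedOutliers P k

/-! ### The noise model -/

/-- The Bernstein condition with parameter `b`. -/
def BernsteinCondition (D : Measure ℝ) (b : ℝ) : Prop :=
  ∀ i : ℕ, 3 ≤ i → Integrable (fun x => |x - ∫ y, y ∂D| ^ i) D ∧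
    ∫ x, |x - ∫ y, y ∂D| ^ i ∂D ≤ 1 / 2 * (i.factorial : ℝ) * variance id D * b ^ (i - 2)

/-- A probability distribution on `ℝ` with mean `0` and variance `σ²` that satisfies the Bernstein
condition. The parameter `b` scales like the noise and is measured in units of the standard
deviation, `b = κ σ`. -/
structure IsNoise (κ σ : ℝ) (D : Measure ℝ) : Prop where
  isProbabilityMeasure : IsProbabilityMeasure D
  memLp : MemLp id 2 D
  mean : ∫ x, x ∂D = 0
  variance_eq : variance id D = σ ^ 2
  bernstein : BernsteinCondition D (κ * σ)

/-- The law of the noise `ξ`: all `ξ p j` are independent and `ξ p j` has law `D j`. -/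
noncomputable def noiseLaw (n : ℕ) {d : ℕ} (D : Fin d → Measure ℝ) :
    Measure (Fin n → Fin d → ℝ) :=
  Measure.pi fun _ => Measure.pi D

/-- The observed data set `p̂ = p + ξ_p`. -/
def observed {n d : ℕ} (P : Dataset n d) (ξ : Fin n → Fin d → ℝ) : Dataset n d :=
  fun p => P p + WithLp.toLp 2 (ξ p)

/-! ### Randomized algorithms on real inputs -/

/-- Randomized algebraic decision trees: finite procedures on an input `x : ι → ℝ` that branch on the
sign of polynomials in the input, draw uniformly random elements of finite sets, and end with an
output in `β`. -/
inductive RandAlg (ι β : Type) : Type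
  | output (b : β) : RandAlg ι β
  | test (p : MvPolynomial ι ℝ) (pos nonpos : RandAlg ι β) : RandAlg ι β
  | draw (N : ℕ) (next : Fin (N + 1) → RandAlg ι β) : RandAlg ι β

open Classical in
/-- The distribution of the output on the input `x`. -/
noncomputable def RandAlg.run {ι β : Type} : RandAlg ι β → (ι → ℝ) → PMF β
  | .output b, _ => PMF.pure b
  | .test p pos nonpos, x => if 0 < MvPolynomial.eval x p then pos.run x else nonpos.run x
  | .draw N next, x => (PMF.uniformOfFintype (Fin (N + 1))).bind fun i => (next i).run x

/-- An algorithm whose input is a data set `X` of `n` points in `ℝ^d` and whose output is a weighted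
subset of `X`, given by its weights. -/
abbrev CoresetAlg (n d : ℕ) : Type := RandAlg (Fin n × Fin d) (Fin n → ℝ≥0)

/-- The distribution of the weights that the algorithm returns on the data set `X`. -/
noncomputable def CoresetAlg.weights {n d : ℕ} (𝒜 : CoresetAlg n d) (X : Dataset n d) :
    PMF (Fin n → ℝ≥0) :=
  RandAlg.run 𝒜 fun q => X q.1 q.2

/-! ### The bounds -/

/-- `ε - √(α - 1) σ² n d / (α OPT)`. -/
noncomputable def slack (n d : ℕ) (ε α σ OPT : ℝ) : ℝ :=
  ε - √(α - 1) * σ ^ 2 * n * d / (α * OPT)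

/-- `k log k / s + (α - 1) k log k / s²` with `s = ε - √(α - 1) σ² n d / (α OPT)`. -/
noncomputable def sizeBound (n d k : ℕ) (ε α σ OPT : ℝ) : ℝ :=
  k * Real.log k / slack n d ε α σ OPT +
    (α - 1) * k * Real.log k / slack n d ε α σ OPT ^ 2

/-- `σ² k d / OPT + (√(α - 1) / α) · (√(σ² k d OPT) + σ² n d) / OPT`. -/
noncomputable def noiseTerm (n d k : ℕ) (α σ OPT : ℝ) : ℝ :=
  σ ^ 2 * k * d / OPT +
    √(α - 1) / α * ((√(σ ^ 2 * k * d * OPT) + σ ^ 2 * n * d) / OPT)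

end NoisyCoreset

open NoisyCoreset

set_option linter.unusedSectionVars false

namespace NoisyCoreset

/-! ### Conditions that a decision tree can test -/

/-! The algorithm is an exhaustive search that draws no random elements. It runs through all
labelled partitions `π` of the observed data `X` into `k` parts and all choices `s` of `m` points
per part, each weighted by (size of the part)`/m`, and returns the first pair found that passes
`IsGoodSample`. All its conditions are polynomial inequalities in the coordinates. Here `m` is of
order `1/ε + (α - 1)/ε²`, so the factor `log k` in the size bound is not needed. It remains to see
that every good sample gives the error bounds, and that on an event of probability at least `0.99`
one exists.

Why a good sample suffices: the sampled points lie deep inside well separated parts, so a center set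
`C` that is `α`-approximate for the sample has exactly one center `z i` near each part, and `z i`
serves the whole sample of that part (`exists_center_assignment`). By the parallel axis theorem the
sample cost is then exactly `(1 + y) V`, where `V` is the cost of the sample around its own means,
`y ≤ α - 1`, and `y V` is the weighted squared distance from the sample means to the `z i`. The same
theorem bounds the cost of `X` by the partition cost `Φ` plus the weighted squared distance from the
true means to the `z i`. Minkowski's inequality bounds the latter by `(√(y V) + √G)²`, with `G` the
gap between sample means and true means. The condition `gap` trades `G` against `V - Φ`, which makes
this at most `(y + e) Φ` (`sq_add_le_of_tradeoff`). For the clean data one more Minkowski term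
appears, from the noise in the means of the parts (`noise_tradeoff`).

Why a good sample exists: merging two optimal clusters of `P` must be expensive by stability, so the
centers are separated at a scale `N` far above the cost and, through the logarithm, above typical
noise (`exists_isSeparated`). Hence an optimal partition of `X` agrees with the clusters of `P` up
to relabeling, except at points of exceptionally large noise, and only such points can lie outside
the cores. Their total squared noise is `tail N ξ`, and everything that goes wrong is charged to it.
From the remaining core points a greedy derandomization of uniform sampling (`exists_greedy_sample`)
picks the sample.

Why the noise is moderate: second moments and Markov's inequality control the total noise, the noise
in the cluster means and the cross term. The Bernstein condition gives an exponential moment, which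
makes the expected tail beyond `N` at most a small multiple of `(α - 1) (σ² n d / OPT)² OPT`.
Positivity of the slack makes `(α - 1) (σ² n d / OPT)²` at most `4 ε²`, so `m` times the fraction of
points outside a core stays bounded. -/

open Classical in
/-- A condition on the input that a decision tree can branch on. -/
def TreeTestable {ι : Type} (Q : (ι → ℝ) → Prop) : Prop :=
  ∀ (β : Type) (t e : RandAlg ι β), ∃ r : RandAlg ι β,
    ∀ x, r.run x = if Q x then t.run x else e.run x

/-- A function that is given by a polynomial in the input. -/
def IsPoly {ι : Type} (g : (ι → ℝ) → ℝ) : Prop :=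
  ∃ p : MvPolynomial ι ℝ, ∀ x, MvPolynomial.eval x p = g x

section Polynomials

variable {ι : Type}

lemma IsPoly.const (a : ℝ) : IsPoly fun _ : ι → ℝ => a := ⟨MvPolynomial.C a, fun _ => by simp⟩

lemma IsPoly.coord (i : ι) : IsPoly fun x : ι → ℝ => x i := ⟨MvPolynomial.X i, fun _ => by simp⟩

lemma IsPoly.add {f g : (ι → ℝ) → ℝ} (hf : IsPoly f) (hg : IsPoly g) :
    IsPoly fun x => f x + g x := by
  obtain ⟨p, hp⟩ := hf
  obtain ⟨q, hq⟩ := hg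
  exact ⟨p + q, fun x => by simp [hp, hq]⟩

lemma IsPoly.mul {f g : (ι → ℝ) → ℝ} (hf : IsPoly f) (hg : IsPoly g) :
    IsPoly fun x => f x * g x := by
  obtain ⟨p, hp⟩ := hf
  obtain ⟨q, hq⟩ := hg
  exact ⟨p * q, fun x => by simp [hp, hq]⟩

lemma IsPoly.sub {f g : (ι → ℝ) → ℝ} (hf : IsPoly f) (hg : IsPoly g) :
    IsPoly fun x => f x - g x := by
  obtain ⟨p, hp⟩ := hf
  obtain ⟨q, hq⟩ := hg
  exact ⟨p - q, fun x => by simp [hp, hq]⟩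

lemma IsPoly.sum {κ : Type*} (s : Finset κ) {f : κ → (ι → ℝ) → ℝ} (hf : ∀ a ∈ s, IsPoly (f a)) :
    IsPoly fun x => ∑ a ∈ s, f a x := by
  classical
  induction s using Finset.induction_on with
  | empty => simpa using IsPoly.const 0
  | insert a s ha ih =>
    simp only [Finset.sum_insert ha]
    exact (hf a (by simp)).add (ih fun b hb => hf b (by simp [hb]))

lemma IsPoly.sq {f : (ι → ℝ) → ℝ} (hf : IsPoly f) : IsPoly fun x => f x ^ 2 := by
  simpa only [_root_.sq] using hf.mul hf

lemma TreeTestable.congr {Q R : (ι → ℝ) → Prop} (hQ : TreeTestable Q) (h : ∀ x, Q x ↔ R x) :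
    TreeTestable R := by
  rwa [← (funext fun x => propext (h x) : Q = R)]

lemma TreeTestable.and {Q R : (ι → ℝ) → Prop} (hQ : TreeTestable Q) (hR : TreeTestable R) :
    TreeTestable fun x => Q x ∧ R x := by
  intro β t e
  obtain ⟨r, hr⟩ := hR β t e
  obtain ⟨r', hr'⟩ := hQ β r e
  exact ⟨r', fun x => by rw [hr', hr]; by_cases h : Q x <;> by_cases h' : R x <;> simp [h, h']⟩

lemma TreeTestable.const (c : Prop) : TreeTestable fun _ : ι → ℝ => c := by
  intro β t e
  by_cases h : c
  · exact ⟨t, fun x => by simp [h]⟩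
  · exact ⟨e, fun x => by simp [h]⟩

lemma TreeTestable.le {f g : (ι → ℝ) → ℝ} (hf : IsPoly f) (hg : IsPoly g) :
    TreeTestable fun x => f x ≤ g x := by
  intro β t e
  obtain ⟨p, hp⟩ := hf.sub hg
  -- A test branches on strict positivity, so `f - g > 0` is the failing case and the branches are
  -- swapped.
  refine ⟨.test p e t, fun x => ?_⟩
  rw [RandAlg.run, hp]
  by_cases h : f x ≤ g x
  · simp [h]
  · simp [h, not_le.1 h]

lemma TreeTestable.forall_mem {κ : Type*} (s : Finset κ) {Q : κ → (ι → ℝ) → Prop}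
    (hQ : ∀ a ∈ s, TreeTestable (Q a)) : TreeTestable fun x => ∀ a ∈ s, Q a x := by
  classical
  induction s using Finset.induction_on with
  | empty => simpa using TreeTestable.const True
  | insert a s ha ih =>
    simp only [Finset.forall_mem_insert]
    exact (hQ a (by simp)).and (ih fun b hb => hQ b (by simp [hb]))

lemma TreeTestable.forall {κ : Type*} [Fintype κ] {Q : κ → (ι → ℝ) → Prop}
    (hQ : ∀ a, TreeTestable (Q a)) : TreeTestable fun x => ∀ a, Q a x := by
  simpa using TreeTestable.forall_mem Finset.univ fun a _ => hQ a

/-- A decision tree can search a finite list of candidates for one that passes a test. -/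
lemma exists_search {κ : Type*} {β : Type} [Fintype κ] {Q : κ → (ι → ℝ) → Prop}
    (hQ : ∀ a, TreeTestable (Q a)) (out : κ → β) (b₀ : β) :
    ∃ r : RandAlg ι β, ∀ x, ∃ b, r.run x = PMF.pure b ∧
      ((∃ a, Q a x ∧ b = out a) ∨ ((∀ a, ¬ Q a x) ∧ b = b₀)) := by
  classical
  suffices h : ∀ s : Finset κ, ∃ r : RandAlg ι β, ∀ x, ∃ b, r.run x = PMF.pure b ∧
      ((∃ a ∈ s, Q a x ∧ b = out a) ∨ ((∀ a ∈ s, ¬ Q a x) ∧ b = b₀)) by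
    simpa using h Finset.univ
  intro s
  induction s using Finset.induction_on with
  | empty => exact ⟨.output b₀, fun x => ⟨b₀, rfl, by simp⟩⟩
  | insert a s ha ih =>
    obtain ⟨r, hr⟩ := ih
    obtain ⟨r', hr'⟩ := hQ a β (.output (out a)) r
    refine ⟨r', fun x => ?_⟩
    by_cases h : Q a x
    · exact ⟨out a, by rw [hr', if_pos h]; rfl, Or.inl ⟨a, by simp, h, rfl⟩⟩
    · obtain ⟨b, hb, hb'⟩ := hr x
      refine ⟨b, by rw [hr', if_neg h, hb], ?_⟩
      rcases hb' with ⟨a', ha', h1, h2⟩ | ⟨h1, h2⟩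
      · exact Or.inl ⟨a', by simp [ha'], h1, h2⟩
      · exact Or.inr ⟨by simpa [Finset.forall_mem_insert, h] using h1, h2⟩

end Polynomials

/-! ### Partitions, means and costs -/

section Partition

variable {E : Type*} [NormedAddCommGroup E] [InnerProductSpace ℝ E] {n k m : ℕ}

/-- The part with label `i`. -/
def fiber (π : Fin n → Fin k) (i : Fin k) : Finset (Fin n) := Finset.univ.filter fun p => π p = i

@[simp] lemma mem_fiber {π : Fin n → Fin k} {i : Fin k} {p : Fin n} : p ∈ fiber π i ↔ π p = i := by
  simp [fiber]

/-- The number of points in the part with label `i`. -/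
noncomputable def mass (π : Fin n → Fin k) (i : Fin k) : ℝ := (fiber π i).card

/-- The mean of the part with label `i`. -/
noncomputable def mean (π : Fin n → Fin k) (X : Fin n → E) (i : Fin k) : E :=
  (mass π i)⁻¹ • ∑ p ∈ fiber π i, X p

/-- The cost of a partition. -/
noncomputable def partCost (π : Fin n → Fin k) (X : Fin n → E) : ℝ :=
  ∑ p, ‖X p - mean π X (π p)‖ ^ 2

lemma mass_nonneg (π : Fin n → Fin k) (i : Fin k) : 0 ≤ mass π i := Nat.cast_nonneg _

lemma partCost_nonneg (π : Fin n → Fin k) (X : Fin n → E) : 0 ≤ partCost π X :=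
  Finset.sum_nonneg fun _ _ => sq_nonneg _

lemma mass_smul_mean (π : Fin n → Fin k) (X : Fin n → E) (i : Fin k) :
    mass π i • mean π X i = ∑ p ∈ fiber π i, X p := by
  by_cases h : mass π i = 0
  · have : fiber π i = ∅ := by simpa [mass] using h
    simp [h, this]
  · rw [mean, smul_inv_smul₀ h]

lemma sum_sub_mean (π : Fin n → Fin k) (X : Fin n → E) (i : Fin k) :
    ∑ p ∈ fiber π i, (X p - mean π X i) = 0 := by
  rw [Finset.sum_sub_distrib, ← mass_smul_mean, Finset.sum_const, mass, Nat.cast_smul_eq_nsmul,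
    sub_self]

lemma mean_add (π : Fin n → Fin k) (X Y : Fin n → E) (i : Fin k) :
    mean π (fun p => X p + Y p) i = mean π X i + mean π Y i := by
  simp [mean, Finset.sum_add_distrib]

lemma sum_fiber {M : Type*} [AddCommMonoid M] (π : Fin n → Fin k) (g : Fin n → M) :
    ∑ i, ∑ p ∈ fiber π i, g p = ∑ p, g p :=
  Finset.sum_fiberwise _ _ _

/-- The parallel axis theorem for a finite family of points. -/
lemma sum_norm_sub_sq {κ : Type*} (s : Finset κ) (x : κ → E) (a z : E)
    (h : ∑ t ∈ s, (x t - a) = 0) :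
    ∑ t ∈ s, ‖x t - z‖ ^ 2 = ∑ t ∈ s, ‖x t - a‖ ^ 2 + s.card * ‖a - z‖ ^ 2 := by
  have h1 : ∀ t, ‖x t - z‖ ^ 2 = ‖x t - a‖ ^ 2 + 2 * inner ℝ (x t - a) (a - z) + ‖a - z‖ ^ 2 := by
    intro t
    rw [← norm_add_sq_real, sub_add_sub_cancel]
  simp only [h1, Finset.sum_add_distrib, ← Finset.mul_sum, ← sum_inner, h, inner_zero_left,
    Finset.sum_const, nsmul_eq_mul, mul_zero, add_zero]

lemma sum_fiber_norm_sub_sq (π : Fin n → Fin k) (X : Fin n → E) (i : Fin k) (z : E) :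
    ∑ p ∈ fiber π i, ‖X p - z‖ ^ 2 =
      ∑ p ∈ fiber π i, ‖X p - mean π X i‖ ^ 2 + mass π i * ‖mean π X i - z‖ ^ 2 :=
  sum_norm_sub_sq _ _ _ _ (sum_sub_mean π X i)

lemma partCost_eq_sum (π : Fin n → Fin k) (X : Fin n → E) :
    partCost π X = ∑ i, ∑ p ∈ fiber π i, ‖X p - mean π X i‖ ^ 2 := by
  rw [partCost, ← sum_fiber π]
  refine Finset.sum_congr rfl fun i _ => Finset.sum_congr rfl fun p hp => ?_
  rw [mem_fiber.1 hp]

/-- The parallel axis theorem, part by part. It reduces the comparison of center sets to distances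
between `k` means and `k` centers. -/
lemma sum_norm_sub_center_sq (π : Fin n → Fin k) (X : Fin n → E) (z : Fin k → E) :
    ∑ p, ‖X p - z (π p)‖ ^ 2 = partCost π X + ∑ i, mass π i * ‖mean π X i - z i‖ ^ 2 := by
  rw [partCost_eq_sum, ← Finset.sum_add_distrib, ← sum_fiber π]
  refine Finset.sum_congr rfl fun i _ => ?_
  rw [← sum_fiber_norm_sub_sq]
  refine Finset.sum_congr rfl fun p hp => ?_
  rw [mem_fiber.1 hp]

lemma partCost_le (π : Fin n → Fin k) (X : Fin n → E) (z : Fin k → E) :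
    partCost π X ≤ ∑ p, ‖X p - z (π p)‖ ^ 2 := by
  rw [sum_norm_sub_center_sq]
  exact le_add_of_nonneg_right
    (Finset.sum_nonneg fun i _ => mul_nonneg (mass_nonneg _ _) (sq_nonneg _))

/-- In a partition of minimal cost every point belongs to a nearest mean. -/
lemma norm_sub_mean_le_of_minimal {π : Fin n → Fin k} {X : Fin n → E}
    (h : ∀ π' : Fin n → Fin k, partCost π X ≤ partCost π' X) (p : Fin n) (j : Fin k) :
    ‖X p - mean π X (π p)‖ ≤ ‖X p - mean π X j‖ := by
  -- Move only `p` to the part `j` and keep the old means as centers: all terms but that of `p`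
  -- cancel.
  have h1 := (h (Function.update π p j)).trans (partCost_le _ X (mean π X))
  rw [partCost, ← Finset.add_sum_erase _ _ (Finset.mem_univ p),
    ← Finset.add_sum_erase _ (fun q => ‖X q - mean π X (Function.update π p j q)‖ ^ 2)
      (Finset.mem_univ p)] at h1
  have h2 : ∑ q ∈ Finset.univ.erase p, ‖X q - mean π X (Function.update π p j q)‖ ^ 2 =
      ∑ q ∈ Finset.univ.erase p, ‖X q - mean π X (π q)‖ ^ 2 :=
    Finset.sum_congr rfl fun q hq => by rw [Function.update_of_ne (Finset.ne_of_mem_erase hq)]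
  rw [h2, Function.update_self] at h1
  exact (sq_le_sq₀ (norm_nonneg _) (norm_nonneg _)).1 (by linarith)

lemma exists_minimal_partition (X : Fin n → E) (hk : 0 < k) :
    ∃ π : Fin n → Fin k, ∀ π' : Fin n → Fin k, partCost π X ≤ partCost π' X := by
  have : Nonempty (Fin k) := ⟨⟨0, hk⟩⟩
  exact Finite.exists_min fun π : Fin n → Fin k => partCost π X

/-- The triangle inequality for weighted sums of squares. -/
lemma sum_mul_norm_add_sq_le {κ : Type*} [Fintype κ] (w : κ → ℝ) (hw : ∀ i, 0 ≤ w i)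
    (x y : κ → E) :
    ∑ i, w i * ‖x i + y i‖ ^ 2 ≤
      (√(∑ i, w i * ‖x i‖ ^ 2) + √(∑ i, w i * ‖y i‖ ^ 2)) ^ 2 := by
  have hx : 0 ≤ ∑ i, w i * ‖x i‖ ^ 2 :=
    Finset.sum_nonneg fun i _ => mul_nonneg (hw i) (sq_nonneg _)
  have hy : 0 ≤ ∑ i, w i * ‖y i‖ ^ 2 :=
    Finset.sum_nonneg fun i _ => mul_nonneg (hw i) (sq_nonneg _)
  have hc : ∑ i, w i * (‖x i‖ * ‖y i‖) ≤ √(∑ i, w i * ‖x i‖ ^ 2) * √(∑ i, w i * ‖y i‖ ^ 2) := by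
    rw [← Real.sqrt_mul hx]
    refine Real.le_sqrt_of_sq_le ?_
    refine Finset.sum_sq_le_sum_mul_sum_of_sq_le_mul _ (fun i _ => mul_nonneg (hw i) (sq_nonneg _))
      (fun i _ => mul_nonneg (hw i) (sq_nonneg _)) fun i _ => le_of_eq (by ring)
  have h1 : ∑ i, w i * ‖x i + y i‖ ^ 2 ≤
      ∑ i, (w i * ‖x i‖ ^ 2 + w i * ‖y i‖ ^ 2 + 2 * (w i * (‖x i‖ * ‖y i‖))) := by
    refine Finset.sum_le_sum fun i _ => ?_
    have : ‖x i + y i‖ ^ 2 ≤ (‖x i‖ + ‖y i‖) ^ 2 := by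
      gcongr
      exact norm_add_le _ _
    nlinarith [mul_le_mul_of_nonneg_left this (hw i)]
  rw [Finset.sum_add_distrib, Finset.sum_add_distrib, ← Finset.mul_sum] at h1
  rw [add_sq, Real.sq_sqrt hx, Real.sq_sqrt hy]
  linarith

lemma norm_add_sq_le_two (x y : E) : ‖x + y‖ ^ 2 ≤ 2 * ‖x‖ ^ 2 + 2 * ‖y‖ ^ 2 := by
  have := parallelogram_law_with_norm ℝ x y
  nlinarith [sq_nonneg ‖x - y‖]

lemma norm_sum_sq_le_card_mul {κ : Type*} (s : Finset κ) (x : κ → E) :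
    ‖∑ t ∈ s, x t‖ ^ 2 ≤ s.card * ∑ t ∈ s, ‖x t‖ ^ 2 := by
  refine le_trans ?_ (sq_sum_le_card_mul_sum_sq)
  gcongr
  exact norm_sum_le _ _

end Partition

/-! ### Samples of a partition -/

section Sample

variable {E : Type*} [NormedAddCommGroup E] [InnerProductSpace ℝ E] {n k m : ℕ}

/-- The mean of the sample of the part `i`. -/
noncomputable def sampleMean (s : Fin k → Fin m → Fin n) (X : Fin n → E) (i : Fin k) : E :=
  (m : ℝ)⁻¹ • ∑ t, X (s i t)

/-- The cost of the sample, in which the sample of a part represents the mass of the part. -/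
noncomputable def sampleCost (π : Fin n → Fin k) (s : Fin k → Fin m → Fin n) (X : Fin n → E) : ℝ :=
  ∑ i, mass π i * ((m : ℝ)⁻¹ * ∑ t, ‖X (s i t) - sampleMean s X i‖ ^ 2)

/-- The weighted squared distance of the sample means from the means. -/
noncomputable def meanGap (π : Fin n → Fin k) (s : Fin k → Fin m → Fin n) (X : Fin n → E) : ℝ :=
  ∑ i, mass π i * ‖sampleMean s X i - mean π X i‖ ^ 2

/-- A partition of minimal cost together with samples that lie well inside the parts and trade the
accuracy of their means against their cost. -/
structure IsGoodSample (lam : ℝ) (π : Fin n → Fin k) (s : Fin k → Fin m → Fin n)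
    (X : Fin n → E) : Prop where
  minimal : ∀ π' : Fin n → Fin k, partCost π X ≤ partCost π' X
  core : ∀ i t j, j ≠ i → 100 * ‖X (s i t) - mean π X i‖ ^ 2 ≤ ‖mean π X i - mean π X j‖ ^ 2
  gap : m * meanGap π s X + 2 * lam * (sampleCost π s X - partCost π X) ≤ 4 * partCost π X

lemma sampleCost_nonneg (π : Fin n → Fin k) (s : Fin k → Fin m → Fin n) (X : Fin n → E) :
    0 ≤ sampleCost π s X :=
  Finset.sum_nonneg fun _ _ => mul_nonneg (mass_nonneg _ _)
    (mul_nonneg (by positivity) (Finset.sum_nonneg fun _ _ => sq_nonneg _))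

lemma meanGap_nonneg (π : Fin n → Fin k) (s : Fin k → Fin m → Fin n) (X : Fin n → E) :
    0 ≤ meanGap π s X :=
  Finset.sum_nonneg fun _ _ => mul_nonneg (mass_nonneg _ _) (sq_nonneg _)

lemma sum_sub_sampleMean (hm : 0 < m) (s : Fin k → Fin m → Fin n) (X : Fin n → E) (i : Fin k) :
    ∑ t, (X (s i t) - sampleMean s X i) = 0 := by
  have : (m : ℝ) ≠ 0 := by positivity
  rw [Finset.sum_sub_distrib, Finset.sum_const, Finset.card_univ, Fintype.card_fin,
    ← Nat.cast_smul_eq_nsmul ℝ, sampleMean, smul_inv_smul₀ this, sub_self]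

lemma avg_norm_sub_sq (hm : 0 < m) (s : Fin k → Fin m → Fin n) (X : Fin n → E) (i : Fin k) (z : E) :
    (m : ℝ)⁻¹ * ∑ t, ‖X (s i t) - z‖ ^ 2 =
      (m : ℝ)⁻¹ * ∑ t, ‖X (s i t) - sampleMean s X i‖ ^ 2 + ‖sampleMean s X i - z‖ ^ 2 := by
  have : (m : ℝ) ≠ 0 := by positivity
  rw [sum_norm_sub_sq _ _ _ z (sum_sub_sampleMean hm s X i)]
  simp only [Finset.card_univ, Fintype.card_fin]
  field_simp

/-- The sum of squared distances of a sample to centers, one for each part. -/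
lemma sum_mass_mul_avg (hm : 0 < m) (π : Fin n → Fin k) (s : Fin k → Fin m → Fin n)
    (X : Fin n → E) (z : Fin k → E) :
    ∑ i, mass π i * ((m : ℝ)⁻¹ * ∑ t, ‖X (s i t) - z i‖ ^ 2) =
      sampleCost π s X + ∑ i, mass π i * ‖sampleMean s X i - z i‖ ^ 2 := by
  rw [sampleCost, ← Finset.sum_add_distrib]
  refine Finset.sum_congr rfl fun i _ => ?_
  rw [avg_norm_sub_sq hm, mul_add]

/-- A greedy choice of `m` points whose sum is close to `m` times the mean and whose squared distances
to the mean are not too large: neither defect is more than its average, up to trading. -/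
lemma exists_greedy_sample {κ : Type*} (T : Finset κ) (hT : T.Nonempty) (x : κ → E) (v lam : ℝ)
    (h0 : ∑ p ∈ T, x p = 0) (hv : ∑ p ∈ T, ‖x p‖ ^ 2 = T.card * v) (m : ℕ) :
    ∃ s : Fin m → κ, (∀ t, s t ∈ T) ∧
      ‖∑ t, x (s t)‖ ^ 2 + lam * (∑ t, ‖x (s t)‖ ^ 2 - m * v) ≤ m * v := by
  induction m with
  | zero => exact ⟨Fin.elim0, fun t => t.elim0, by simp⟩
  | succ m ih =>
    obtain ⟨s, hs, h⟩ := ih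
    set z := ∑ t, x (s t)
    -- Conditional expectations: for a uniform point of `T` the inner product averages to `0` and
    -- the squared norm to `v`, so some point is no worse than the average.
    obtain ⟨p, hp, hle⟩ : ∃ p ∈ T, 2 * inner ℝ (x p) z + (1 + lam) * ‖x p‖ ^ 2 ≤ (1 + lam) * v := by
      refine Finset.exists_le_of_sum_le hT ?_
      rw [Finset.sum_add_distrib, ← Finset.mul_sum, ← Finset.mul_sum, ← sum_inner, h0, hv,
        inner_zero_left, Finset.sum_const, nsmul_eq_mul]
      exact le_of_eq (by ring)
    refine ⟨Fin.cons p s, fun t => ?_, ?_⟩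
    · refine Fin.cases ?_ (fun t => ?_) t
      · simpa using hp
      · simpa using hs t
    · rw [Fin.sum_univ_succ, Fin.sum_univ_succ]
      simp only [Fin.cons_zero, Fin.cons_succ]
      rw [norm_add_sq_real]
      push_cast
      linarith

/-- The arithmetic of passing from a core to its cluster: `v'` and `v` are their variances, `M` is
the distance of their means, `Bμ` and `B` are the distances of the sample mean from these means. The
shift costs `m M² ≤ 2 m q v`, harmless since `m q` is at most `1/6`; `lam ≤ m` keeps the change of
variance at the same order. -/
lemma sample_tradeoff {m lam q v v' V B M Bμ : ℝ} (hm : 1 ≤ m) (hlam : 0 ≤ lam) (hlm : lam ≤ m)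
    (hq : 0 ≤ q) (hmq : 12 * m * q ≤ 2) (hq6 : q ≤ 1 / 6) (hv : 0 ≤ v) (hv' : 0 ≤ v')
    (hvv : (1 - q) * v' ≤ v)
    (hg : m ^ 2 * Bμ ^ 2 + lam * (V + m * Bμ ^ 2 - m * v') ≤ m * v')
    (hB : B ^ 2 ≤ 2 * Bμ ^ 2 + 2 * M ^ 2) (hM : M ^ 2 ≤ 2 * q * v) :
    m * B ^ 2 + 2 * lam * (m⁻¹ * V - v) ≤ 4 * v := by
  have hm0 : 0 < m := by linarith
  obtain ⟨V', rfl⟩ : ∃ V', V = m * V' := ⟨m⁻¹ * V, (mul_inv_cancel_left₀ hm0.ne' V).symm⟩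
  rw [inv_mul_cancel_left₀ hm0.ne']
  have hg1 : m * Bμ ^ 2 + lam * (V' + Bμ ^ 2 - v') ≤ v' := by
    refine le_of_mul_le_mul_left ?_ hm0
    linarith
  have hv2 : v' ≤ (1 + 2 * q) * v := by
    nlinarith [mul_le_mul_of_nonneg_left hvv (show 0 ≤ 1 + 2 * q by linarith),
      mul_nonneg (mul_nonneg hq (show 0 ≤ 1 - 2 * q by linarith)) hv']
  have hqv : 0 ≤ q * v := mul_nonneg hq hv
  have hlb : 0 ≤ lam * Bμ ^ 2 := mul_nonneg hlam (sq_nonneg _)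
  have h6 : lam * (v' - v) ≤ lam * (2 * (q * v)) :=
    mul_le_mul_of_nonneg_left (by linarith) hlam
  have h7 : lam * (q * v) ≤ m * (q * v) := mul_le_mul_of_nonneg_right hlm hqv
  have h8 : q * v ≤ m * (q * v) := le_mul_of_one_le_left hqv hm
  have h9 : 12 * (m * (q * v)) ≤ 2 * v := by nlinarith
  have h10 := mul_le_mul_of_nonneg_left hB hm0.le
  have h11 := mul_le_mul_of_nonneg_left hM hm0.le
  linarith

/-- Sampling from a large part `T` of a cluster `Q`. -/
lemma exists_sample_of_core {κ : Type*} [DecidableEq κ] (Q T : Finset κ) (hTQ : T ⊆ Q)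
    (x : κ → E) (lam q v : ℝ)
    (m : ℕ) (hm : 0 < m) (hlam : 0 ≤ lam) (hlm : lam ≤ m) (hq : 0 ≤ q) (hmq : 12 * m * q ≤ 2)
    (hQ : Q.Nonempty) (hcard : ((Q \ T).card : ℝ) ≤ q * Q.card) (h0 : ∑ p ∈ Q, x p = 0)
    (hv : ∑ p ∈ Q, ‖x p‖ ^ 2 = Q.card * v) :
    ∃ s : Fin m → κ, (∀ t, s t ∈ T) ∧
      m * ‖(m : ℝ)⁻¹ • ∑ t, x (s t)‖ ^ 2 +
        2 * lam * ((m : ℝ)⁻¹ * ∑ t, ‖x (s t) - (m : ℝ)⁻¹ • ∑ t, x (s t)‖ ^ 2 - v) ≤ 4 * v := by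
  have hm1 : (1 : ℝ) ≤ m := by exact_mod_cast hm
  have hm0 : (m : ℝ) ≠ 0 := by linarith
  have hq6 : q ≤ 1 / 6 := by nlinarith
  have hQc : (0 : ℝ) < Q.card := by exact_mod_cast hQ.card_pos
  have hcs : ((Q \ T).card : ℝ) + T.card = Q.card := by
    exact_mod_cast Finset.card_sdiff_add_card_eq_card hTQ
  have hTc : (1 - q) * Q.card ≤ T.card := by linarith
  have hTc0 : (0 : ℝ) < T.card := lt_of_lt_of_le (mul_pos (by linarith) hQc) hTc
  have hT : T.Nonempty := Finset.card_pos.1 (by exact_mod_cast hTc0)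
  obtain ⟨μ, hTμ⟩ : ∃ μ : E, (T.card : ℝ) • μ = ∑ p ∈ T, x p :=
    ⟨(T.card : ℝ)⁻¹ • ∑ p ∈ T, x p, smul_inv_smul₀ hTc0.ne' _⟩
  have hT0 : ∑ p ∈ T, (x p - μ) = 0 := by
    rw [Finset.sum_sub_distrib, Finset.sum_const, ← hTμ, Nat.cast_smul_eq_nsmul, sub_self]
  obtain ⟨v', hTv⟩ : ∃ v' : ℝ, ∑ p ∈ T, ‖x p - μ‖ ^ 2 = T.card * v' :=
    ⟨_, (mul_inv_cancel_left₀ hTc0.ne' _).symm⟩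
  have hv'0 : 0 ≤ v' := by
    refine nonneg_of_mul_nonneg_right (b := v') ?_ hTc0
    exact hTv ▸ Finset.sum_nonneg fun _ _ => sq_nonneg _
  have hv0 : 0 ≤ v := by
    refine nonneg_of_mul_nonneg_right (b := v) ?_ hQc
    exact hv ▸ Finset.sum_nonneg fun _ _ => sq_nonneg _
  obtain ⟨s, hs, hg⟩ := exists_greedy_sample T hT (fun p => x p - μ) v' lam hT0 hTv m
  refine ⟨s, hs, ?_⟩
  obtain ⟨b, hb⟩ : ∃ b : E, b = (m : ℝ)⁻¹ • ∑ t, x (s t) := ⟨_, rfl⟩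
  have hmb : (m : ℝ) • b = ∑ t, x (s t) := by rw [hb, smul_inv_smul₀ hm0]
  have hsum : ∑ t, (x (s t) - μ) = (m : ℝ) • (b - μ) := by
    rw [Finset.sum_sub_distrib, ← hmb, smul_sub, Finset.sum_const, Finset.card_univ,
      Fintype.card_fin, Nat.cast_smul_eq_nsmul ℝ m μ]
  have hb0 : ∑ t, (x (s t) - b) = 0 := by
    rw [Finset.sum_sub_distrib, ← hmb, Finset.sum_const, Finset.card_univ, Fintype.card_fin,
      Nat.cast_smul_eq_nsmul, sub_self]
  have hpar := sum_norm_sub_sq Finset.univ (fun t => x (s t)) b μ hb0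
  simp only [Finset.card_univ, Fintype.card_fin] at hpar
  rw [hsum, hpar, norm_smul, Real.norm_natCast, mul_pow] at hg
  rw [← hb]
  -- the variance of the core
  have hTx : T.card * v' ≤ Q.card * v := by
    have h1 := sum_norm_sub_sq T x μ 0 hT0
    simp only [sub_zero] at h1
    have h2 : ∑ p ∈ T, ‖x p‖ ^ 2 ≤ ∑ p ∈ Q, ‖x p‖ ^ 2 :=
      Finset.sum_le_sum_of_subset_of_nonneg hTQ fun _ _ _ => sq_nonneg _
    rw [← hTv, ← hv]
    have : 0 ≤ (T.card : ℝ) * ‖μ‖ ^ 2 := mul_nonneg hTc0.le (sq_nonneg _)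
    linarith
  have hv'v : (1 - q) * v' ≤ v := by
    refine le_of_mul_le_mul_left ?_ hQc
    nlinarith [mul_le_mul_of_nonneg_right hTc hv'0]
  -- the shift of the mean
  have hshift : (T.card : ℝ) • μ = -∑ p ∈ Q \ T, x p := by
    rw [hTμ, eq_neg_iff_add_eq_zero, add_comm, Finset.sum_sdiff hTQ, h0]
  have hμ2 : ‖μ‖ ^ 2 ≤ 2 * q * v := by
    have h1 := norm_sum_sq_le_card_mul (Q \ T) x
    rw [← norm_neg, ← hshift, norm_smul, Real.norm_natCast, mul_pow] at h1
    have h2 : ∑ p ∈ Q \ T, ‖x p‖ ^ 2 ≤ Q.card * v := by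
      rw [← hv]
      exact Finset.sum_le_sum_of_subset_of_nonneg Finset.sdiff_subset fun _ _ _ => sq_nonneg _
    have h3 : (T.card : ℝ) ^ 2 * ‖μ‖ ^ 2 ≤ q * Q.card * (Q.card * v) :=
      h1.trans (mul_le_mul hcard h2 (Finset.sum_nonneg fun _ _ => sq_nonneg _)
        (mul_nonneg hq hQc.le))
    have h4 : (5 / 6 * (Q.card : ℝ)) ^ 2 ≤ (T.card : ℝ) ^ 2 :=
      pow_le_pow_left₀ (mul_nonneg (by norm_num) hQc.le)
        ((mul_le_mul_of_nonneg_right (by linarith) hQc.le).trans hTc) 2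
    have h5 := mul_le_mul_of_nonneg_right h4 (sq_nonneg ‖μ‖)
    have h6 : 0 < (Q.card : ℝ) ^ 2 := pow_pos hQc 2
    refine le_of_mul_le_mul_left ?_ h6
    have : 0 ≤ q * v * Q.card ^ 2 := mul_nonneg (mul_nonneg hq hv0) h6.le
    nlinarith
  have hbb : ‖b‖ ^ 2 ≤ 2 * ‖b - μ‖ ^ 2 + 2 * ‖μ‖ ^ 2 := by
    simpa using norm_add_sq_le_two (b - μ) μ
  obtain ⟨V, hV⟩ : ∃ V, V = ∑ t, ‖x (s t) - b‖ ^ 2 := ⟨_, rfl⟩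
  rw [← hV] at hg ⊢
  exact sample_tradeoff hm1 hlam hlm hq hmq hq6 hv0 hv'0 hv'v hg hbb hμ2

/-- The weights of a sample. -/
noncomputable def sampleWeight (π : Fin n → Fin k) (s : Fin k → Fin m → Fin n) (p : Fin n) : ℝ≥0 :=
  ∑ i, ∑ t, if s i t = p then ((fiber π i).card : ℝ≥0) * (m : ℝ≥0)⁻¹ else 0

lemma size_sampleWeight_le (π : Fin n → Fin k) (s : Fin k → Fin m → Fin n) :
    size (sampleWeight π s) ≤ k * m := by
  classical
  have h : (Finset.univ.filter fun p => sampleWeight π s p ≠ 0) ⊆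
      Finset.univ.image fun q : Fin k × Fin m => s q.1 q.2 := by
    intro p hp
    rw [Finset.mem_filter] at hp
    by_contra hcon
    refine hp.2 (Finset.sum_eq_zero fun i _ => Finset.sum_eq_zero fun t _ => if_neg fun h => ?_)
    exact hcon (Finset.mem_image.2 ⟨(i, t), Finset.mem_univ _, h⟩)
  refine (Finset.card_le_card h).trans (Finset.card_image_le.trans ?_)
  simp

lemma sum_sampleWeight_mul (π : Fin n → Fin k) (s : Fin k → Fin m → Fin n) (g : Fin n → ℝ) :
    ∑ p, (sampleWeight π s p : ℝ) * g p = ∑ i, mass π i * ((m : ℝ)⁻¹ * ∑ t, g (s i t)) := by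
  simp only [sampleWeight, NNReal.coe_sum, Finset.sum_mul]
  rw [Finset.sum_comm]
  refine Finset.sum_congr rfl fun i _ => ?_
  rw [Finset.sum_comm, ← mul_assoc, Finset.mul_sum]
  refine Finset.sum_congr rfl fun t _ => ?_
  rw [Finset.sum_eq_single (s i t)]
  · simp [mass]
  · intro p _ hp
    simp [hp.symm]
  · simp

end Sample

/-! ### Costs and ratios as real numbers -/

section Ratio

variable {n d k m : ℕ}

lemma cost_eq_ofReal (w : Fin n → ℝ≥0) (X : Dataset n d) {C : Finset (Pt d)} (hC : C.Nonempty) :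
    cost w X C = ENNReal.ofReal (∑ p, (w p : ℝ) * Metric.infDist (X p) C ^ 2) := by
  rw [ENNReal.ofReal_sum_of_nonneg fun p _ => by positivity]
  refine Finset.sum_congr rfl fun p _ => ?_
  have h : Metric.infEDist (X p) (C : Set (Pt d)) ≠ ⊤ :=
    Metric.infEDist_ne_top (by simpa using hC)
  rw [ENNReal.ofReal_mul (by positivity), ENNReal.ofReal_pow Metric.infDist_nonneg,
    Metric.infDist, ENNReal.ofReal_toReal h, ENNReal.ofReal_coe_nnreal]

lemma cost_one_le (X : Dataset n d) {C : Finset (Pt d)} (z : Fin n → Pt d) (hz : ∀ i, z i ∈ C)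
    (hC : C.Nonempty) :
    cost 1 X C ≤ ENNReal.ofReal (∑ p, ‖X p - z p‖ ^ 2) := by
  rw [cost_eq_ofReal _ _ hC]
  refine ENNReal.ofReal_le_ofReal (Finset.sum_le_sum fun p _ => ?_)
  simp only [Pi.one_apply, NNReal.coe_one, one_mul]
  gcongr
  · exact Metric.infDist_nonneg
  · rw [← dist_eq_norm]
    exact Metric.infDist_le_dist_of_mem (by simpa using hz p)

lemma exists_enumeration {C : Finset (Pt d)} (hC : C.card = k) :
    ∃ c : Fin k → Pt d, Function.Injective c ∧ ∀ x, x ∈ C ↔ ∃ i, c i = x := by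
  refine ⟨fun i => ((C.equivFinOfCardEq hC).symm i : Pt d), fun i j h => ?_, fun x => ⟨fun h => ?_, ?_⟩⟩
  · simpa using Subtype.ext h
  · exact ⟨C.equivFinOfCardEq hC ⟨x, h⟩, by simp⟩
  · rintro ⟨i, rfl⟩
    exact ((C.equivFinOfCardEq hC).symm i).2

lemma exists_nearest_center (X : Dataset n d) (hk : 0 < k) (c : Fin k → Pt d) :
    ∃ f : Fin n → Fin k, ∀ p j, ‖X p - c (f p)‖ ≤ ‖X p - c j‖ := by
  have : Nonempty (Fin k) := ⟨⟨0, hk⟩⟩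
  have h : ∀ p, ∃ i, ∀ j, ‖X p - c i‖ ≤ ‖X p - c j‖ := fun p =>
    Finite.exists_min fun i => ‖X p - c i‖
  choose f hf using h
  exact ⟨f, hf⟩

lemma infDist_eq_of_nearest {C : Finset (Pt d)} {c : Fin k → Pt d} (hc : ∀ x, x ∈ C ↔ ∃ i, c i = x)
    {x : Pt d} {i : Fin k} (h : ∀ j, ‖x - c i‖ ≤ ‖x - c j‖) :
    Metric.infDist x (C : Set (Pt d)) = ‖x - c i‖ := by
  have hi : c i ∈ (C : Set (Pt d)) := by simpa using (hc _).2 ⟨i, rfl⟩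
  refine le_antisymm ?_ ?_
  · rw [← dist_eq_norm]
    exact Metric.infDist_le_dist_of_mem hi
  · rw [Metric.le_infDist ⟨_, hi⟩]
    intro y hy
    obtain ⟨j, rfl⟩ := (hc y).1 (by simpa using hy)
    rw [dist_eq_norm]
    exact h j

lemma cost_one_eq {C : Finset (Pt d)} (X : Dataset n d) (c : Fin k → Pt d)
    (hc : ∀ x, x ∈ C ↔ ∃ i, c i = x) (hk : 0 < k) (f : Fin n → Fin k)
    (hf : ∀ p j, ‖X p - c (f p)‖ ≤ ‖X p - c j‖) :
    cost 1 X C = ENNReal.ofReal (∑ p, ‖X p - c (f p)‖ ^ 2) := by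
  rw [cost_eq_ofReal _ _ ⟨c ⟨0, hk⟩, (hc _).2 ⟨_, rfl⟩⟩]
  congr 1
  refine Finset.sum_congr rfl fun p _ => ?_
  rw [infDist_eq_of_nearest hc (hf p)]
  simp

lemma partCost_le_opt {π : Fin n → Fin k} {X : Dataset n d} (hk : 0 < k)
    (h : ∀ π' : Fin n → Fin k, partCost π X ≤ partCost π' X) :
    ENNReal.ofReal (partCost π X) ≤ opt 1 X k := by
  refine le_iInf₂ fun C hC => ?_
  obtain ⟨c, -, hc⟩ := exists_enumeration hC
  obtain ⟨f, hf⟩ := exists_nearest_center X hk c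
  rw [cost_one_eq X c hc hk f hf]
  exact ENNReal.ofReal_le_ofReal ((h f).trans (partCost_le f X c))

lemma ratio_le {w : Fin n → ℝ≥0} {X : Dataset n d} {C : Finset (Pt d)} {x : ℝ} (hx : 1 ≤ x)
    (hopt : opt w X k ≠ ⊤) (h : cost w X C ≤ ENNReal.ofReal x * opt w X k) :
    ratio w X k C ≤ ENNReal.ofReal x := by
  rw [ratio]
  split_ifs with h1
  · simpa using ENNReal.ofReal_le_ofReal hx
  · exact (ENNReal.div_le_iff_le_mul (Or.inr ENNReal.ofReal_ne_top) (Or.inl hopt)).2 h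

lemma cost_le_of_ratio_le {w : Fin n → ℝ≥0} {X : Dataset n d} {C : Finset (Pt d)} {x : ℝ}
    (hx : 1 ≤ x) (hopt : opt w X k ≠ ⊤) (h : ratio w X k C ≤ ENNReal.ofReal x) :
    cost w X C ≤ ENNReal.ofReal x * opt w X k := by
  rw [ratio] at h
  split_ifs at h with h1
  · rw [h1]
    exact le_mul_of_one_le_left (by simp) (by simpa using ENNReal.ofReal_le_ofReal hx)
  · exact (ENNReal.div_le_iff_le_mul (Or.inr ENNReal.ofReal_ne_top) (Or.inl hopt)).1 h

/-- Replacing the optimum by the upper bound `V` only decreases the quotient. In the branch where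
`C` is optimal the ratio is `1` by convention, and then `y V = 0` forces `y = 0`, by `hVy` if `V =
0`. -/
lemma le_ratio {w : Fin n → ℝ≥0} {X : Dataset n d} {C : Finset (Pt d)} {V y : ℝ} (hV : 0 ≤ V)
    (hy : 0 ≤ y) (hVy : V = 0 → y = 0) (hcost : cost w X C = ENNReal.ofReal (V + y * V))
    (hCk : C.card = k) (hopt : opt w X k ≤ ENNReal.ofReal V) :
    ENNReal.ofReal (1 + y) ≤ ratio w X k C := by
  rw [ratio]
  split_ifs with h1
  · rw [← h1, hcost, ENNReal.ofReal_le_ofReal_iff hV] at hopt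
    have : y = 0 := by
      by_contra hne
      have hV0 : V ≠ 0 := fun h => hne (hVy h)
      have : 0 < y * V := mul_pos (lt_of_le_of_ne hy (Ne.symm hne)) (lt_of_le_of_ne hV hV0.symm)
      linarith
    simp [this]
  · have hle : opt w X k ≤ cost w X C := iInf₂_le C hCk
    have hc0 : cost w X C ≠ 0 := fun h0 => h1 (by rw [h0] at hle ⊢; exact (le_antisymm hle bot_le).symm)
    rw [ENNReal.le_div_iff_mul_le (Or.inr hc0) (Or.inr (hcost ▸ ENNReal.ofReal_ne_top)), hcost]
    calc _ ≤ ENNReal.ofReal (1 + y) * ENNReal.ofReal V := by gcongr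
      _ = _ := by rw [← ENNReal.ofReal_mul (by linarith)]; congr 1; ring

/-! ### Center sets that are good for a sample -/

lemma cost_sampleWeight (π : Fin n → Fin k) (s : Fin k → Fin m → Fin n) (X : Dataset n d)
    {C : Finset (Pt d)} (hC : C.Nonempty) :
    cost (sampleWeight π s) X C = ENNReal.ofReal
      (∑ i, mass π i * ((m : ℝ)⁻¹ * ∑ t, Metric.infDist (X (s i t)) C ^ 2)) := by
  rw [cost_eq_ofReal _ _ hC, sum_sampleWeight_mul π s fun p => Metric.infDist (X p) C ^ 2]

lemma norm_sub_le_of_core {π : Fin n → Fin k} {s : Fin k → Fin m → Fin n} {X : Dataset n d}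
    (hcore : ∀ i t j, j ≠ i →
      100 * ‖X (s i t) - mean π X i‖ ^ 2 ≤ ‖mean π X i - mean π X j‖ ^ 2)
    {i j : Fin k} (hij : j ≠ i) (t : Fin m) :
    ‖X (s i t) - mean π X i‖ ≤ ‖mean π X i - mean π X j‖ / 10 := by
  have h := hcore i t j hij
  refine (sq_le_sq₀ (norm_nonneg _) (by positivity)).1 ?_
  rw [div_pow]
  linarith

/-- A center set of small cost has exactly one center near every sampled part. -/
lemma exists_center_assignment (hm : 0 < m) {π : Fin n → Fin k} {s : Fin k → Fin m → Fin n}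
    {X : Dataset n d} {V : ℝ}
    (hcore : ∀ i t j, j ≠ i →
      100 * ‖X (s i t) - mean π X i‖ ^ 2 ≤ ‖mean π X i - mean π X j‖ ^ 2)
    (hW : ∀ i, 0 < mass π i) (hne : ∀ i j, j ≠ i → mean π X i ≠ mean π X j)
    (hsep : ∀ i j, j ≠ i → 800 * V ≤ mass π i * ‖mean π X i - mean π X j‖ ^ 2)
    {C : Finset (Pt d)} (hC : C.card = k) (hk : 0 < k)
    (hcost : ∑ i, mass π i * ((m : ℝ)⁻¹ * ∑ t, Metric.infDist (X (s i t)) C ^ 2) ≤ 2 * V) :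
    ∃ z : Fin k → Pt d, (∀ i, z i ∈ C) ∧
      ∀ i t, Metric.infDist (X (s i t)) (C : Set (Pt d)) = ‖X (s i t) - z i‖ := by
  have hCne : (C : Set (Pt d)).Nonempty := by
    simpa using Finset.card_pos.1 (by omega)
  have hm0 : (0 : ℝ) < m := by exact_mod_cast hm
  -- In units of the distance to another mean: some sample point has a center within `√(2/800) =
  -- 1/20`, and sample points are within `1/10` of their mean, in total `3/20`.
  have hex : ∀ i, ∃ z ∈ C, ∀ j, j ≠ i →
      ‖mean π X i - z‖ ≤ 3 / 20 * ‖mean π X i - mean π X j‖ := by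
    intro i
    have h1 : mass π i * ((m : ℝ)⁻¹ * ∑ t, Metric.infDist (X (s i t)) C ^ 2) ≤ 2 * V :=
      (Finset.single_le_sum (f := fun i => mass π i *
        ((m : ℝ)⁻¹ * ∑ t, Metric.infDist (X (s i t)) C ^ 2))
        (fun i _ => mul_nonneg (mass_nonneg _ _) (by positivity)) (Finset.mem_univ i)).trans hcost
    obtain ⟨t, -, ht⟩ : ∃ t ∈ (Finset.univ : Finset (Fin m)),
        Metric.infDist (X (s i t)) C ^ 2 ≤ 2 * V / mass π i := by
      refine Finset.exists_le_of_sum_le ⟨⟨0, hm⟩, Finset.mem_univ _⟩ ?_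
      rw [Finset.sum_const, Finset.card_univ, Fintype.card_fin, nsmul_eq_mul]
      have h2 : (m : ℝ)⁻¹ * ∑ t, Metric.infDist (X (s i t)) C ^ 2 ≤ 2 * V / mass π i := by
        rw [le_div_iff₀ (hW i)]
        linarith
      rwa [inv_mul_le_iff₀ hm0] at h2
    obtain ⟨z, hz, hzd⟩ := C.finite_toSet.isCompact.exists_infDist_eq_dist hCne (X (s i t))
    refine ⟨z, by simpa using hz, fun j hj => ?_⟩
    have h3 := norm_sub_le_of_core hcore hj t
    have h4 : ‖X (s i t) - z‖ ≤ ‖mean π X i - mean π X j‖ / 20 := by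
      refine (sq_le_sq₀ (norm_nonneg _) (by positivity)).1 ?_
      rw [← dist_eq_norm, ← hzd]
      refine ht.trans ?_
      rw [div_le_iff₀ (hW i)]
      linarith [hsep i j hj]
    have h5 : ‖mean π X i - z‖ ≤ ‖X (s i t) - mean π X i‖ + ‖X (s i t) - z‖ := by
      rw [norm_sub_rev (X (s i t)) (mean π X i)]
      exact norm_sub_le_norm_sub_add_norm_sub _ _ _
    linarith
  choose z hzC hz using hex
  have hDpos : ∀ i j, j ≠ i → 0 < ‖mean π X i - mean π X j‖ := fun i j h =>
    norm_pos_iff.2 (sub_ne_zero.2 (hne i j h))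
  have hzinj : Function.Injective z := by
    intro i j hij
    by_contra hne'
    have h1 := hz i j (Ne.symm hne')
    have h2 := hz j i hne'
    rw [norm_sub_rev (mean π X j) (mean π X i)] at h2
    have h3 : ‖mean π X i - mean π X j‖ ≤ ‖mean π X i - z i‖ + ‖mean π X j - z j‖ := by
      rw [hij, norm_sub_rev (mean π X j) (z j)]
      exact norm_sub_le_norm_sub_add_norm_sub _ _ _
    linarith [hDpos i j (Ne.symm hne')]
  -- The `z i` are `k` distinct elements of `C`, so there are no further centers that could compete
  -- for a sample point.
  have himg : ∀ x, x ∈ C ↔ ∃ i, z i = x := by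
    have : Finset.univ.image z = C := by
      refine Finset.eq_of_subset_of_card_le (fun x hx => ?_) ?_
      · obtain ⟨i, -, rfl⟩ := Finset.mem_image.1 hx
        exact hzC i
      · rw [Finset.card_image_of_injective _ hzinj, hC]; simp
    intro x
    rw [← this]
    simp
  refine ⟨z, hzC, fun i t => infDist_eq_of_nearest himg fun j => ?_⟩
  -- The own center is within `1/10 + 3/20 = 1/4` of the distance between the two means, any other
  -- one is at least `1 - 1/4 = 3/4` away.
  by_cases hij : j = i
  · rw [hij]
  · have h1 := hz i j hij
    have h2 := hz j i (Ne.symm hij)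
    rw [norm_sub_rev (mean π X j) (mean π X i)] at h2
    have h3 := norm_sub_le_of_core hcore hij t
    have h4 : ‖X (s i t) - z i‖ ≤ ‖X (s i t) - mean π X i‖ + ‖mean π X i - z i‖ :=
      norm_sub_le_norm_sub_add_norm_sub _ _ _
    have h5 : ‖mean π X i - mean π X j‖ ≤
        ‖mean π X i - X (s i t)‖ + ‖X (s i t) - z j‖ + ‖z j - mean π X j‖ :=
      (norm_sub_le_norm_sub_add_norm_sub _ (z j) _).trans
        (add_le_add_left (norm_sub_le_norm_sub_add_norm_sub _ _ _) _)
    rw [norm_sub_rev (mean π X i) (X (s i t)), norm_sub_rev (z j)] at h5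
    linarith [hDpos i j hij]

/-- The sample means serve as centers. The core condition keeps them distinct, which matters because
the optimum is over sets of exactly `k` points. -/
lemma opt_sampleWeight_le (hm : 0 < m) {π : Fin n → Fin k} {s : Fin k → Fin m → Fin n}
    {X : Dataset n d}
    (hcore : ∀ i t j, j ≠ i →
      100 * ‖X (s i t) - mean π X i‖ ^ 2 ≤ ‖mean π X i - mean π X j‖ ^ 2)
    (hne : ∀ i j, j ≠ i → mean π X i ≠ mean π X j) (hk : 0 < k) :
    opt (sampleWeight π s) X k ≤ ENNReal.ofReal (sampleCost π s X) := by
  classical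
  have hm0 : (0 : ℝ) < m := by exact_mod_cast hm
  have hb : ∀ i j, j ≠ i → ‖sampleMean s X i - mean π X i‖ ≤ ‖mean π X i - mean π X j‖ / 10 := by
    intro i j hij
    have h1 : sampleMean s X i - mean π X i = (m : ℝ)⁻¹ • ∑ t, (X (s i t) - mean π X i) := by
      rw [Finset.sum_sub_distrib, smul_sub, Finset.sum_const, Finset.card_univ, Fintype.card_fin,
        ← Nat.cast_smul_eq_nsmul ℝ, inv_smul_smul₀ hm0.ne', sampleMean]
    rw [h1, norm_smul, norm_inv, Real.norm_natCast, inv_mul_le_iff₀ hm0]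
    refine (norm_sum_le _ _).trans ((Finset.sum_le_sum fun t _ =>
      norm_sub_le_of_core hcore hij t).trans ?_)
    simp
  have hinj : Function.Injective (sampleMean s X) := by
    intro i j hij
    by_contra hne'
    have h1 := hb i j (Ne.symm hne')
    have h2 := hb j i hne'
    rw [norm_sub_rev (mean π X j) (mean π X i), ← hij] at h2
    have h3 := norm_sub_le_norm_sub_add_norm_sub (mean π X i) (sampleMean s X i) (mean π X j)
    rw [norm_sub_rev (mean π X i) (sampleMean s X i)] at h3
    have := norm_pos_iff.2 (sub_ne_zero.2 (hne i j (Ne.symm hne')))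
    linarith
  have hcard : (Finset.univ.image (sampleMean s X)).card = k := by
    rw [Finset.card_image_of_injective _ hinj]; simp
  have hle : opt (sampleWeight π s) X k ≤
      cost (sampleWeight π s) X (Finset.univ.image (sampleMean s X)) :=
    iInf₂_le (f := fun (C : Finset (Pt d)) (_ : C.card = k) => cost (sampleWeight π s) X C) _ hcard
  refine hle.trans ?_
  rw [cost_sampleWeight _ _ _ (Finset.card_pos.1 (by omega)), sampleCost]
  refine ENNReal.ofReal_le_ofReal (Finset.sum_le_sum fun i _ => ?_)
  refine mul_le_mul_of_nonneg_left ?_ (mass_nonneg _ _)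
  refine mul_le_mul_of_nonneg_left (Finset.sum_le_sum fun t _ => ?_) (by positivity)
  refine pow_le_pow_left₀ Metric.infDist_nonneg ?_ 2
  rw [← dist_eq_norm]
  exact Metric.infDist_le_dist_of_mem (by simp)

/-- The structure of a center set that is `α`-approximate for a sample. -/
lemma approxCenters_structure (hm : 0 < m) {π : Fin n → Fin k} {s : Fin k → Fin m → Fin n}
    {X : Dataset n d}
    (hcore : ∀ i t j, j ≠ i →
      100 * ‖X (s i t) - mean π X i‖ ^ 2 ≤ ‖mean π X i - mean π X j‖ ^ 2)
    (hW : ∀ i, 0 < mass π i) (hne : ∀ i j, j ≠ i → mean π X i ≠ mean π X j)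
    (hsep : ∀ i j, j ≠ i → 800 * sampleCost π s X ≤ mass π i * ‖mean π X i - mean π X j‖ ^ 2)
    (hk : 0 < k) {α : ℝ} (hα : 1 ≤ α) (hα2 : α ≤ 2) {C : Finset (Pt d)}
    (hC : C ∈ approxCenters (sampleWeight π s) X k α) :
    ∃ z : Fin k → Pt d, (∀ i, z i ∈ C) ∧ ∃ y, 0 ≤ y ∧ y ≤ α - 1 ∧
      ∑ i, mass π i * ‖sampleMean s X i - z i‖ ^ 2 = y * sampleCost π s X ∧
      ENNReal.ofReal (1 + y) ≤ ratio (sampleWeight π s) X k C := by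
  obtain ⟨hCk, hr⟩ := hC
  have hCne : C.Nonempty := Finset.card_pos.1 (by omega)
  have hopt := opt_sampleWeight_le hm hcore hne hk
  have hV := sampleCost_nonneg π s X
  have hcost := cost_le_of_ratio_le hα (hopt.trans_lt ENNReal.ofReal_lt_top).ne hr
  have hcost' : cost (sampleWeight π s) X C ≤ ENNReal.ofReal (α * sampleCost π s X) := by
    rw [ENNReal.ofReal_mul (by linarith)]
    exact hcost.trans (by gcongr)
  rw [cost_sampleWeight _ _ _ hCne,
    ENNReal.ofReal_le_ofReal_iff (mul_nonneg (by linarith) hV)] at hcost'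
  obtain ⟨z, hzC, hz⟩ := exists_center_assignment hm hcore hW hne hsep hCk hk
    (hcost'.trans (mul_le_mul_of_nonneg_right hα2 hV))
  simp only [hz] at hcost'
  rw [sum_mass_mul_avg hm] at hcost'
  set U := ∑ i, mass π i * ‖sampleMean s X i - z i‖ ^ 2 with hU
  have hU0 : 0 ≤ U := Finset.sum_nonneg fun i _ => mul_nonneg (mass_nonneg _ _) (sq_nonneg _)
  -- If the sample cost vanishes, the quotient is `0` by default, and `U = 0` because the cost of
  -- `C` is at most `α` times it.
  have hyU : U = U / sampleCost π s X * sampleCost π s X := by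
    by_cases h0 : sampleCost π s X = 0
    · rw [h0] at hcost' ⊢
      simp only [mul_zero]
      linarith
    · rw [div_mul_cancel₀ _ h0]
  have hy0 : 0 ≤ U / sampleCost π s X := div_nonneg hU0 hV
  refine ⟨z, hzC, U / sampleCost π s X, hy0, ?_, hyU, ?_⟩
  · refine div_le_of_le_mul₀ hV (by linarith) ?_
    linarith
  · refine le_ratio hV hy0 (fun h => by rw [h, div_zero]) ?_ hCk hopt
    rw [cost_sampleWeight _ _ _ hCne]
    simp only [hz]
    rw [sum_mass_mul_avg hm, ← hU, ← hyU]

end Ratio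

/-! ### From a good sample to the error bounds -/

lemma errAlpha_le {n d k : ℕ} {w : Fin n → ℝ≥0} {X Y : Dataset n d} {α x : ℝ} (hx : 0 ≤ x)
    (h : ∀ C ∈ approxCenters w X k α,
      ratio 1 Y k C ≤ ENNReal.ofReal (1 + x) * ratio w X k C) :
    errAlpha w X Y k α ≤ (x : EReal) := by
  have h1 : (⨆ C ∈ approxCenters w X k α, ratio 1 Y k C / ratio w X k C) ≤
      ENNReal.ofReal (1 + x) :=
    iSup₂_le fun C hC => ENNReal.div_le_of_le_mul (h C hC)
  have h2 : ((⨆ C ∈ approxCenters w X k α, ratio 1 Y k C / ratio w X k C : ℝ≥0∞) : EReal) ≤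
      ((1 + x : ℝ) : EReal) := by
    refine (EReal.coe_ennreal_le_coe_ennreal_iff.2 h1).trans ?_
    rw [EReal.coe_ennreal_ofReal, max_eq_left (by linarith)]
  rw [errAlpha]
  refine EReal.sub_le_of_le_add ?_
  refine h2.trans (le_of_eq ?_)
  rw [add_comm]
  norm_cast

lemma quality_le {n d k : ℕ} {w : Fin n → ℝ≥0} {X Y : Dataset n d} {α x : ℝ} (hx : 0 ≤ x)
    (h : ∀ C ∈ approxCenters w X k α,
      ratio 1 Y k C ≤ ENNReal.ofReal (1 + x) * ratio w X k C) :
    quality w X Y k α ≤ ENNReal.ofReal ((1 + x) * α) := by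
  refine iSup₂_le fun C hC => (h C hC).trans ?_
  rw [ENNReal.ofReal_mul (by linarith)]
  gcongr
  exact hC.2

/-- Trading the gap of the means against the cost of the sample. -/
lemma sq_add_le_of_tradeoff {y a e lam m V Φ G : ℝ} (he : 0 < e) (hy : 0 ≤ y) (hya : y ≤ a)
    (hlam : lam = 2 + 8 * a / e) (hm : 16 * (4 + 2 * lam) ≤ e * m) (hV : 0 ≤ V) (hΦ : 0 ≤ Φ)
    (hG : 0 ≤ G) (h : m * G + 2 * lam * (V - Φ) ≤ 4 * Φ) :
    (√(y * V) + √G) ^ 2 ≤ (y + e) * Φ := by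
  have hlam2 : 2 ≤ lam := by
    rw [hlam]
    have : 0 ≤ 8 * a / e := by
      have : 0 ≤ a := hy.trans hya
      positivity
    linarith
  have hlame : 8 * a ≤ lam * e := by
    rw [hlam, add_mul, div_mul_cancel₀ _ he.ne']
    linarith
  have hm0 : 0 < m := by
    by_contra hcon
    have : e * m ≤ 0 := mul_nonpos_of_nonneg_of_nonpos he.le (not_lt.1 hcon)
    linarith
  have hyV : 0 ≤ y * V := mul_nonneg hy hV
  obtain ⟨u, hu⟩ : ∃ u, u = y / e := ⟨_, rfl⟩
  have hyu : y = u * e := by rw [hu, div_mul_cancel₀ _ he.ne']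
  have hu0 : 0 ≤ u := hu ▸ div_nonneg hy he.le
  -- Weighted AM-GM: with `y = u e`, the product of the two terms on the right is `y V G`.
  have hamgm : √(y * V) * √G ≤ (e * V / 4 + 4 * u * G) / 2 := by
    rw [← Real.sqrt_mul hyV]
    refine Real.sqrt_le_iff.2 ⟨by positivity, ?_⟩
    rw [hyu]
    nlinarith [sq_nonneg (e * V / 4 - 4 * u * G)]
  rw [add_sq, Real.sq_sqrt hyV, Real.sq_sqrt hG]
  obtain ⟨c, hc⟩ : ∃ c, c = (1 + 4 * u) / m := ⟨_, rfl⟩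
  have hc0 : 0 ≤ c := hc ▸ by positivity
  have hcm : c * m = 1 + 4 * u := by rw [hc, div_mul_cancel₀ _ hm0.ne']
  have h1 : (1 + 4 * u) * G ≤ c * (4 * Φ + 2 * lam * Φ - 2 * lam * V) := by
    rw [← hcm, mul_assoc]
    exact mul_le_mul_of_nonneg_left (by linarith) hc0
  have h2 : 16 * (c * (4 + 2 * lam)) ≤ e + 4 * y := by
    have := mul_le_mul_of_nonneg_left hm hc0
    have h3 : c * (e * m) = e + 4 * y := by rw [hyu]; linear_combination e * hcm
    linarith
  have hVle : lam * V ≤ (lam + 2) * Φ := by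
    have : 0 ≤ m * G := mul_nonneg hm0.le hG
    linarith
  -- After `G` is eliminated the left side is linear in `V`, so only the ends of the range of `V`
  -- matter: `V = 0` for a nonpositive slope, `V = (1 + 2 / lam) Φ` otherwise. At the latter the
  -- terms with `c` cancel, and `lam e ≥ 8 a` absorbs the excess of `V` over `Φ`.
  have key : V * (y + e / 4) + c * (4 * Φ + 2 * lam * Φ - 2 * lam * V) ≤ (y + e) * Φ := by
    by_cases hs : y + e / 4 - 2 * c * lam ≤ 0
    · have h3 : V * (y + e / 4 - 2 * c * lam) ≤ 0 := mul_nonpos_of_nonneg_of_nonpos hV hs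
      have h4 := mul_le_mul_of_nonneg_right h2 hΦ
      have h5 : 0 ≤ y * Φ := mul_nonneg hy hΦ
      have h6 : 0 ≤ e * Φ := mul_nonneg he.le hΦ
      linarith
    · have h3 := mul_le_mul_of_nonneg_right hVle (not_le.1 hs).le
      have h4 : 2 * (y + e / 4) ≤ lam * (3 * e / 4) := by nlinarith
      have h5 := mul_le_mul_of_nonneg_right h4 hΦ
      have hlam0 : 0 < lam := by linarith
      refine le_of_mul_le_mul_left ?_ hlam0
      nlinarith
  have h7 : y * V + e * V / 4 + (1 + 4 * u) * G ≤ (y + e) * Φ := by linarith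
  linarith

/-- All quantities are relative to the optimum of the clean data: `φ` is the observed partition
cost, `g` the distance of the observed means from the centers, `f` the noise in the means, `τ` and
`ϑ` the noise levels `σ² n d` and `σ² k d`. The cross term `g f` is split by `g ≤ 21 √a + √(e φ)`:
the first part yields the terms with `√(α - 1)`, the second is absorbed into `ε` and `f²`. -/
lemma noise_tradeoff {y a e ε τ ϑ rϑ ra g f φ : ℝ} (hy : 0 ≤ y) (hya : y ≤ a) (ha : a ≤ 1)
    (he : e = ε / 2000) (hε : 0 ≤ ε) (hτ : 0 ≤ τ) (hτ1 : τ ≤ 1) (hrϑ : 0 ≤ rϑ) (hϑ : rϑ ^ 2 = ϑ)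
    (hra : 0 ≤ ra) (hraa : ra ^ 2 = a) (hg : 0 ≤ g) (hf : 0 ≤ f) (hφ : 0 ≤ φ)
    (hgφ : g ^ 2 ≤ (y + e) * φ) (hfb : f ≤ 40 * rϑ + ra * τ) (hφ1 : φ ≤ 1 + 40 * rϑ + 400 * τ)
    (hφ2 : φ ≤ 441) :
    25 * (a * τ ^ 2) + (g + f) ^ 2 ≤ y + ε + 8000 * (ϑ + ra / 2 * (rϑ + τ)) := by
  have he0 : 0 ≤ e := by rw [he]; positivity
  have ha0 : 0 ≤ a := hy.trans hya
  have hra1 : ra ≤ 1 := (sq_le_one_iff₀ hra).1 (hraa ▸ ha)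
  have hara : a ≤ ra := by
    rw [← hraa, sq]
    exact mul_le_of_le_one_left hra hra1
  have hyφ : 0 ≤ y * φ := mul_nonneg hy hφ
  have heφ : 0 ≤ e * φ := mul_nonneg he0 hφ
  have h1 : √(y * φ) ≤ 21 * ra := by
    refine Real.sqrt_le_iff.2 ⟨by positivity, ?_⟩
    rw [mul_pow, hraa]
    have := mul_le_mul hya hφ2 hφ ha0
    linarith
  have h2 : g ≤ √(y * φ) + √(e * φ) := by
    refine (sq_le_sq₀ hg (by positivity)).1 (hgφ.trans ?_)
    rw [add_sq, Real.sq_sqrt hyφ, Real.sq_sqrt heφ]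
    have : 0 ≤ 2 * √(y * φ) * √(e * φ) := by positivity
    linarith
  obtain ⟨r, hr⟩ : ∃ r, r = √(e * φ) := ⟨_, rfl⟩
  have hrr : r ^ 2 = e * φ := hr ▸ Real.sq_sqrt heφ
  rw [← hr] at h2
  have h3 : g * f ≤ 21 * (ra * f) + r * f := by
    have := mul_le_mul_of_nonneg_right (h2.trans (add_le_add_left h1 _)) hf
    linarith
  have h4 : 2 * (r * f) ≤ e * φ + f ^ 2 := by linarith [sq_nonneg (r - f)]
  have hrt : 0 ≤ ra * τ := mul_nonneg hra hτ
  have hrr' : 0 ≤ ra * rϑ := mul_nonneg hra hrϑ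
  have h5 : f ^ 2 ≤ 3200 * ϑ + 2 * (ra * τ) := by
    have h51 : f ^ 2 ≤ (40 * rϑ + ra * τ) ^ 2 := pow_le_pow_left₀ hf hfb 2
    have h52 : (ra * τ) ^ 2 ≤ ra * τ :=
      pow_le_of_le_one hrt (mul_le_one₀ hra1 hτ hτ1) two_ne_zero
    linarith [sq_nonneg (40 * rϑ - ra * τ)]
  have h6 : ra * f ≤ 40 * (ra * rϑ) + ra * τ := by
    have h61 := mul_le_mul_of_nonneg_left hfb hra
    have h62 : ra * (ra * τ) ≤ ra * τ := mul_le_of_le_one_left hrt hra1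
    linarith
  have h7 : y * φ ≤ y + 40 * (ra * rϑ) + 400 * (ra * τ) := by
    have h71 := mul_le_mul_of_nonneg_left hφ1 hy
    have h72 : y * rϑ ≤ ra * rϑ := mul_le_mul_of_nonneg_right (hya.trans hara) hrϑ
    have h73 : y * τ ≤ ra * τ := mul_le_mul_of_nonneg_right (hya.trans hara) hτ
    linarith
  have h8 : e * φ ≤ ε / 4 := by
    have := mul_le_mul_of_nonneg_left hφ2 he0
    linarith
  have h9 : a * τ ^ 2 ≤ ra * τ :=
    mul_le_mul hara (pow_le_of_le_one hτ hτ1 two_ne_zero) (sq_nonneg _) hra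
  have hϑ0 : 0 ≤ ϑ := hϑ ▸ sq_nonneg _
  linarith

section Conclusion

variable {n d k m : ℕ}

/-- The errors of a sample, in terms of the cost of its partition for the clean and the observed data
and the noise in the means. -/
lemma ratio_le_of_isGoodSample (hm : 0 < m) (hk : 0 < k) {π : Fin n → Fin k}
    {s : Fin k → Fin m → Fin n} {P X ξ : Dataset n d} (hX : X = fun p => P p + ξ p)
    {α ε e lam O τ ϑ : ℝ} (hε : 0 < ε) (he : e = ε / 2000) (hα : 1 ≤ α) (hα2 : α ≤ 2)
    (hlam : lam = 2 + 8 * (α - 1) / e) (hem : 16 * (4 + 2 * lam) ≤ e * m)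
    (hgood : IsGoodSample lam π s X)
    (hW : ∀ i, 0 < mass π i) (hne : ∀ i j, j ≠ i → mean π X i ≠ mean π X j)
    (hsep : ∀ i j, j ≠ i → 800 * sampleCost π s X ≤ mass π i * ‖mean π X i - mean π X j‖ ^ 2)
    (hO : 0 < O) (hopt : opt 1 P k = ENNReal.ofReal O) (hτ : 0 ≤ τ) (hτ1 : τ ≤ 1) (hϑ : 0 ≤ ϑ)
    (hΦ : partCost π X ≤ (1 + 40 * √ϑ + 400 * τ) * O) (hΦ2 : partCost π X ≤ 441 * O)
    (hP : partCost π P ≤ (1 + 25 * ((α - 1) * τ ^ 2)) * O)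
    (hF : ∑ i, mass π i * ‖mean π ξ i‖ ^ 2 ≤ (1600 * ϑ + (α - 1) * τ ^ 2) * O)
    {C : Finset (Pt d)} (hC : C ∈ approxCenters (sampleWeight π s) X k α) :
    ratio 1 X k C ≤ ENNReal.ofReal (1 + ε) * ratio (sampleWeight π s) X k C ∧
    ratio 1 P k C ≤ ENNReal.ofReal (1 + (ε + 8000 * (ϑ + √(α - 1) / 2 * (√ϑ + τ)))) *
      ratio (sampleWeight π s) X k C := by
  obtain ⟨z, hzC, y, hy, hyα, hU, hr⟩ :=
    approxCenters_structure hm hgood.core hW hne hsep hk hα hα2 hC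
  have hCne : C.Nonempty := Finset.card_pos.1 (by have := hC.1; omega)
  have he0 : 0 < e := by rw [he]; positivity
  have hα1 : 0 ≤ α - 1 := by linarith
  have hΦ0 := partCost_nonneg π X
  have hgap : (√(y * sampleCost π s X) + √(meanGap π s X)) ^ 2 ≤ (y + e) * partCost π X :=
    sq_add_le_of_tradeoff he0 hy hyα hlam hem (sampleCost_nonneg _ _ _) hΦ0
      (meanGap_nonneg _ _ _) hgood.gap
  -- Go from the means to the centers through the sample means.
  have hmink : ∑ i, mass π i * ‖mean π X i - z i‖ ^ 2 ≤ (y + e) * partCost π X := by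
    have h1 := sum_mul_norm_add_sq_le (mass π) (mass_nonneg π)
      (fun i => sampleMean s X i - z i) (fun i => mean π X i - sampleMean s X i)
    rw [hU] at h1
    have h2 : ∑ i, mass π i * ‖mean π X i - sampleMean s X i‖ ^ 2 = meanGap π s X := by
      simp only [meanGap, norm_sub_rev]
    rw [h2] at h1
    simp only [sub_add_sub_cancel'] at h1
    exact h1.trans hgap
  have hyy : 0 ≤ ε * y := mul_nonneg hε.le hy
  constructor
  · have h1 : cost 1 X C ≤ ENNReal.ofReal (1 + (y + e)) * opt 1 X k := by
      refine (cost_one_le X (fun p => z (π p)) (fun p => hzC _) hCne).trans ?_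
      rw [sum_norm_sub_center_sq]
      calc _ ≤ ENNReal.ofReal ((1 + (y + e)) * partCost π X) :=
            ENNReal.ofReal_le_ofReal (by linarith)
        _ = ENNReal.ofReal (1 + (y + e)) * ENNReal.ofReal (partCost π X) :=
            ENNReal.ofReal_mul (by linarith)
        _ ≤ _ := by
            gcongr
            exact partCost_le_opt hk hgood.minimal
    by_cases htop : opt 1 X k = ⊤
    · exfalso
      have h2 : opt 1 X k ≤ cost 1 X C := iInf₂_le C hC.1
      rw [htop, cost_eq_ofReal _ _ hCne] at h2
      exact ENNReal.ofReal_ne_top (top_le_iff.1 h2)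
    refine (ratio_le (by linarith) htop h1).trans ?_
    -- The sample ratio is at least `1 + y`, so an additive error `e` becomes a multiplicative one.
    calc _ ≤ ENNReal.ofReal ((1 + ε) * (1 + y)) := by
          refine ENNReal.ofReal_le_ofReal ?_
          rw [he]
          linarith
      _ = ENNReal.ofReal (1 + ε) * ENNReal.ofReal (1 + y) := ENNReal.ofReal_mul (by linarith)
      _ ≤ _ := by gcongr
  · set η := 8000 * (ϑ + √(α - 1) / 2 * (√ϑ + τ)) with hη
    have hη0 : 0 ≤ η := by positivity
    have h1 : ∑ p, ‖P p - z (π p)‖ ^ 2 ≤ (1 + (y + ε + η)) * O := by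
      rw [sum_norm_sub_center_sq]
      have h2 := sum_mul_norm_add_sq_le (mass π) (mass_nonneg π)
        (fun i => mean π X i - z i) (fun i => -mean π ξ i)
      simp only [norm_neg] at h2
      have h3 : ∀ i, mean π X i - z i + -mean π ξ i = mean π P i - z i := by
        intro i
        rw [hX, mean_add]
        abel
      simp only [h3] at h2
      have hG0 : 0 ≤ ∑ i, mass π i * ‖mean π X i - z i‖ ^ 2 :=
        Finset.sum_nonneg fun i _ => mul_nonneg (mass_nonneg _ _) (sq_nonneg _)
      have hF0 : 0 ≤ ∑ i, mass π i * ‖mean π ξ i‖ ^ 2 :=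
        Finset.sum_nonneg fun i _ => mul_nonneg (mass_nonneg _ _) (sq_nonneg _)
      obtain ⟨G, hG⟩ : ∃ G, ∑ i, mass π i * ‖mean π X i - z i‖ ^ 2 = G := ⟨_, rfl⟩
      obtain ⟨F, hFF⟩ : ∃ F, ∑ i, mass π i * ‖mean π ξ i‖ ^ 2 = F := ⟨_, rfl⟩
      rw [hG] at h2 hG0 hmink
      rw [hFF] at h2 hF0 hF
      obtain ⟨φ, hφ⟩ : ∃ φ, partCost π X = φ * O := ⟨_, (div_mul_cancel₀ _ hO.ne').symm⟩
      rw [hφ] at hΦ hΦ2 hmink hΦ0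
      have hφ0 : 0 ≤ φ := nonneg_of_mul_nonneg_left hΦ0 hO
      have hsO : √O ^ 2 = O := Real.sq_sqrt hO.le
      have hsO0 : 0 < √O := Real.sqrt_pos.2 hO
      have key := noise_tradeoff (y := y) (a := α - 1) (e := e) (ε := ε) (τ := τ) (ϑ := ϑ) (rϑ := √ϑ)
        (ra := √(α - 1)) (g := √G / √O) (f := √F / √O) (φ := φ) hy hyα (by linarith) he hε.le hτ hτ1
        (Real.sqrt_nonneg _) (Real.sq_sqrt hϑ) (Real.sqrt_nonneg _) (Real.sq_sqrt hα1)
        (by positivity) (by positivity) hφ0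
        (by
          rw [div_pow, Real.sq_sqrt hG0, hsO, div_le_iff₀ hO]
          linarith)
        (by
          rw [div_le_iff₀ hsO0]
          refine Real.sqrt_le_iff.2 ⟨by positivity, hF.trans ?_⟩
          rw [mul_pow, hsO]
          refine mul_le_mul_of_nonneg_right ?_ hO.le
          rw [add_sq, mul_pow, mul_pow, Real.sq_sqrt hϑ, Real.sq_sqrt hα1]
          have : 0 ≤ 2 * (40 * √ϑ) * (√(α - 1) * τ) := by positivity
          linarith)
        (le_of_mul_le_mul_right hΦ hO) (le_of_mul_le_mul_right hΦ2 hO)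
      rw [← hη, ← add_div, div_pow, hsO] at key
      have h4 : (√G + √F) ^ 2 ≤ (y + ε + η - 25 * ((α - 1) * τ ^ 2)) * O := by
        rw [← div_le_iff₀ hO]
        linarith
      linarith
    have h2 : cost 1 P C ≤ ENNReal.ofReal (1 + (y + ε + η)) * opt 1 P k := by
      refine (cost_one_le P (fun p => z (π p)) (fun p => hzC _) hCne).trans ?_
      rw [hopt, ← ENNReal.ofReal_mul (by linarith)]
      exact ENNReal.ofReal_le_ofReal h1
    refine (ratio_le (by linarith) (hopt ▸ ENNReal.ofReal_ne_top) h2).trans ?_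
    calc _ ≤ ENNReal.ofReal ((1 + (ε + η)) * (1 + y)) := by
          refine ENNReal.ofReal_le_ofReal ?_
          have := mul_nonneg hη0 hy
          linarith
      _ = ENNReal.ofReal (1 + (ε + η)) * ENNReal.ofReal (1 + y) := ENNReal.ofReal_mul (by linarith)
      _ ≤ _ := by gcongr

end Conclusion

/-! ### Perturbations of well separated clusters -/

section Separated

variable {E : Type*} [NormedAddCommGroup E] [InnerProductSpace ℝ E] {n k m : ℕ}

/-- Clusters with assignment `f` and centers `c` that are separated at a scale far above that of
their radii. -/
structure IsSeparated (P : Fin n → E) (f : Fin n → Fin k) (c : Fin k → E) (N : ℝ) : Prop where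
  pos : 0 < N
  sep : ∀ i j, i ≠ j → 10 ^ 14 * N ≤ mass f i * ‖c i - c j‖ ^ 2
  rad : ∀ p, mass f (f p) * ‖P p - c (f p)‖ ^ 2 ≤ 64 * N

/-- The total squared length of the perturbations that are not small. -/
noncomputable def tail (N : ℝ) (ξ : Fin n → E) : ℝ :=
  ∑ p, if N ≤ n * ‖ξ p‖ ^ 2 then ‖ξ p‖ ^ 2 else 0

lemma tail_nonneg (N : ℝ) (ξ : Fin n → E) : 0 ≤ tail N ξ :=
  Finset.sum_nonneg fun p _ => by split_ifs <;> positivity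

lemma mass_le (f : Fin n → Fin k) (i : Fin k) : mass f i ≤ n := by
  rw [mass]
  exact_mod_cast (Finset.card_le_univ _).trans (by simp)

lemma mass_relabel (l : Equiv.Perm (Fin k)) (f : Fin n → Fin k) (i : Fin k) :
    mass (fun p => l (f p)) i = mass f (l.symm i) := by
  simp only [mass, fiber, ← Equiv.eq_symm_apply]

lemma sum_fiber_relabel (l : Equiv.Perm (Fin k)) (f : Fin n → Fin k) (i : Fin k) (g : Fin n → E) :
    ∑ p ∈ fiber (fun p => l (f p)) i, g p = ∑ p ∈ fiber f (l.symm i), g p := by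
  simp only [fiber, ← Equiv.eq_symm_apply]

variable {P X ξ : Fin n → E} {f π : Fin n → Fin k} {c a : Fin k → E} {N : ℝ}

lemma IsSeparated.relabel (h : IsSeparated P f c N) (l : Equiv.Perm (Fin k)) :
    IsSeparated P (fun p => l (f p)) (fun i => c (l.symm i)) N where
  pos := h.pos
  sep i j hij := by
    rw [mass_relabel]
    exact h.sep _ _ fun h => hij (l.symm.injective h)
  rad p := by
    rw [mass_relabel, Equiv.symm_apply_apply]
    exact h.rad p

lemma exists_ne_of_two_le (hk : 2 ≤ k) (i : Fin k) : ∃ j, i ≠ j := by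
  have : Nontrivial (Fin k) := Fin.nontrivial_iff_two_le.2 hk
  obtain ⟨j, hj⟩ := exists_ne i
  exact ⟨j, hj.symm⟩

lemma IsSeparated.mass_pos (h : IsSeparated P f c N) (hk : 2 ≤ k) (i : Fin k) : 0 < mass f i := by
  obtain ⟨j, hj⟩ := exists_ne_of_two_le hk i
  refine lt_of_le_of_ne (mass_nonneg _ _) fun h0 => ?_
  have := h.sep i j hj
  rw [← h0, zero_mul] at this
  linarith [h.pos]

/-- Converts bounds at the scale `N` into fractions of the distances between centers. The bound
`1764 = 2 · (441 + 441)` is the one that the matching of means with centers produces. -/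
lemma IsSeparated.le_div (h : IsSeparated P f c N) (hk : 2 ≤ k) {i j : Fin k} (hij : i ≠ j) {x : ℝ}
    (hx0 : 0 ≤ x) (hx : mass f i * x ^ 2 ≤ 1764 * N) : x ≤ ‖c i - c j‖ / 100 := by
  refine (sq_le_sq₀ hx0 (by positivity)).1 ?_
  refine le_of_mul_le_mul_left ?_ (h.mass_pos hk i)
  have := h.sep i j hij
  rw [div_pow]
  linarith [h.pos]

/-- The means of a partition of small cost are close to the centers, after relabeling. -/
lemma IsSeparated.exists_matching (h : IsSeparated P f c N) (hk : 2 ≤ k)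
    (h1 : partCost π X ≤ 441 * N) (h2 : ∑ p, ‖X p - c (f p)‖ ^ 2 ≤ 441 * N) :
    ∃ l : Equiv.Perm (Fin k), ∀ i, mass f i * ‖mean π X (l i) - c i‖ ^ 2 ≤ 1764 * N := by
  have hex : ∀ i, ∃ j, mass f i * ‖mean π X j - c i‖ ^ 2 ≤ 1764 * N := by
    intro i
    have hpos := h.mass_pos hk i
    have hne : (fiber f i).Nonempty := Finset.card_pos.1 (by simpa [mass] using hpos)
    -- Averaging over the cluster: both `c i` and the mean of the part of `p` are close to `X p` on
    -- average, so some `p` has them close to each other.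
    obtain ⟨p, -, hp⟩ : ∃ p ∈ fiber f i, ‖mean π X (π p) - c i‖ ^ 2 ≤ 1764 * N / mass f i := by
      refine Finset.exists_le_of_sum_le hne ?_
      rw [Finset.sum_const, nsmul_eq_mul]
      change _ ≤ mass f i * _
      rw [mul_div_cancel₀ _ hpos.ne']
      have h3 : ∀ p ∈ fiber f i, ‖mean π X (π p) - c i‖ ^ 2 ≤
          2 * ‖X p - mean π X (π p)‖ ^ 2 + 2 * ‖X p - c (f p)‖ ^ 2 := by
        intro p hp
        rw [mem_fiber.1 hp, norm_sub_rev (X p)]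
        simpa using norm_add_sq_le_two (mean π X (π p) - X p) (X p - c i)
      refine (Finset.sum_le_sum h3).trans ?_
      refine (Finset.sum_le_univ_sum_of_nonneg fun p => by positivity).trans ?_
      rw [Finset.sum_add_distrib, ← Finset.mul_sum, ← Finset.mul_sum]
      rw [partCost] at h1
      linarith
    exact ⟨π p, by rwa [le_div_iff₀' hpos] at hp⟩
  choose l hl using hex
  have hinj : Function.Injective l := by
    intro i j hij
    by_contra hne
    have h3 := h.le_div hk hne (norm_nonneg _) (hl i)
    have h4 := h.le_div hk (Ne.symm hne) (norm_nonneg _) (hl j)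
    rw [norm_sub_rev (c j) (c i)] at h4
    have h5 := norm_sub_le_norm_sub_add_norm_sub (c i) (mean π X (l i)) (c j)
    rw [norm_sub_rev (c i) (mean π X (l i))] at h5
    rw [← hij] at h4
    have h6 : ‖c i - c j‖ = 0 := le_antisymm (by linarith) (norm_nonneg _)
    have h7 := h.sep i j hne
    rw [h6] at h7
    linarith [h.pos]
  exact ⟨Equiv.ofBijective l (Finite.injective_iff_bijective.1 hinj), hl⟩

/-- Nearby means `a` of the clusters, the points being assigned to nearest means. -/
structure IsMatched (P X ξ : Fin n → E) (f π : Fin n → Fin k) (c a : Fin k → E) (N : ℝ) : Prop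
    extends IsSeparated P f c N where
  two_le : 2 ≤ k
  add : X = fun p => P p + ξ p
  close : ∀ i, mass f i * ‖a i - c i‖ ^ 2 ≤ 1764 * N
  nearest : ∀ p j, ‖X p - a (π p)‖ ≤ ‖X p - a j‖
  tail_le : tail N ξ ≤ N

/-- The points whose perturbation is not small compared to the distances of the cluster `i` to the
other clusters. -/
noncomputable def badSet (f : Fin n → Fin k) (N : ℝ) (ξ : Fin n → E) (i : Fin k) :
    Finset (Fin n) :=
  Finset.univ.filter fun p => 10 ^ 14 * N ≤ 400 * (mass f i * ‖ξ p‖ ^ 2)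

namespace IsMatched

variable (h : IsMatched P X ξ f π c a N)
include h

lemma norm_mean_sub_le {i j : Fin k} (hij : i ≠ j) : ‖a i - c i‖ ≤ ‖c i - c j‖ / 100 :=
  h.le_div h.two_le hij (norm_nonneg _) (h.close i)

lemma norm_point_sub_le {p : Fin n} {j : Fin k} (hj : f p ≠ j) :
    ‖P p - c (f p)‖ ≤ ‖c (f p) - c j‖ / 100 :=
  h.le_div h.two_le hj (norm_nonneg _) ((h.rad p).trans (by linarith [h.pos]))

lemma norm_center_sub_le {i j : Fin k} (hij : i ≠ j) :
    98 / 100 * ‖c i - c j‖ ≤ ‖a i - a j‖ := by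
  have h1 := h.norm_mean_sub_le hij
  have h2 := h.norm_mean_sub_le (Ne.symm hij)
  rw [norm_sub_rev (c j) (c i)] at h2
  have h3 : ‖c i - c j‖ ≤ ‖c i - a i‖ + ‖a i - a j‖ + ‖a j - c j‖ :=
    (norm_sub_le_norm_sub_add_norm_sub _ (a j) _).trans
      (add_le_add_left (norm_sub_le_norm_sub_add_norm_sub _ _ _) _)
  rw [norm_sub_rev (c i) (a i)] at h3
  linarith

lemma norm_observed_sub_le (p : Fin n) :
    ‖X p - a (f p)‖ ≤ ‖ξ p‖ + ‖P p - c (f p)‖ + ‖a (f p) - c (f p)‖ := by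
  have h0 : X p = P p + ξ p := congrFun h.add p
  have h1 : X p - a (f p) = ξ p + (P p - c (f p)) - (a (f p) - c (f p)) := by
    rw [h0]
    abel
  rw [h1]
  exact (norm_sub_le _ _).trans (add_le_add_left (norm_add_le _ _) _)

/-- A moved point is at least as close to the mean of its new part, so its distance from its own
mean is at least half the distance of the two means. All deviations except the noise are about a
hundredth of the latter. -/
lemma norm_sub_le_of_moved {p : Fin n} (hp : π p ≠ f p) :
    ‖c (f p) - c (π p)‖ ≤ 4 * ‖ξ p‖ := by
  have h1 := h.nearest p (f p)
  have h2 := h.norm_center_sub_le (Ne.symm hp)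
  have h3 := h.norm_mean_sub_le (Ne.symm hp)
  have h4 := h.norm_point_sub_le (Ne.symm hp)
  have h5 : ‖a (f p) - a (π p)‖ ≤ ‖X p - a (f p)‖ + ‖X p - a (π p)‖ := by
    rw [norm_sub_rev (X p) (a (f p))]
    exact norm_sub_le_norm_sub_add_norm_sub _ _ _
  have h6 := h.norm_observed_sub_le p
  linarith [norm_nonneg (ξ p)]

lemma mem_badSet_of_norm_le {p : Fin n} {i j : Fin k} (hij : i ≠ j)
    (hp : ‖c i - c j‖ ≤ 20 * ‖ξ p‖) : p ∈ badSet f N ξ i := by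
  rw [badSet, Finset.mem_filter]
  refine ⟨Finset.mem_univ _, (h.sep i j hij).trans ?_⟩
  have h1 : ‖c i - c j‖ ^ 2 ≤ (20 * ‖ξ p‖) ^ 2 := pow_le_pow_left₀ (norm_nonneg _) hp 2
  have h2 := mul_le_mul_of_nonneg_left h1 (mass_nonneg f i)
  linarith

lemma mem_badSet_of_moved {p : Fin n} (hp : π p ≠ f p) :
    p ∈ badSet f N ξ (f p) ∧ p ∈ badSet f N ξ (π p) := by
  have h1 := h.norm_sub_le_of_moved hp
  have h0 := norm_nonneg (ξ p)
  refine ⟨h.mem_badSet_of_norm_le (Ne.symm hp) (by linarith),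
    h.mem_badSet_of_norm_le hp ?_⟩
  rw [norm_sub_rev]
  linarith

/-- Either the point was moved, or it strays from its mean by more than a tenth of the distance to
another mean; radius and displacement of the mean explain only about two hundredths. -/
lemma mem_badSet_of_not_core {p : Fin n} {j : Fin k} (hj : j ≠ π p)
    (hp : ‖a (π p) - a j‖ ^ 2 < 100 * ‖X p - a (π p)‖ ^ 2) : p ∈ badSet f N ξ (π p) := by
  by_cases hm : π p = f p
  · have h1 : ‖a (π p) - a j‖ < 10 * ‖X p - a (π p)‖ := by
      refine lt_of_pow_lt_pow_left₀ 2 (by positivity) ?_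
      rw [mul_pow]
      linarith
    have h2 := h.norm_center_sub_le hj.symm
    have h3 := h.norm_mean_sub_le hj.symm
    have h4 := h.norm_point_sub_le (j := j) (hm ▸ hj.symm)
    have h6 := h.norm_observed_sub_le p
    refine h.mem_badSet_of_norm_le hj.symm ?_
    rw [hm] at h1 h2 h3 ⊢
    linarith [norm_nonneg (ξ p)]
  · exact (h.mem_badSet_of_moved hm).2

/-- Since a cluster has at most `n` points, the threshold of `tail` is below that of every bad set.
-/
lemma mem_tail_of_mem_badSet {p : Fin n} {i : Fin k} (hp : p ∈ badSet f N ξ i) :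
    N ≤ n * ‖ξ p‖ ^ 2 := by
  rw [badSet, Finset.mem_filter] at hp
  have h1 := mul_le_mul_of_nonneg_right (mass_le f i) (sq_nonneg ‖ξ p‖)
  have h2 := h.pos
  linarith [hp.2]

lemma sum_le_tail {s : Finset (Fin n)} (hs : ∀ p ∈ s, N ≤ n * ‖ξ p‖ ^ 2) :
    ∑ p ∈ s, ‖ξ p‖ ^ 2 ≤ tail N ξ := by
  calc ∑ p ∈ s, ‖ξ p‖ ^ 2 = ∑ p ∈ s, if N ≤ n * ‖ξ p‖ ^ 2 then ‖ξ p‖ ^ 2 else 0 :=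
        Finset.sum_congr rfl fun p hp => (if_pos (hs p hp)).symm
    _ ≤ _ := Finset.sum_le_univ_sum_of_nonneg fun p => by split_ifs <;> positivity

/-- Markov's inequality for counting: every bad point contributes a minimum amount to the tail. -/
lemma card_badSet_mul_le (i : Fin k) :
    ((badSet f N ξ i).card : ℝ) * (10 ^ 14 * N) ≤ 400 * (mass f i * tail N ξ) := by
  have h1 : ((badSet f N ξ i).card : ℝ) * (10 ^ 14 * N) ≤
      ∑ p ∈ badSet f N ξ i, 400 * (mass f i * ‖ξ p‖ ^ 2) := by
    rw [← nsmul_eq_mul]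
    refine Finset.card_nsmul_le_sum _ _ _ fun p hp => ?_
    exact (Finset.mem_filter.1 hp).2
  rw [← Finset.mul_sum, ← Finset.mul_sum] at h1
  refine h1.trans ?_
  have h2 := h.sum_le_tail fun p (hp : p ∈ badSet f N ξ i) => h.mem_tail_of_mem_badSet hp
  have h3 := mul_le_mul_of_nonneg_left h2 (mass_nonneg f i)
  linarith

lemma mass_le_two_mul (i : Fin k) : mass f i ≤ 2 * mass π i := by
  have h1 : fiber f i ⊆ fiber π i ∪ badSet f N ξ i := by
    intro p hp
    rw [Finset.mem_union, mem_fiber]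
    by_cases hm : π p = f p
    · left
      rw [hm, mem_fiber.1 hp]
    · right
      rw [← mem_fiber.1 hp]
      exact (h.mem_badSet_of_moved hm).1
  have h2 : mass f i ≤ mass π i + (badSet f N ξ i).card := by
    simp only [mass]
    exact_mod_cast (Finset.card_le_card h1).trans (Finset.card_union_le _ _)
  have h3 := h.card_badSet_mul_le i
  have h4 := mul_le_mul_of_nonneg_left h.tail_le (mass_nonneg f i)
  have h5 : ((badSet f N ξ i).card : ℝ) ≤ mass f i / 2 := by
    refine le_of_mul_le_mul_right ?_ (show 0 < 10 ^ 14 * N by linarith [h.pos])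
    have := mul_nonneg (mass_nonneg f i) h.pos.le
    linarith
  linarith

lemma mass_pos' (i : Fin k) : 0 < mass π i := by
  have := h.mass_pos h.two_le i
  linarith [h.mass_le_two_mul i]

/-- The cost of the partition of the observed data for the clean data. -/
lemma partCost_clean_le : partCost π P ≤ ∑ p, ‖P p - c (f p)‖ ^ 2 + 25 * tail N ξ := by
  refine (partCost_le π P c).trans ?_
  rw [tail, Finset.mul_sum, ← Finset.sum_add_distrib]
  refine Finset.sum_le_sum fun p _ => ?_
  by_cases hm : π p = f p
  · rw [hm]
    refine le_add_of_nonneg_right ?_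
    split_ifs <;> positivity
  · rw [if_pos (h.mem_tail_of_mem_badSet (h.mem_badSet_of_moved hm).1)]
    have h1 := h.norm_sub_le_of_moved hm
    have h2 := h.norm_point_sub_le (Ne.symm hm)
    have h3 : ‖P p - c (π p)‖ ≤ ‖P p - c (f p)‖ + ‖c (f p) - c (π p)‖ :=
      norm_sub_le_norm_sub_add_norm_sub _ _ _
    -- A moved point pays at most `4 ‖ξ p‖` for the distance of the centers plus a hundredth of that
    -- for its radius; squaring gives the constant `25`.
    have h4 : ‖P p - c (π p)‖ ≤ 5 * ‖ξ p‖ := by linarith [norm_nonneg (ξ p)]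
    have h5 : ‖P p - c (π p)‖ ^ 2 ≤ (5 * ‖ξ p‖) ^ 2 := pow_le_pow_left₀ (norm_nonneg _) h4 2
    have h6 := sq_nonneg ‖P p - c (f p)‖
    linarith

/-- The noise in the means of the partition of the observed data. -/
lemma sum_mass_mul_norm_mean_sq_le :
    ∑ i, mass π i * ‖mean π ξ i‖ ^ 2 ≤
      4 * ∑ i, ‖∑ p ∈ fiber f i, ξ p‖ ^ 2 / mass f i + tail N ξ ^ 2 / N := by
  classical
  -- The points that enter or leave the part `i`. Only these distinguish the noise of the part from
  -- that of the cluster, and they are few, so Cauchy–Schwarz gains their number.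
  set mv : Fin k → Finset (Fin n) := fun i =>
    Finset.univ.filter fun p => π p ≠ f p ∧ (π p = i ∨ f p = i) with hmv
  have hbad : ∀ i, mv i ⊆ badSet f N ξ i := by
    intro i p hp
    obtain ⟨-, h1, h2 | h2⟩ := Finset.mem_filter.1 hp
    · exact h2 ▸ (h.mem_badSet_of_moved h1).2
    · exact h2 ▸ (h.mem_badSet_of_moved h1).1
  have hmvT : ∀ i, ∑ p ∈ mv i, ‖ξ p‖ ^ 2 ≤ tail N ξ := fun i =>
    h.sum_le_tail fun p hp => h.mem_tail_of_mem_badSet (hbad i hp)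
  have hone : ∀ i, mass π i * ‖mean π ξ i‖ ^ 2 ≤
      4 * (‖∑ p ∈ fiber f i, ξ p‖ ^ 2 / mass f i) +
        1600 * tail N ξ / (10 ^ 14 * N) * ∑ p ∈ mv i, ‖ξ p‖ ^ 2 := by
    intro i
    have hWf := h.mass_pos h.two_le i
    have hWπ := h.mass_pos' i
    have h1 : mass π i * ‖mean π ξ i‖ ^ 2 = ‖∑ p ∈ fiber π i, ξ p‖ ^ 2 / mass π i := by
      rw [← mass_smul_mean, norm_smul, Real.norm_of_nonneg hWπ.le, mul_pow]
      field_simp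
    have h2 : ‖∑ p ∈ fiber π i, ξ p‖ ^ 2 / mass π i ≤
        2 * ‖∑ p ∈ fiber π i, ξ p‖ ^ 2 / mass f i := by
      rw [div_le_div_iff₀ hWπ hWf]
      have := mul_le_mul_of_nonneg_left (h.mass_le_two_mul i)
        (sq_nonneg ‖∑ p ∈ fiber π i, ξ p‖)
      linarith
    have h3 : ∑ p ∈ fiber π i, ξ p = ∑ p ∈ fiber f i, ξ p +
        ∑ p ∈ mv i, ((if π p = i then ξ p else 0) - (if f p = i then ξ p else 0)) := by
      have h31 : ∑ p ∈ mv i, ((if π p = i then ξ p else 0) - (if f p = i then ξ p else 0)) =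
          ∑ p, ((if π p = i then ξ p else 0) - (if f p = i then ξ p else 0)) := by
        refine Finset.sum_subset (Finset.subset_univ _) fun p _ hp => ?_
        have hp' : ¬ (π p ≠ f p ∧ (π p = i ∨ f p = i)) := fun h => hp (by simpa [hmv] using h)
        by_cases h1 : π p = i
        · by_cases h2 : f p = i
          · simp [h1, h2]
          · exact absurd ⟨fun h => h2 (h ▸ h1), Or.inl h1⟩ hp'
        · by_cases h2 : f p = i
          · exact absurd ⟨fun h => h1 (h.trans h2), Or.inr h2⟩ hp'
          · simp [h1, h2]
      rw [h31, Finset.sum_sub_distrib, fiber, fiber, Finset.sum_filter, Finset.sum_filter]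
      abel
    have h4 : ‖∑ p ∈ mv i, ((if π p = i then ξ p else 0) - (if f p = i then ξ p else 0))‖ ^ 2 ≤
        (mv i).card * ∑ p ∈ mv i, ‖ξ p‖ ^ 2 := by
      refine (norm_sum_sq_le_card_mul _ _).trans ?_
      refine mul_le_mul_of_nonneg_left (Finset.sum_le_sum fun p hp => ?_) (Nat.cast_nonneg _)
      have hp' : π p ≠ f p := (Finset.mem_filter.1 hp).2.1
      by_cases h1 : π p = i
      · have h2 : f p ≠ i := fun h2 => hp' (h1.trans h2.symm)
        simp [h1, h2]
      · by_cases h2 : f p = i <;> simp [h1, h2]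
    have h5 : ((mv i).card : ℝ) ≤ 400 * tail N ξ / (10 ^ 14 * N) * mass f i := by
      have hN : 0 < 10 ^ 14 * N := by linarith [h.pos]
      rw [div_mul_eq_mul_div, le_div_iff₀ hN]
      have h51 : ((mv i).card : ℝ) ≤ (badSet f N ξ i).card := by
        exact_mod_cast Finset.card_le_card (hbad i)
      have h52 := mul_le_mul_of_nonneg_right h51 hN.le
      linarith [h.card_badSet_mul_le i]
    have hS0 : 0 ≤ ∑ p ∈ mv i, ‖ξ p‖ ^ 2 := Finset.sum_nonneg fun _ _ => sq_nonneg _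
    have h6 := h4.trans (mul_le_mul_of_nonneg_right h5 hS0)
    have h7 := norm_add_sq_le_two (∑ p ∈ fiber f i, ξ p)
      (∑ p ∈ mv i, ((if π p = i then ξ p else 0) - (if f p = i then ξ p else 0)))
    rw [← h3] at h7
    rw [h1]
    refine h2.trans ?_
    rw [div_le_iff₀ hWf, add_mul, mul_assoc 4, div_mul_cancel₀ _ hWf.ne']
    have h8 : 1600 * tail N ξ / (10 ^ 14 * N) = 4 * (400 * tail N ξ / (10 ^ 14 * N)) := by ring
    rw [h8]
    linarith
  -- Every moved point enters one part and leaves one, so it is counted twice.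
  have hsum : ∑ i, ∑ p ∈ mv i, ‖ξ p‖ ^ 2 ≤ 2 * tail N ξ := by
    set MV := Finset.univ.filter fun p => π p ≠ f p with hMV
    have h1 : ∀ i, ∑ p ∈ mv i, ‖ξ p‖ ^ 2 ≤
        ∑ p ∈ MV, ((if π p = i then ‖ξ p‖ ^ 2 else 0) + (if f p = i then ‖ξ p‖ ^ 2 else 0)) := by
      intro i
      have hsub : mv i ⊆ MV := fun p hp =>
        Finset.mem_filter.2 ⟨Finset.mem_univ _, (Finset.mem_filter.1 hp).2.1⟩
      refine le_trans (Finset.sum_le_sum fun p hp => ?_)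
        (Finset.sum_le_sum_of_subset_of_nonneg hsub fun p _ _ => by split_ifs <;> positivity)
      have h0 := sq_nonneg ‖ξ p‖
      rcases (Finset.mem_filter.1 hp).2.2 with h1 | h1 <;> rw [if_pos h1] <;> split_ifs <;> linarith
    refine (Finset.sum_le_sum fun i _ => h1 i).trans ?_
    rw [Finset.sum_comm]
    simp only [Finset.sum_add_distrib, Finset.sum_ite_eq, Finset.mem_univ, if_true]
    rw [← two_mul]
    refine mul_le_mul_of_nonneg_left (h.sum_le_tail fun p hp => ?_) zero_le_two
    exact h.mem_tail_of_mem_badSet (h.mem_badSet_of_moved (Finset.mem_filter.1 hp).2).1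
  refine (Finset.sum_le_sum fun i _ => hone i).trans ?_
  rw [Finset.sum_add_distrib, ← Finset.mul_sum, ← Finset.mul_sum]
  refine add_le_add_right ?_ _
  have hT := tail_nonneg N ξ
  have hN := h.pos
  refine (mul_le_mul_of_nonneg_left hsum (by positivity)).trans ?_
  rw [div_mul_eq_mul_div, div_le_div_iff₀ (by positivity) hN]
  have : 0 ≤ tail N ξ ^ 2 * N := by positivity
  linarith

end IsMatched

/-- The existence of a good sample. -/
lemma IsMatched.exists_isGoodSample (h : IsMatched P X ξ f π c (mean π X) N)
    (hmin : ∀ π' : Fin n → Fin k, partCost π X ≤ partCost π' X) {lam δ : ℝ} (hm : 0 < m)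
    (hlam : 0 ≤ lam) (hlm : lam ≤ m) (hδ : tail N ξ ≤ δ * N) (hmδ : m * δ ≤ 10 ^ 10) :
    ∃ s : Fin k → Fin m → Fin n, IsGoodSample lam π s X := by
  classical
  have hδ0 : 0 ≤ δ := nonneg_of_mul_nonneg_left ((tail_nonneg N ξ).trans hδ) h.pos
  set T : Fin k → Finset (Fin n) := fun i => (fiber π i).filter fun p =>
    ∀ j, j ≠ i → 100 * ‖X p - mean π X i‖ ^ 2 ≤ ‖mean π X i - mean π X j‖ ^ 2 with hT
  have hex : ∀ i, ∃ s : Fin m → Fin n, (∀ t, s t ∈ T i) ∧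
      m * ‖(m : ℝ)⁻¹ • ∑ t, X (s t) - mean π X i‖ ^ 2 + 2 * lam *
        ((m : ℝ)⁻¹ * ∑ t, ‖X (s t) - (m : ℝ)⁻¹ • ∑ t, X (s t)‖ ^ 2 -
          (mass π i)⁻¹ * ∑ p ∈ fiber π i, ‖X p - mean π X i‖ ^ 2) ≤
      4 * ((mass π i)⁻¹ * ∑ p ∈ fiber π i, ‖X p - mean π X i‖ ^ 2) := by
    intro i
    have hWπ := h.mass_pos' i
    have hbad : fiber π i \ T i ⊆ badSet f N ξ i := by
      intro p hp
      rw [Finset.mem_sdiff, Finset.mem_filter, mem_fiber] at hp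
      obtain ⟨hpi, hp2⟩ := hp
      have hp3 : ∃ j, j ≠ i ∧ ‖mean π X i - mean π X j‖ ^ 2 < 100 * ‖X p - mean π X i‖ ^ 2 := by
        by_contra hcon
        push Not at hcon
        exact hp2 ⟨hpi, hcon⟩
      obtain ⟨j, hj, hlt⟩ := hp3
      subst hpi
      exact h.mem_badSet_of_not_core hj hlt
    -- The bad set has at most `400 δ / 10 ^ 14` of the cluster's mass, which is at most twice that
    -- of the part.
    have hcard : ((fiber π i \ T i).card : ℝ) ≤ 800 * δ / 10 ^ 14 * (fiber π i).card := by
      have h1 : ((fiber π i \ T i).card : ℝ) ≤ (badSet f N ξ i).card := by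
        exact_mod_cast Finset.card_le_card hbad
      have h2 := h.card_badSet_mul_le i
      have hN := h.pos
      refine le_of_mul_le_mul_right ?_ (show 0 < 10 ^ 14 * N by linarith)
      refine (mul_le_mul_of_nonneg_right h1 (by linarith)).trans (h2.trans ?_)
      have h3 := mul_le_mul_of_nonneg_left hδ (mass_nonneg f i)
      have h4 := mul_le_mul_of_nonneg_right (h.mass_le_two_mul i) (mul_nonneg hδ0 hN.le)
      have h5 : 800 * δ / 10 ^ 14 * ((fiber π i).card : ℝ) * (10 ^ 14 * N) =
          800 * (mass π i * (δ * N)) := by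
        rw [mass]; ring
      rw [h5]
      linarith
    -- With `q = 800 δ / 10 ^ 14` the bound `m δ ≤ 10 ^ 10` gives `12 m q ≤ 0.96`, below the
    -- required `2`.
    obtain ⟨s, hs, hg⟩ := exists_sample_of_core (fiber π i) (T i) (Finset.filter_subset _ _)
      (fun p => X p - mean π X i) lam (800 * δ / 10 ^ 14)
      ((mass π i)⁻¹ * ∑ p ∈ fiber π i, ‖X p - mean π X i‖ ^ 2) m hm hlam hlm (by positivity)
      (by linarith) (Finset.card_pos.1 (by simpa [mass] using hWπ)) hcard (sum_sub_mean π X i)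
      (by
        change _ = mass π i * _
        rw [mul_inv_cancel_left₀ hWπ.ne'])
    refine ⟨s, hs, ?_⟩
    have hm0 : (m : ℝ) ≠ 0 := by positivity
    have h1 : (m : ℝ)⁻¹ • ∑ t, (X (s t) - mean π X i) =
        (m : ℝ)⁻¹ • ∑ t, X (s t) - mean π X i := by
      rw [Finset.sum_sub_distrib, smul_sub, Finset.sum_const, Finset.card_univ, Fintype.card_fin,
        ← Nat.cast_smul_eq_nsmul ℝ, inv_smul_smul₀ hm0]
    simpa only [h1, sub_sub_sub_cancel_right] using hg
  choose s hs hg using hex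
  refine ⟨s, hmin, fun i t j hj => ?_, ?_⟩
  · exact (Finset.mem_filter.1 (hs i t)).2 j hj
  · have hΦ : partCost π X = ∑ i, mass π i *
        ((mass π i)⁻¹ * ∑ p ∈ fiber π i, ‖X p - mean π X i‖ ^ 2) := by
      rw [partCost_eq_sum]
      exact Finset.sum_congr rfl fun i _ => (mul_inv_cancel_left₀ (h.mass_pos' i).ne' _).symm
    have h1 := Finset.sum_le_sum fun i (_ : i ∈ Finset.univ) =>
      mul_le_mul_of_nonneg_left (hg i) (mass_nonneg π i)
    rw [hΦ, meanGap, sampleCost, ← Finset.sum_sub_distrib, Finset.mul_sum, Finset.mul_sum,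
      Finset.mul_sum, ← Finset.sum_add_distrib]
    refine le_trans (le_of_eq ?_) (h1.trans (le_of_eq ?_))
    · refine Finset.sum_congr rfl fun i _ => ?_
      simp only [sampleMean]
      ring
    · exact Finset.sum_congr rfl fun i _ => by ring

/-- The parts of the observed data are separated. -/
lemma IsMatched.sampleCost_le (h : IsMatched P X ξ f π c (mean π X) N)
    {lam : ℝ} {s : Fin k → Fin m → Fin n} (hs : IsGoodSample lam π s X) (hlam : 2 ≤ lam)
    (hΦ : partCost π X ≤ 441 * N) {i j : Fin k} (hij : j ≠ i) :
    800 * sampleCost π s X ≤ mass π i * ‖mean π X i - mean π X j‖ ^ 2 ∧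
      mean π X i ≠ mean π X j := by
  have h1 := h.norm_center_sub_le hij.symm
  have h2 : (98 / 100 * ‖c i - c j‖) ^ 2 ≤ ‖mean π X i - mean π X j‖ ^ 2 :=
    pow_le_pow_left₀ (by positivity) h1 2
  have h3 := h.sep i j hij.symm
  have hN := h.pos
  have h4 := mul_le_mul_of_nonneg_right (h.mass_le_two_mul i) (sq_nonneg ‖c i - c j‖)
  have h5 := mul_le_mul_of_nonneg_left h2 (mass_nonneg π i)
  have h6 : 10 ^ 13 * N ≤ mass π i * ‖mean π X i - mean π X j‖ ^ 2 := by linarith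
  have hgap := mul_nonneg (Nat.cast_nonneg m) (meanGap_nonneg π s X) (α := ℝ)
  -- Drop the gap of the means in the tradeoff and use `lam ≥ 2`.
  have hV : sampleCost π s X ≤ 2 * partCost π X := by
    by_contra hcon
    have h7 := mul_le_mul_of_nonneg_right hlam
      (show 0 ≤ sampleCost π s X - partCost π X by linarith [partCost_nonneg π X])
    linarith [hs.gap, partCost_nonneg π X]
  refine ⟨by linarith, fun h0 => ?_⟩
  rw [h0, sub_self, norm_zero] at h6
  linarith

end Separated

/-! ### The algorithm -/

section Algorithm

variable {ι : Type} {n d k m : ℕ}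

/-- A vector whose coordinates are polynomials in the input. -/
def IsPolyVec (v : (ι → ℝ) → Pt d) : Prop := ∀ j, IsPoly fun x => v x j

lemma IsPolyVec.norm_sq {v : (ι → ℝ) → Pt d} (hv : IsPolyVec v) : IsPoly fun x => ‖v x‖ ^ 2 := by
  simp only [EuclideanSpace.norm_sq_eq, Real.norm_eq_abs, sq_abs]
  exact IsPoly.sum _ fun j _ => (hv j).sq

lemma IsPolyVec.sub {v w : (ι → ℝ) → Pt d} (hv : IsPolyVec v) (hw : IsPolyVec w) :
    IsPolyVec fun x => v x - w x := fun j => by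
  simpa using (hv j).sub (hw j)

lemma IsPolyVec.smul (a : ℝ) {v : (ι → ℝ) → Pt d} (hv : IsPolyVec v) :
    IsPolyVec fun x => a • v x := fun j => by
  simpa using (IsPoly.const a).mul (hv j)

lemma IsPolyVec.sum {κ : Type*} (s : Finset κ) {v : κ → (ι → ℝ) → Pt d}
    (hv : ∀ a ∈ s, IsPolyVec (v a)) : IsPolyVec fun x => ∑ a ∈ s, v a x := fun j => by
  simpa using IsPoly.sum s fun a ha => hv a ha j

/-- The data set with the given coordinates. -/
noncomputable def ofCoords (x : Fin n × Fin d → ℝ) : Dataset n d :=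
  fun p => WithLp.toLp 2 fun j => x (p, j)

lemma isPolyVec_ofCoords (p : Fin n) : IsPolyVec fun x : Fin n × Fin d → ℝ => ofCoords x p :=
  fun j => IsPoly.coord (p, j)

lemma isPolyVec_mean (π : Fin n → Fin k) (i : Fin k) :
    IsPolyVec fun x : Fin n × Fin d → ℝ => mean π (ofCoords x) i :=
  (IsPolyVec.sum _ fun p _ => isPolyVec_ofCoords p).smul _

lemma isPoly_partCost (π : Fin n → Fin k) :
    IsPoly fun x : Fin n × Fin d → ℝ => partCost π (ofCoords x) :=
  IsPoly.sum _ fun p _ => ((isPolyVec_ofCoords p).sub (isPolyVec_mean π _)).norm_sq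

lemma isPolyVec_sampleMean (s : Fin k → Fin m → Fin n) (i : Fin k) :
    IsPolyVec fun x : Fin n × Fin d → ℝ => sampleMean s (ofCoords x) i :=
  (IsPolyVec.sum _ fun t _ => isPolyVec_ofCoords (s i t)).smul _

lemma isPoly_sampleCost (π : Fin n → Fin k) (s : Fin k → Fin m → Fin n) :
    IsPoly fun x : Fin n × Fin d → ℝ => sampleCost π s (ofCoords x) :=
  IsPoly.sum _ fun i _ => (IsPoly.const _).mul ((IsPoly.const _).mul (IsPoly.sum _ fun t _ =>
    ((isPolyVec_ofCoords (s i t)).sub (isPolyVec_sampleMean s i)).norm_sq))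

lemma isPoly_meanGap (π : Fin n → Fin k) (s : Fin k → Fin m → Fin n) :
    IsPoly fun x : Fin n × Fin d → ℝ => meanGap π s (ofCoords x) :=
  IsPoly.sum _ fun i _ => (IsPoly.const _).mul
    ((isPolyVec_sampleMean s i).sub (isPolyVec_mean π i)).norm_sq

lemma treeTestable_isGoodSample (lam : ℝ) (π : Fin n → Fin k) (s : Fin k → Fin m → Fin n) :
    TreeTestable fun x : Fin n × Fin d → ℝ => IsGoodSample lam π s (ofCoords x) := by
  have h1 : TreeTestable fun x : Fin n × Fin d → ℝ =>
      ∀ π' : Fin n → Fin k, partCost π (ofCoords x) ≤ partCost π' (ofCoords x) :=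
    TreeTestable.forall fun π' => TreeTestable.le (isPoly_partCost π) (isPoly_partCost π')
  have h2 : TreeTestable fun x : Fin n × Fin d → ℝ => ∀ i t,
      ∀ j ∈ Finset.univ.filter (fun j => j ≠ i),
      100 * ‖ofCoords x (s i t) - mean π (ofCoords x) i‖ ^ 2 ≤
        ‖mean π (ofCoords x) i - mean π (ofCoords x) j‖ ^ 2 :=
    TreeTestable.forall fun i => TreeTestable.forall fun t => TreeTestable.forall_mem _ fun j _ =>
      TreeTestable.le
        ((IsPoly.const _).mul ((isPolyVec_ofCoords (s i t)).sub (isPolyVec_mean π i)).norm_sq)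
        ((isPolyVec_mean π i).sub (isPolyVec_mean π j)).norm_sq
  have h3 : TreeTestable fun x : Fin n × Fin d → ℝ =>
      m * meanGap π s (ofCoords x) + 2 * lam * (sampleCost π s (ofCoords x) -
        partCost π (ofCoords x)) ≤ 4 * partCost π (ofCoords x) :=
    TreeTestable.le (((IsPoly.const _).mul (isPoly_meanGap π s)).add
      ((IsPoly.const _).mul ((isPoly_sampleCost π s).sub (isPoly_partCost π))))
      ((IsPoly.const _).mul (isPoly_partCost π))
  have h4 := h1.and (h2.and h3)
  exact h4.congr fun x =>
    ⟨fun h => ⟨h.1, fun i t j hj => h.2.1 i t j (by simpa using hj), h.2.2⟩,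
      fun h => ⟨h.minimal, fun i t j hj => h.core i t j (by simpa using hj), h.gap⟩⟩

/-- The algorithm searches for a good sample. -/
lemma exists_algorithm (n d k m : ℕ) (lam : ℝ) :
    ∃ 𝒜 : CoresetAlg n d, ∀ X : Dataset n d, ∃ w, 𝒜.weights X = PMF.pure w ∧ size w ≤ k * m ∧
      ((∃ (π : Fin n → Fin k) (s : Fin k → Fin m → Fin n), IsGoodSample lam π s X) →
        ∃ (π : Fin n → Fin k) (s : Fin k → Fin m → Fin n), IsGoodSample lam π s X ∧
          w = sampleWeight π s) := by
  obtain ⟨r, hr⟩ := exists_search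
    (Q := fun (a : (Fin n → Fin k) × (Fin k → Fin m → Fin n)) (x : Fin n × Fin d → ℝ) =>
      IsGoodSample lam a.1 a.2 (ofCoords x))
    (fun a => treeTestable_isGoodSample lam a.1 a.2) (fun a => sampleWeight a.1 a.2) 0
  refine ⟨r, fun X => ?_⟩
  obtain ⟨w, hw, h⟩ := hr fun q => X q.1 q.2
  have hX : (ofCoords fun q : Fin n × Fin d => X q.1 q.2) = X := rfl
  simp only [hX] at h
  refine ⟨w, hw, ?_, ?_⟩
  · rcases h with ⟨a, -, rfl⟩ | ⟨-, rfl⟩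
    · exact size_sampleWeight_le _ _
    · simp [size]
  · rintro ⟨π, s, hs⟩
    rcases h with ⟨a, ha, rfl⟩ | ⟨h, -⟩
    · exact ⟨a.1, a.2, ha, rfl⟩
    · exact absurd hs (h (π, s))

end Algorithm

/-! ### Separation of the clusters of stable data -/

section Stability

variable {n d k : ℕ}

/-- The squared average radius times the size of a cluster is at most the whole cost, and `64 = 8²`.
In `cluster` a tied point belongs to several clusters, whereas `f` picks one, hence the inclusion
instead of an equality. -/
lemma mass_mul_dist_sq_le {P : Dataset n d} {C : Finset (Pt d)} {c : Fin k → Pt d}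
    (hc : ∀ x, x ∈ C ↔ ∃ i, c i = x) {f : Fin n → Fin k}
    (hf : ∀ p j, ‖P p - c (f p)‖ ≤ ‖P p - c j‖)
    (hrad : ∀ x ∈ C, ∀ p ∈ cluster P C x, dist (P p) x ≤ 8 * avgRadius P C x) (p : Fin n) :
    mass f (f p) * ‖P p - c (f p)‖ ^ 2 ≤ 64 * ∑ q, ‖P q - c (f q)‖ ^ 2 := by
  have hmem : ∀ q i, f q = i → q ∈ cluster P C (c i) := by
    rintro q i rfl
    refine Finset.mem_filter.2 ⟨Finset.mem_univ _, fun x hx => ?_⟩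
    obtain ⟨j, rfl⟩ := (hc x).1 hx
    rw [dist_eq_norm, dist_eq_norm]
    exact hf q j
  set i := f p with hi
  have h1 := hrad (c i) ((hc _).2 ⟨i, rfl⟩) p (hmem p i rfl)
  rw [dist_eq_norm] at h1
  have hpos : (0 : ℝ) < (cluster P C (c i)).card := by
    exact_mod_cast Finset.card_pos.2 ⟨p, hmem p i rfl⟩
  have h2 : ‖P p - c i‖ ^ 2 ≤ (8 * avgRadius P C (c i)) ^ 2 := pow_le_pow_left₀ (norm_nonneg _) h1 2
  have hS0 : 0 ≤ ∑ q ∈ cluster P C (c i), dist (P q) (c i) ^ 2 :=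
    Finset.sum_nonneg fun _ _ => sq_nonneg _
  rw [mul_pow, avgRadius, Real.sq_sqrt (by positivity)] at h2
  have h3 : mass f i ≤ (cluster P C (c i)).card := by
    rw [mass]
    exact_mod_cast Finset.card_le_card fun q hq => hmem q i (mem_fiber.1 hq)
  have h4 : ∑ q ∈ cluster P C (c i), dist (P q) (c i) ^ 2 ≤ ∑ q, ‖P q - c (f q)‖ ^ 2 := by
    refine le_trans (Finset.sum_le_sum fun q hq => ?_)
      (Finset.sum_le_univ_sum_of_nonneg fun q => sq_nonneg _)
    rw [← dist_eq_norm]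
    exact pow_le_pow_left₀ dist_nonneg ((Finset.mem_filter.1 hq).2 _ ((hc _).2 ⟨_, rfl⟩)) 2
  refine (mul_le_mul_of_nonneg_right h3 (sq_nonneg _)).trans ?_
  refine (mul_le_mul_of_nonneg_left h2 hpos.le).trans ?_
  have h5 : ((cluster P C (c i)).card : ℝ) * (8 ^ 2 * ((∑ q ∈ cluster P C (c i),
      dist (P q) (c i) ^ 2) / (cluster P C (c i)).card)) =
      64 * ∑ q ∈ cluster P C (c i), dist (P q) (c i) ^ 2 := by
    field_simp
    ring
  rw [h5]
  linarith

/-- The price of deleting the center `c i` and sending its cluster to `c j`; compared with the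
stability of the data it forces the two centers apart. -/
lemma sum_merge_le {P : Dataset n d} (c : Fin k → Pt d) (f : Fin n → Fin k) (i j : Fin k) :
    ∑ p, ‖P p - c (if f p = i then j else f p)‖ ^ 2 ≤
      2 * ∑ p, ‖P p - c (f p)‖ ^ 2 + 2 * (mass f i * ‖c i - c j‖ ^ 2) := by
  have h1 : ∀ p, ‖P p - c (if f p = i then j else f p)‖ ^ 2 ≤
      2 * ‖P p - c (f p)‖ ^ 2 + if f p = i then 2 * ‖c i - c j‖ ^ 2 else 0 := by
    intro p
    split_ifs with h
    · rw [h]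
      simpa using norm_add_sq_le_two (P p - c i) (c i - c j)
    · have := sq_nonneg ‖P p - c (f p)‖
      linarith
  refine (Finset.sum_le_sum fun p _ => h1 p).trans (le_of_eq ?_)
  rw [Finset.sum_add_distrib, ← Finset.mul_sum, ← Finset.sum_filter, Finset.sum_const, nsmul_eq_mul]
  simp only [mass, fiber]
  ring

/-- Only an inequality: for `α = 1` the real logarithm takes the default value `log 0 = 0`, while
`logSq` is infinite. -/
lemma le_stabilityParam_mul {A α σ O : ℝ} {P : Dataset n d} (hA : 0 ≤ A) (hα : 1 ≤ α) (hO : 0 < O)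
    (hopt : opt 1 P k = ENNReal.ofReal O) :
    ENNReal.ofReal (A * (O + σ ^ 2 * n * d * Real.log (k * d / √(α - 1)) ^ 2)) ≤
      stabilityParam A α σ P k * ENNReal.ofReal O := by
  have hO0 : ENNReal.ofReal O ≠ 0 := by simpa using hO
  have hσ : 0 ≤ σ ^ 2 * n * d := by positivity
  rw [stabilityParam, hopt, mul_assoc (ENNReal.ofReal _), add_mul, one_mul, ENNReal.div_mul_cancel hO0
    ENNReal.ofReal_ne_top, ENNReal.ofReal_mul hA, ENNReal.ofReal_add hO.le (by positivity),
    ENNReal.ofReal_mul hσ]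
  gcongr
  · exact le_mul_of_one_le_right hA hα
  · rw [logSq]
    split_ifs
    · exact le_top
    · exact le_rfl

/-- Stable data with limited outliers have separated clusters. -/
lemma exists_isSeparated (hd : 1 ≤ d) (hk : 2 ≤ k) {P : Dataset n d} {a α σ O : ℝ} (ha : 1 ≤ a)
    (hα : 1 ≤ α) (hO : 0 < O) (hopt : opt 1 P k = ENNReal.ofReal O)
    (h : DataAssumption (4 * 10 ^ 14 * a) α σ P k) :
    (α = 1 → σ = 0) ∧ ∃ (f : Fin n → Fin k) (c : Fin k → Pt d),
      ∑ p, ‖P p - c (f p)‖ ^ 2 = O ∧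
      IsSeparated P f c (O + a * (σ ^ 2 * n * d * Real.log (k * d / √(α - 1)) ^ 2)) := by
  obtain ⟨hstab, C, hCk, hcost, hrad⟩ := h
  obtain ⟨c, hcinj, hc⟩ := exists_enumeration hCk
  obtain ⟨f, hf⟩ := exists_nearest_center P (by omega) c
  have hsum : ∑ p, ‖P p - c (f p)‖ ^ 2 = O := by
    rw [cost_one_eq P c hc (by omega) f hf, hopt] at hcost
    exact (ENNReal.ofReal_eq_ofReal_iff (Finset.sum_nonneg fun _ _ => sq_nonneg _) hO.le).1 hcost
  have hn : 0 < n := by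
    rcases Nat.eq_zero_or_pos n with rfl | h
    · simp at hsum
      exact absurd hsum hO.ne
    · exact h
  have hO0 : ENNReal.ofReal O ≠ 0 := by simpa using hO
  have hmerge : ∀ i j, i ≠ j →
      ENNReal.ofReal O + stabilityParam (4 * 10 ^ 14 * a) α σ P k * ENNReal.ofReal O ≤
        ENNReal.ofReal (2 * O + 2 * (mass f i * ‖c i - c j‖ ^ 2)) := by
    intro i j hij
    rw [CostStable, ENNReal.le_div_iff_mul_le (Or.inl (hopt ▸ hO0))
      (Or.inl (hopt ▸ ENNReal.ofReal_ne_top)), hopt, add_mul, one_mul] at hstab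
    refine hstab.trans ?_
    have hci : c i ∈ C := (hc _).2 ⟨i, rfl⟩
    have hmem : ∀ l, l ≠ i → c l ∈ C.erase (c i) := fun l hl =>
      Finset.mem_erase.2 ⟨fun h => hl (hcinj h), (hc _).2 ⟨l, rfl⟩⟩
    have hcard : (C.erase (c i)).card = k - 1 := by rw [Finset.card_erase_of_mem hci, hCk]
    have h1 : opt 1 P (k - 1) ≤ cost 1 P (C.erase (c i)) :=
      iInf₂_le (f := fun (C : Finset (Pt d)) (_ : C.card = k - 1) => cost 1 P C) _ hcard
    refine h1.trans ((cost_one_le P (fun p => c (if f p = i then j else f p)) (fun p => ?_)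
      ⟨c j, hmem j (Ne.symm hij)⟩).trans (ENNReal.ofReal_le_ofReal ?_))
    · split_ifs with hp
      · exact hmem j (Ne.symm hij)
      · exact hmem _ hp
    · rw [← hsum]
      exact sum_merge_le c f i j
  constructor
  -- For `α = 1` and `σ ≠ 0` the stability parameter would be infinite, but merging two clusters has
  -- finite cost.
  · rintro rfl
    by_contra hσ
    obtain ⟨j, hj⟩ := exists_ne_of_two_le hk (⟨0, by omega⟩ : Fin k)
    have h1 := hmerge _ j hj
    have h2 : ENNReal.ofReal (σ ^ 2 * n * d) ≠ 0 := by
      rw [Ne, ENNReal.ofReal_eq_zero, not_le]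
      have : (0 : ℝ) < n := by exact_mod_cast hn
      have : (0 : ℝ) < d := by exact_mod_cast hd
      positivity
    have h3 : stabilityParam (4 * 10 ^ 14 * a) 1 σ P k = ⊤ := by
      rw [stabilityParam, logSq, if_pos rfl, ENNReal.mul_top h2, hopt,
        ENNReal.top_div_of_ne_top ENNReal.ofReal_ne_top, add_top, ENNReal.mul_top]
      rw [Ne, ENNReal.ofReal_eq_zero, not_le]
      positivity
    rw [h3, ENNReal.top_mul hO0, add_top] at h1
    exact ENNReal.ofReal_ne_top (top_le_iff.1 h1)
  · set lg := σ ^ 2 * n * d * Real.log (k * d / √(α - 1)) ^ 2 with hlg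
    have hlg0 : 0 ≤ lg := by positivity
    have halg : 0 ≤ a * lg := by positivity
    refine ⟨f, c, hsum, by linarith, fun i j hij => ?_, fun p => ?_⟩
    · have h1 := hmerge i j hij
      have h2 := le_stabilityParam_mul (σ := σ) (P := P) (k := k)
        (show 0 ≤ 4 * 10 ^ 14 * a by linarith) hα hO hopt
      rw [← hlg] at h2
      have h3 := (add_le_add_right h2 (ENNReal.ofReal O)).trans h1
      rw [← ENNReal.ofReal_add hO.le (by positivity), ENNReal.ofReal_le_ofReal_iff
        (by have := mass_nonneg f i; positivity)] at h3
      have h4 : O ≤ a * O := le_mul_of_one_le_left hO.le ha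
      linarith
    · have h1 := mass_mul_dist_sq_le hc hf hrad p
      rw [hsum] at h1
      linarith

end Stability

/-! ### The bounds for moderate noise -/

section Deterministic

variable {n d k m : ℕ}

/-- All that is needed about the noise, without probability. The second claim is for every good
sample, since it is not known which one the search returns. -/
lemma deterministic_bounds (hk : 2 ≤ k) {P X ξ : Dataset n d} (hX : X = fun p => P p + ξ p)
    {α ε e lam O N τ ϑ : ℝ} (hε : 0 < ε) (he : e = ε / 2000) (hα : 1 ≤ α) (hα2 : α ≤ 2)
    (hlam : lam = 2 + 8 * (α - 1) / e) (hem : 16 * (4 + 2 * lam) ≤ e * m) (hlm : lam ≤ m)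
    (hm : 0 < m) (hmε : m * ε ^ 2 ≤ 2 * 10 ^ 9)
    (hO : 0 < O) (hON : O ≤ N) (hopt : opt 1 P k = ENNReal.ofReal O) {f : Fin n → Fin k}
    {c : Fin k → Pt d} (hsep : IsSeparated P f c N) (hsum : ∑ p, ‖P p - c (f p)‖ ^ 2 = O)
    (hτ : 0 ≤ τ) (hτ1 : τ ≤ 1) (hϑ : 0 ≤ ϑ) (hslack : (α - 1) * τ ^ 2 ≤ 4 * ε ^ 2)
    (hξ : ∑ p, ‖ξ p‖ ^ 2 ≤ 400 * τ * O)
    (hmean : ∑ i, ‖∑ p ∈ fiber f i, ξ p‖ ^ 2 / mass f i ≤ 400 * ϑ * O)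
    (hcross : (∑ p, inner ℝ (P p - c (f p)) (ξ p)) ^ 2 ≤ 400 * ϑ * O ^ 2)
    (hcross' : (∑ p, inner ℝ (P p - c (f p)) (ξ p)) ^ 2 ≤ 400 * O ^ 2)
    (htail : tail N ξ ≤ (α - 1) * τ ^ 2 * O) :
    (∃ (π : Fin n → Fin k) (s : Fin k → Fin m → Fin n), IsGoodSample lam π s X) ∧
    ∀ (π : Fin n → Fin k) (s : Fin k → Fin m → Fin n), IsGoodSample lam π s X →
      ∀ C ∈ approxCenters (sampleWeight π s) X k α,
        ratio 1 X k C ≤ ENNReal.ofReal (1 + ε) * ratio (sampleWeight π s) X k C ∧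
        ratio 1 P k C ≤ ENNReal.ofReal (1 + (ε + 8000 * (ϑ + √(α - 1) / 2 * (√ϑ + τ)))) *
          ratio (sampleWeight π s) X k C := by
  have hα1 : 0 ≤ α - 1 := by linarith
  have he0 : 0 < e := by rw [he]; positivity
  have hlam2 : 2 ≤ lam := by
    rw [hlam]
    have : 0 ≤ 8 * (α - 1) / e := by positivity
    linarith
  have hδ0 : 0 ≤ (α - 1) * τ ^ 2 := by positivity
  have hδ1 : (α - 1) * τ ^ 2 ≤ 1 :=
    mul_le_one₀ (by linarith) (sq_nonneg _) (pow_le_one₀ hτ hτ1)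
  have hobs : ∑ p, ‖X p - c (f p)‖ ^ 2 =
      O + 2 * ∑ p, inner ℝ (P p - c (f p)) (ξ p) + ∑ p, ‖ξ p‖ ^ 2 := by
    rw [← hsum, Finset.mul_sum, ← Finset.sum_add_distrib, ← Finset.sum_add_distrib]
    refine Finset.sum_congr rfl fun p _ => ?_
    rw [← norm_add_sq_real, hX, sub_add_eq_add_sub]
  have hobs1 : ∑ p, ‖X p - c (f p)‖ ^ 2 ≤ (1 + 40 * √ϑ + 400 * τ) * O := by
    have h1 : ∑ p, inner ℝ (P p - c (f p)) (ξ p) ≤ 20 * √ϑ * O := by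
      refine le_of_abs_le (abs_le_of_sq_le_sq ?_ (by positivity))
      rw [mul_pow, mul_pow, Real.sq_sqrt hϑ]
      linarith
    rw [hobs]
    linarith
  -- A bound that does not involve the noise levels: `441 = 1 + 2 · 20 + 400`.
  have hobs2 : ∑ p, ‖X p - c (f p)‖ ^ 2 ≤ 441 * O := by
    have h1 : ∑ p, inner ℝ (P p - c (f p)) (ξ p) ≤ 20 * O := by
      refine le_of_abs_le (abs_le_of_sq_le_sq ?_ (by positivity))
      rw [mul_pow]
      linarith
    have h2 : 400 * τ * O ≤ 400 * O := mul_le_mul_of_nonneg_right (by linarith) hO.le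
    rw [hobs]
    linarith
  have hmatch : ∀ π : Fin n → Fin k, (∀ π' : Fin n → Fin k, partCost π X ≤ partCost π' X) →
      ∃ (f' : Fin n → Fin k) (c' : Fin k → Pt d), IsMatched P X ξ f' π c' (mean π X) N ∧
        ∑ p, ‖P p - c' (f' p)‖ ^ 2 = O ∧
        ∑ i, ‖∑ p ∈ fiber f' i, ξ p‖ ^ 2 / mass f' i ≤ 400 * ϑ * O := by
    intro π hπ
    have hΦ := (hπ f).trans (partCost_le f X c)
    obtain ⟨l, hl⟩ := hsep.exists_matching (π := π) (X := X) hk (by linarith) (by linarith)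
    -- The clusters of `P` are relabeled rather than the parts, because the labels of `π` are those
    -- of the sample.
    refine ⟨fun p => l (f p), fun i => c (l.symm i),
      { hsep.relabel l with
        two_le := hk
        add := hX
        close := fun i => ?_
        nearest := norm_sub_mean_le_of_minimal hπ
        tail_le := htail.trans ((mul_le_of_le_one_left hO.le hδ1).trans hON) }, ?_, ?_⟩
    · rw [mass_relabel]
      simpa using hl (l.symm i)
    · simpa using hsum
    · simp only [mass_relabel, sum_fiber_relabel]
      rw [Equiv.sum_comp l.symm fun i => ‖∑ p ∈ fiber f i, ξ p‖ ^ 2 / mass f i]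
      exact hmean
  constructor
  · obtain ⟨π, hπ⟩ := exists_minimal_partition (k := k) X (by omega)
    obtain ⟨f', c', hM, -, -⟩ := hmatch π hπ
    -- Here the slack enters: `δ ≤ 4 ε²` and `m ε² ≤ 2 · 10 ^ 9` give `m δ ≤ 8 · 10 ^ 9`.
    obtain ⟨s, hs⟩ := hM.exists_isGoodSample hπ (lam := lam) (δ := (α - 1) * τ ^ 2) hm (by linarith)
      hlm (htail.trans (mul_le_mul_of_nonneg_left hON hδ0)) (by
        have := mul_le_mul_of_nonneg_left hslack (Nat.cast_nonneg m) (α := ℝ)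
        linarith)
    exact ⟨π, s, hs⟩
  · intro π s hs C hC
    obtain ⟨f', c', hM, hsum', hmean'⟩ := hmatch π hs.minimal
    have hΦ := (hs.minimal f).trans (partCost_le f X c)
    refine ratio_le_of_isGoodSample hm (by omega) hX hε he hα hα2 hlam hem hs hM.mass_pos'
      (fun i j hij => (hM.sampleCost_le hs hlam2 (by linarith) hij).2)
      (fun i j hij => (hM.sampleCost_le hs hlam2 (by linarith) hij).1) hO hopt hτ hτ1 hϑ
      (hΦ.trans hobs1) (hΦ.trans hobs2) ?_ ?_ hC
    · have := hM.partCost_clean_le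
      rw [hsum'] at this
      linarith
    · refine hM.sum_mass_mul_norm_mean_sq_le.trans ?_
      have h1 : tail N ξ ^ 2 / N ≤ (α - 1) * τ ^ 2 * O := by
        rw [div_le_iff₀ (by linarith)]
        have h2 := tail_nonneg N ξ
        have h3 : tail N ξ ≤ N := hM.tail_le
        nlinarith
      linarith

end Deterministic

/-! ### Moments of the noise -/

section Moments

/-- Variances of independent centered variables add up. Stated for general factors so that it
applies first to the coordinates of one point and then to the points. -/
lemma sum_comp_eval_moments {ι : Type*} [Fintype ι] {Ω : ι → Type*} [∀ i, MeasurableSpace (Ω i)]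
    (μ : (i : ι) → Measure (Ω i)) [∀ i, IsProbabilityMeasure (μ i)] (g : (i : ι) → Ω i → ℝ)
    (hg : ∀ i, MemLp (g i) 2 (μ i)) (h0 : ∀ i, ∫ x, g i x ∂μ i = 0) :
    MemLp (fun ω : (i : ι) → Ω i => ∑ i, g i (ω i)) 2 (Measure.pi μ) ∧
      ∫ ω, ∑ i, g i (ω i) ∂Measure.pi μ = 0 ∧
      ∫ ω, (∑ i, g i (ω i)) ^ 2 ∂Measure.pi μ = ∑ i, ∫ x, g i x ^ 2 ∂μ i := by
  have hm : ∀ i, MemLp (fun ω : (i : ι) → Ω i => g i (ω i)) 2 (Measure.pi μ) := fun i =>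
    (hg i).comp_measurePreserving (measurePreserving_eval _ i)
  have h1 : MemLp (fun ω : (i : ι) → Ω i => ∑ i, g i (ω i)) 2 (Measure.pi μ) :=
    memLp_finsetSum _ fun i _ => hm i
  have h2 : ∫ ω, ∑ i, g i (ω i) ∂Measure.pi μ = 0 := by
    rw [integral_finsetSum _ fun i _ => (hm i).integrable (by norm_num)]
    refine Finset.sum_eq_zero fun i _ => ?_
    rw [integral_comp_eval (hg i).aestronglyMeasurable, h0]
  refine ⟨h1, h2, ?_⟩
  rw [← variance_of_integral_eq_zero h1.aestronglyMeasurable.aemeasurable h2]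
  have h3 := variance_sum_pi hg
  have h4 : (∑ i, fun ω : (i : ι) → Ω i => g i (ω i)) = fun ω => ∑ i, g i (ω i) := by
    ext ω
    simp
  rw [h4] at h3
  rw [h3]
  exact Finset.sum_congr rfl fun i _ =>
    variance_of_integral_eq_zero (hg i).aestronglyMeasurable.aemeasurable (h0 i)

variable {n d k : ℕ} {κ σ : ℝ} {D : Fin d → Measure ℝ}

lemma IsNoise.integral_sq {D : Measure ℝ} (h : IsNoise κ σ D) : ∫ x, x ^ 2 ∂D = σ ^ 2 := by
  rw [← h.variance_eq]
  exact (variance_of_integral_eq_zero h.memLp.aestronglyMeasurable.aemeasurable h.mean).symm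

lemma isProbabilityMeasure_noiseLaw (n : ℕ) (hD : ∀ j, IsNoise κ σ (D j)) :
    IsProbabilityMeasure (noiseLaw n D) := by
  have := fun j => (hD j).isProbabilityMeasure
  unfold noiseLaw
  infer_instance

/-- The second moment of a linear form in the noise. -/
lemma lintegral_linear_sq (n : ℕ) (hD : ∀ j, IsNoise κ σ (D j)) (v : Fin n → Fin d → ℝ) :
    ∫⁻ ξ, ENNReal.ofReal ((∑ p, ∑ j, v p j * ξ p j) ^ 2) ∂noiseLaw n D =
      ENNReal.ofReal (σ ^ 2 * ∑ p, ∑ j, v p j ^ 2) := by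
  have := fun j => (hD j).isProbabilityMeasure
  have h1 := fun p => sum_comp_eval_moments D (fun j x => v p j * x)
    (fun j => (hD j).memLp.const_mul _) fun j => by
      rw [integral_const_mul, (hD j).mean, mul_zero]
  have h2 := sum_comp_eval_moments (fun _ : Fin n => Measure.pi D) (fun p x => ∑ j, v p j * x j)
    (fun p => (h1 p).1) fun p => (h1 p).2.1
  rw [noiseLaw, ← ofReal_integral_eq_lintegral_ofReal h2.1.integrable_sq
    (Filter.Eventually.of_forall fun _ => sq_nonneg _), h2.2.2]
  congr 1
  rw [Finset.mul_sum]
  refine Finset.sum_congr rfl fun p _ => ?_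
  rw [(h1 p).2.2, Finset.mul_sum]
  refine Finset.sum_congr rfl fun j _ => ?_
  simp only [mul_pow]
  rw [integral_const_mul, (hD j).integral_sq, mul_comm]

lemma lintegral_sum_linear_sq {A : Type*} [Fintype A] (n : ℕ) (hD : ∀ j, IsNoise κ σ (D j))
    (v : A → Fin n → Fin d → ℝ) :
    ∫⁻ ξ, ENNReal.ofReal (∑ a, (∑ p, ∑ j, v a p j * ξ p j) ^ 2) ∂noiseLaw n D =
      ENNReal.ofReal (σ ^ 2 * ∑ a, ∑ p, ∑ j, v a p j ^ 2) := by
  have h1 : ∀ ξ : Fin n → Fin d → ℝ, ENNReal.ofReal (∑ a, (∑ p, ∑ j, v a p j * ξ p j) ^ 2) =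
      ∑ a, ENNReal.ofReal ((∑ p, ∑ j, v a p j * ξ p j) ^ 2) := fun ξ =>
    ENNReal.ofReal_sum_of_nonneg fun a _ => sq_nonneg _
  simp only [h1]
  rw [lintegral_finsetSum _ fun a _ => by fun_prop]
  simp only [lintegral_linear_sq n hD]
  rw [Finset.mul_sum, ENNReal.ofReal_sum_of_nonneg fun a _ => by positivity]

lemma lintegral_comp_coord (n : ℕ) (hD : ∀ j, IsNoise κ σ (D j)) {g : ℝ → ℝ≥0∞} (hg : Measurable g)
    (p : Fin n) (j : Fin d) : ∫⁻ ξ, g (ξ p j) ∂noiseLaw n D = ∫⁻ x, g x ∂D j := by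
  have := fun j => (hD j).isProbabilityMeasure
  have h1 : MeasurePreserving (fun ξ : Fin n → Fin d → ℝ => ξ p j) (noiseLaw n D) (D j) :=
    (measurePreserving_eval D j).comp (measurePreserving_eval (fun _ : Fin n => Measure.pi D) p)
  exact h1.lintegral_comp hg

/-- The Bernstein condition bounds an exponential moment. -/
lemma lintegral_exp_le {D : Measure ℝ} (hκ : 0 < κ) (hσ : 0 < σ) (h : IsNoise κ σ D) :
    ∫⁻ x, ENNReal.ofReal (Real.exp (|x| / (2 * (κ * σ)))) ∂D ≤
      ENNReal.ofReal (4 * (1 + 1 / κ ^ 2)) := by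
  have := h.isProbabilityMeasure
  set b := κ * σ with hb
  have hb0 : 0 < b := by positivity
  have hb2 : σ ^ 2 / b ^ 2 = 1 / κ ^ 2 := by
    rw [hb]
    field_simp
  set K := 1 + 1 / κ ^ 2 with hK
  have hκ2 : 0 < 1 / κ ^ 2 := by positivity
  have hK' : K = 1 + (κ ^ 2)⁻¹ := by rw [hK, one_div]
  have hκ2' : 0 < (κ ^ 2)⁻¹ := by positivity
  have hsq : Integrable (fun x : ℝ => (|x| / (2 * b)) ^ 2) D := by
    have h1 : Integrable (fun x : ℝ => x ^ 2) D := h.memLp.integrable_sq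
    have h2 : (fun x : ℝ => (|x| / (2 * b)) ^ 2) = fun x => x ^ 2 * (1 / (2 * b) ^ 2) := by
      ext x
      rw [div_pow, sq_abs, mul_one_div]
    rw [h2]
    exact h1.mul_const _
  have hsqi : ∫ x, (|x| / (2 * b)) ^ 2 ∂D = 1 / κ ^ 2 / 4 := by
    have h2 : (fun x : ℝ => (|x| / (2 * b)) ^ 2) = fun x => x ^ 2 * (1 / (2 * b) ^ 2) := by
      ext x
      rw [div_pow, sq_abs, mul_one_div]
    rw [h2, integral_mul_const, h.integral_sq, ← hb2]
    ring
  -- The factorial of the Bernstein condition cancels that of the exponential series, and the scale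
  -- `2 b` leaves a geometric series. The condition starts at `i = 3`; the first moment is bounded
  -- by AM-GM through the second.
  have hterm : ∀ i : ℕ, ∫⁻ x, ENNReal.ofReal ((|x| / (2 * b)) ^ i / i.factorial) ∂D ≤
      ENNReal.ofReal (2 * K * (1 / 2) ^ i) := by
    intro i
    have key : ∀ g : ℝ → ℝ, Integrable g D → (∀ x, 0 ≤ g x) →
        (∀ x, (|x| / (2 * b)) ^ i / i.factorial ≤ g x) →
        ∫ x, g x ∂D ≤ 2 * K * (1 / 2) ^ i →
        ∫⁻ x, ENNReal.ofReal ((|x| / (2 * b)) ^ i / i.factorial) ∂D ≤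
          ENNReal.ofReal (2 * K * (1 / 2) ^ i) := by
      intro g hg hg0 hle hint
      refine (lintegral_mono fun x => ENNReal.ofReal_le_ofReal (hle x)).trans ?_
      rw [← ofReal_integral_eq_lintegral_ofReal hg (Filter.Eventually.of_forall hg0)]
      exact ENNReal.ofReal_le_ofReal hint
    rcases i with _ | _ | _ | i
    · refine key (fun _ => 1) (integrable_const _) (fun _ => zero_le_one) (fun x => by simp) ?_
      simp
      linarith
    · refine key (fun x => (1 + (|x| / (2 * b)) ^ 2) / 2)
        (((integrable_const _).add hsq).div_const 2) (fun x => by positivity) (fun x => ?_) ?_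
      · simp only [zero_add, pow_one, Nat.factorial_one, Nat.cast_one, div_one]
        linarith [sq_nonneg (|x| / (2 * b) - 1)]
      · rw [integral_div, integral_add (integrable_const _) hsq, hsqi]
        simp
        linarith
    · refine key (fun x => (|x| / (2 * b)) ^ 2) hsq (fun x => by positivity) (fun x => ?_) ?_
      · simp only [zero_add, Nat.reduceAdd]
        exact div_le_self (by positivity) (by norm_num [Nat.factorial])
      · rw [hsqi]
        norm_num
        linarith
    · obtain ⟨h1, h2⟩ := h.bernstein (i + 3) (by omega)
      simp only [h.mean, sub_zero] at h1 h2
      rw [h.variance_eq, ← hb] at h2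
      have h3 : (fun x : ℝ => (|x| / (2 * b)) ^ (i + 3) / ((i + 3).factorial : ℝ)) =
          fun x => |x| ^ (i + 3) * (1 / ((2 * b) ^ (i + 3) * (i + 3).factorial)) := by
        ext x
        rw [div_pow, div_div, mul_one_div]
      refine key (fun x => (|x| / (2 * b)) ^ (i + 3) / ((i + 3).factorial : ℝ)) ?_
        (fun x => by positivity) (fun x => le_rfl) ?_
      · rw [h3]
        exact h1.mul_const _
      · rw [h3, integral_mul_const]
        refine (mul_le_mul_of_nonneg_right h2 (by positivity)).trans ?_
        have h4 : 1 / 2 * ((i + 3).factorial : ℝ) * σ ^ 2 * b ^ (i + 3 - 2) *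
            (1 / ((2 * b) ^ (i + 3) * ((i + 3).factorial : ℝ))) =
            1 / 2 * (σ ^ 2 / b ^ 2) * (1 / 2) ^ (i + 3) := by
          have hf : ((i + 3).factorial : ℝ) ≠ 0 := by positivity
          have h5 : i + 3 - 2 = i + 1 := by omega
          rw [h5, mul_pow, one_div_pow]
          field_simp
          ring
        rw [h4, hb2]
        exact mul_le_mul_of_nonneg_right (by linarith) (by positivity)
  have hexp : ∀ x : ℝ, ENNReal.ofReal (Real.exp (|x| / (2 * b))) =
      ∑' i : ℕ, ENNReal.ofReal ((|x| / (2 * b)) ^ i / i.factorial) := by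
    intro x
    rw [Real.exp_eq_exp_ℝ, NormedSpace.exp_eq_tsum_div]
    exact ENNReal.ofReal_tsum_of_nonneg (fun i => by positivity)
      (Real.summable_pow_div_factorial _)
  simp only [hexp]
  rw [lintegral_tsum fun i => by fun_prop]
  refine (ENNReal.tsum_le_tsum hterm).trans ?_
  rw [← ENNReal.ofReal_tsum_of_nonneg (fun i => by positivity)
    (summable_geometric_two.mul_left _), tsum_mul_left, tsum_geometric_two]
  exact ENNReal.ofReal_le_ofReal (by linarith)

/-- The fourth moment of the noise beyond a threshold. -/
lemma lintegral_tail_le {D : Measure ℝ} (hκ : 0 < κ) (hσ : 0 ≤ σ) (h : IsNoise κ σ D) (u : ℝ) :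
    ∫⁻ x, ENNReal.ofReal (if (u * σ) ^ 2 ≤ x ^ 2 then x ^ 4 else 0) ∂D ≤
      ENNReal.ofReal (24576 * (κ ^ 4 + κ ^ 2) * σ ^ 4 * Real.exp (-(u / (4 * κ)))) := by
  have := h.isProbabilityMeasure
  rcases hσ.eq_or_lt with rfl | hσ
  · have h1 : ∀ᵐ x ∂D, x = 0 := by
      have h2 := ae_eq_integral_of_variance_eq_zero h.memLp (by simpa using h.variance_eq)
      simpa [h.mean] using h2
    refine le_trans (le_of_eq ?_) bot_le
    rw [bot_eq_zero, ← lintegral_zero (μ := D)]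
    refine lintegral_congr_ae ?_
    filter_upwards [h1] with x hx
    simp [hx]
  · set b := κ * σ with hb
    have hb0 : 0 < b := by positivity
    -- With `w = |x| / (4 b)`, write `exp (2 w) = exp w · exp w`: one factor dominates `w ^ 4 / 4!`,
    -- which gives `6144 = 4 ^ 4 · 4!`, the other is at least `exp (u / (4 κ))` beyond the
    -- threshold.
    have hpt : ∀ x : ℝ, ENNReal.ofReal (if (u * σ) ^ 2 ≤ x ^ 2 then x ^ 4 else 0) ≤
        ENNReal.ofReal (6144 * b ^ 4 * Real.exp (-(u / (4 * κ)))) *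
          ENNReal.ofReal (Real.exp (|x| / (2 * b))) := by
      intro x
      rw [← ENNReal.ofReal_mul (by positivity)]
      refine ENNReal.ofReal_le_ofReal ?_
      split_ifs with hx
      · have h1 : u * σ ≤ |x| := (le_abs_self _).trans (sq_le_sq.1 hx)
        have h2 := Real.pow_div_factorial_le_exp (|x| / (4 * b)) (by positivity) 4
        rw [div_pow, Even.pow_abs (by decide), div_div, div_le_iff₀ (by positivity)] at h2
        have h3 : Real.exp (|x| / (4 * b)) ≤
            Real.exp (-(u / (4 * κ))) * Real.exp (|x| / (2 * b)) := by
          rw [← Real.exp_add]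
          refine Real.exp_le_exp.2 ?_
          have h4 : u / (4 * κ) ≤ |x| / (4 * b) := by
            rw [div_le_div_iff₀ (by positivity) (by positivity), hb]
            nlinarith
          have h5 : |x| / (2 * b) = |x| / (4 * b) + |x| / (4 * b) := by
            field_simp
            ring
          linarith
        have h6 := mul_le_mul_of_nonneg_right h3
          (show 0 ≤ (4 * b) ^ 4 * ((Nat.factorial 4 : ℕ) : ℝ) by positivity)
        refine h2.trans (h6.trans (le_of_eq ?_))
        norm_num [Nat.factorial]
        ring
      · positivity
    refine (lintegral_mono hpt).trans ?_
    rw [lintegral_const_mul' _ _ ENNReal.ofReal_ne_top]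
    refine (mul_le_mul_right (lintegral_exp_le hκ hσ h) _).trans ?_
    rw [← ENNReal.ofReal_mul (by positivity)]
    refine ENNReal.ofReal_le_ofReal (le_of_eq ?_)
    rw [hb]
    field_simp
    ring

/-- The expected tail of the noise. -/
lemma lintegral_tail_noise_le (n : ℕ) (hκ : 0 < κ) (hσ : 0 ≤ σ) (hD : ∀ j, IsNoise κ σ (D j))
    {O u : ℝ} (hO : 0 < O) :
    ∫⁻ ξ, ENNReal.ofReal (tail (O + u ^ 2 * (σ ^ 2 * n * d))
        fun p => (WithLp.toLp 2 (ξ p) : Pt d)) ∂noiseLaw n D ≤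
      ENNReal.ofReal (n * d * (n * d ^ 2 / O) *
        (24576 * (κ ^ 4 + κ ^ 2) * σ ^ 4 * Real.exp (-(u / (4 * κ))))) := by
  set g : ℝ → ℝ := fun x => if (u * σ) ^ 2 ≤ x ^ 2 then x ^ 4 else 0 with hg
  have hg0 : ∀ x, 0 ≤ g x := fun x => by
    simp only [hg]
    split_ifs <;> positivity
  have hgm : Measurable g :=
    Measurable.ite (measurableSet_le measurable_const (by fun_prop)) (by fun_prop) measurable_const
  -- Both summands of the threshold are used. With `T = ‖ξ p‖²`, the second makes the largest
  -- squared coordinate, at least `T / d`, exceed `(u σ)²`; the first gives `T ≤ n T² / O`, and `T²`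
  -- is at most `d²` times the fourth power of that coordinate.
  have hpt : ∀ ξ : Fin n → Fin d → ℝ, tail (O + u ^ 2 * (σ ^ 2 * n * d))
      (fun p => (WithLp.toLp 2 (ξ p) : Pt d)) ≤ ∑ p, ∑ j, n * d ^ 2 / O * g (ξ p j) := by
    intro ξ
    refine Finset.sum_le_sum fun p _ => ?_
    have hnn : ∀ j ∈ (Finset.univ : Finset (Fin d)), 0 ≤ n * d ^ 2 / O * g (ξ p j) := fun j _ =>
      mul_nonneg (by positivity) (hg0 _)
    split_ifs with hN
    · set T := ‖(WithLp.toLp 2 (ξ p) : Pt d)‖ ^ 2 with hT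
      have hTsum : T = ∑ j, ξ p j ^ 2 := by
        rw [hT, EuclideanSpace.norm_sq_eq]
        simp
      have hun : 0 ≤ u ^ 2 * (σ ^ 2 * n * d) := by positivity
      have hn : (0 : ℝ) < n := by
        refine lt_of_le_of_ne (Nat.cast_nonneg n) fun h0 => ?_
        rw [← h0, zero_mul] at hN
        rw [← h0] at hun
        linarith
      have hTpos : 0 < T := pos_of_mul_pos_right (lt_of_lt_of_le (by linarith) hN) hn.le
      have hd : 0 < d := by
        rcases Nat.eq_zero_or_pos d with rfl | hd
        · simp [hTsum] at hTpos
        · exact hd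
      have hd0 : (0 : ℝ) < d := by exact_mod_cast hd
      obtain ⟨j, -, hj⟩ : ∃ j ∈ (Finset.univ : Finset (Fin d)), T / d ≤ ξ p j ^ 2 := by
        refine Finset.exists_le_of_sum_le ⟨⟨0, hd⟩, Finset.mem_univ _⟩ ?_
        rw [Finset.sum_const, Finset.card_univ, Fintype.card_fin, nsmul_eq_mul,
          mul_div_cancel₀ _ hd0.ne', hTsum]
      have hj' : (u * σ) ^ 2 ≤ ξ p j ^ 2 := by
        refine le_trans ?_ hj
        rw [le_div_iff₀ hd0]
        refine le_of_mul_le_mul_left ?_ hn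
        linarith
      refine le_trans ?_ (Finset.single_le_sum hnn (Finset.mem_univ j))
      simp only [hg]
      rw [if_pos hj']
      have h1 : (T / d) ^ 2 ≤ (ξ p j ^ 2) ^ 2 := pow_le_pow_left₀ (by positivity) hj 2
      have h2 : O * T ≤ n * T * T := mul_le_mul_of_nonneg_right (by linarith) hTpos.le
      have h3 : n * d ^ 2 / O * (T / d) ^ 2 ≤ n * d ^ 2 / O * ξ p j ^ 4 := by
        refine mul_le_mul_of_nonneg_left ?_ (by positivity)
        calc _ ≤ _ := h1
          _ = _ := by ring
      refine le_trans ?_ h3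
      have h4 : n * d ^ 2 / O * (T / d) ^ 2 = n * T * T / O := by
        field_simp
      rw [h4, le_div_iff₀ hO]
      linarith
    · exact Finset.sum_nonneg hnn
  refine (lintegral_mono fun ξ => ENNReal.ofReal_le_ofReal (hpt ξ)).trans ?_
  have h1 : ∀ ξ : Fin n → Fin d → ℝ, ENNReal.ofReal (∑ p, ∑ j, n * d ^ 2 / O * g (ξ p j)) =
      ∑ p, ∑ j, ENNReal.ofReal (n * d ^ 2 / O) * ENNReal.ofReal (g (ξ p j)) := by
    intro ξ
    rw [ENNReal.ofReal_sum_of_nonneg fun p _ =>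
      Finset.sum_nonneg fun j _ => mul_nonneg (by positivity) (hg0 _)]
    refine Finset.sum_congr rfl fun p _ => ?_
    rw [ENNReal.ofReal_sum_of_nonneg fun j _ => mul_nonneg (by positivity) (hg0 _)]
    exact Finset.sum_congr rfl fun j _ => ENNReal.ofReal_mul (by positivity)
  simp only [h1]
  have hmeas : ∀ (p : Fin n) (j : Fin d),
      Measurable fun ξ : Fin n → Fin d → ℝ => ENNReal.ofReal (g (ξ p j)) := fun p j =>
    ENNReal.measurable_ofReal.comp (hgm.comp (by fun_prop))
  rw [lintegral_finsetSum _ fun p _ => Finset.measurable_sum _ fun j _ =>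
    (hmeas p j).const_mul _]
  have h2 : ∀ p : Fin n, ∫⁻ ξ, ∑ j, ENNReal.ofReal (n * d ^ 2 / O) * ENNReal.ofReal (g (ξ p j))
      ∂noiseLaw n D ≤ ∑ _j : Fin d, ENNReal.ofReal (n * d ^ 2 / O *
        (24576 * (κ ^ 4 + κ ^ 2) * σ ^ 4 * Real.exp (-(u / (4 * κ))))) := by
    intro p
    rw [lintegral_finsetSum _ fun j _ => (hmeas p j).const_mul _]
    refine Finset.sum_le_sum fun j _ => ?_
    rw [lintegral_const_mul _ (hmeas p j),
      lintegral_comp_coord n hD (g := fun x => ENNReal.ofReal (g x))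
        (ENNReal.measurable_ofReal.comp hgm) p j, ENNReal.ofReal_mul (by positivity)]
    gcongr
    exact lintegral_tail_le hκ hσ (hD j) u
  refine (Finset.sum_le_sum fun p _ => h2 p).trans (le_of_eq ?_)
  rw [Finset.sum_const, Finset.sum_const, Finset.card_univ, Finset.card_univ, Fintype.card_fin,
    Fintype.card_fin, smul_smul, nsmul_eq_mul, mul_assoc _ (n * d ^ 2 / O : ℝ), ← Nat.cast_mul,
    ENNReal.ofReal_mul (p := ((n * d : ℕ) : ℝ)) (Nat.cast_nonneg _), ENNReal.ofReal_natCast]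

/-- Markov's inequality, also for a vanishing mean. -/
lemma measure_lt_le_of_lintegral_le {Ω : Type*} [MeasurableSpace Ω] (μ : Measure Ω)
    {g : Ω → ℝ} (hg : Measurable g) {a : ℝ} (h : ∫⁻ ω, ENNReal.ofReal (g ω) ∂μ ≤ ENNReal.ofReal a)
    (ha : 0 ≤ a) : μ {ω | 400 * a < g ω} ≤ 1 / 400 := by
  have hm : Measurable fun ω => ENNReal.ofReal (g ω) := ENNReal.measurable_ofReal.comp hg
  rcases ha.eq_or_lt with rfl | ha
  · rw [ENNReal.ofReal_zero, nonpos_iff_eq_zero, lintegral_eq_zero_iff hm] at h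
    have h1 : μ {ω | 400 * 0 < g ω} = 0 := by
      have h2 : ∀ᵐ ω ∂μ, ¬ 400 * 0 < g ω := by
        filter_upwards [h] with ω hω
        simpa using hω
      simpa [ae_iff] using h2
    rw [h1]
    exact bot_le
  · have h1 := mul_meas_ge_le_lintegral (μ := μ) hm (ENNReal.ofReal (400 * a))
    have h2 : μ {ω | 400 * a < g ω} ≤ μ {ω | ENNReal.ofReal (400 * a) ≤ ENNReal.ofReal (g ω)} :=
      measure_mono fun ω hω => ENNReal.ofReal_le_ofReal (le_of_lt hω)
    refine h2.trans ?_
    have ha0 : ENNReal.ofReal a ≠ 0 := by simpa using ha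
    rw [ENNReal.le_div_iff_mul_le (Or.inl (by norm_num)) (Or.inl (by norm_num))]
    refine (ENNReal.mul_le_mul_iff_right ha0 ENNReal.ofReal_ne_top).1 ?_
    rw [ENNReal.ofReal_mul (by norm_num)] at h1
    have h4 : ENNReal.ofReal 400 = 400 := by norm_num
    rw [h4] at h1
    calc _ = 400 * ENNReal.ofReal a *
          μ {ω | 400 * ENNReal.ofReal a ≤ ENNReal.ofReal (g ω)} := by
          rw [ENNReal.ofReal_mul (by norm_num), h4]
          ring
      _ ≤ _ := (h1.trans h).trans (by simp)

end Moments

/-! ### The good event -/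

section Event

variable {n d k : ℕ} {κ σ : ℝ} {D : Fin d → Measure ℝ}

lemma lintegral_sum_norm_sq (n : ℕ) (hD : ∀ j, IsNoise κ σ (D j)) :
    ∫⁻ ξ, ENNReal.ofReal (∑ p : Fin n, ‖(WithLp.toLp 2 (ξ p) : Pt d)‖ ^ 2) ∂noiseLaw n D ≤
      ENNReal.ofReal (σ ^ 2 * (n * d)) := by
  -- The squared norm is a sum of squares of linear forms, one for each coordinate of each point.
  have h := lintegral_sum_linear_sq (A := Fin n × Fin d) n hD
    (fun a p j => if p = a.1 then (if j = a.2 then 1 else 0) else 0)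
  simp only [ite_mul, one_mul, zero_mul, Finset.sum_ite_irrel, Finset.sum_const_zero,
    Finset.sum_ite_eq', Finset.mem_univ, if_true, ite_pow, one_pow, ne_eq, OfNat.ofNat_ne_zero,
    not_false_eq_true, zero_pow, Fintype.sum_prod_type, Finset.sum_const,
    Finset.card_univ, Fintype.card_prod, Fintype.card_fin, Nat.cast_mul, nsmul_eq_mul, mul_one] at h
  simp only [EuclideanSpace.norm_sq_eq, Real.norm_eq_abs, sq_abs]
  exact h.le

lemma lintegral_sum_norm_fiber_sq (hD : ∀ j, IsNoise κ σ (D j)) (f : Fin n → Fin k) :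
    ∫⁻ ξ, ENNReal.ofReal (∑ i, ‖∑ p ∈ fiber f i, (WithLp.toLp 2 (ξ p) : Pt d)‖ ^ 2 / mass f i)
      ∂noiseLaw n D ≤ ENNReal.ofReal (σ ^ 2 * (k * d)) := by
  have h := lintegral_sum_linear_sq (A := Fin k × Fin d) n hD
    (fun a p j => if f p = a.1 then (if j = a.2 then (√(mass f a.1))⁻¹ else 0) else 0)
  simp only [ite_mul, zero_mul, Finset.sum_ite_irrel, Finset.sum_const_zero,
    Finset.sum_ite_eq', Finset.mem_univ, if_true, ite_pow, ne_eq, OfNat.ofNat_ne_zero,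
    not_false_eq_true, zero_pow, Fintype.sum_prod_type] at h
  have h1 : ∀ (ξ : Fin n → Fin d → ℝ) (i : Fin k),
      ‖∑ p ∈ fiber f i, (WithLp.toLp 2 (ξ p) : Pt d)‖ ^ 2 / mass f i =
        ∑ j, (∑ p, if f p = i then (√(mass f i))⁻¹ * ξ p j else 0) ^ 2 := by
    intro ξ i
    rw [EuclideanSpace.norm_sq_eq, Finset.sum_div]
    refine Finset.sum_congr rfl fun j _ => ?_
    rw [← Finset.sum_filter, ← Finset.mul_sum, mul_pow, inv_pow, Real.sq_sqrt (mass_nonneg f i),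
      Real.norm_eq_abs, sq_abs, div_eq_inv_mul]
    simp [fiber]
  simp only [h1]
  rw [h]
  refine ENNReal.ofReal_le_ofReal (mul_le_mul_of_nonneg_left ?_ (sq_nonneg _))
  have h2 : ∀ (i : Fin k) (j : Fin d),
      ∑ p, (if f p = i then (√(mass f i))⁻¹ ^ 2 else 0) ≤ 1 := by
    -- The sum is `mass f i` times its inverse, which is `1`, or `0` for an empty cluster.
    intro i j
    rw [← Finset.sum_filter, Finset.sum_const, nsmul_eq_mul, inv_pow,
      Real.sq_sqrt (mass_nonneg f i)]
    exact mul_inv_le_one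
  refine (Finset.sum_le_sum fun i _ => Finset.sum_le_sum fun j _ => h2 i j).trans (le_of_eq ?_)
  simp

lemma lintegral_sum_inner_sq (hD : ∀ j, IsNoise κ σ (D j)) (v : Fin n → Pt d) :
    ∫⁻ ξ, ENNReal.ofReal ((∑ p, inner ℝ (v p) (WithLp.toLp 2 (ξ p) : Pt d)) ^ 2) ∂noiseLaw n D =
      ENNReal.ofReal (σ ^ 2 * ∑ p, ‖v p‖ ^ 2) := by
  have h := lintegral_linear_sq n hD fun p j => v p j
  simp only [EuclideanSpace.norm_sq_eq, Real.norm_eq_abs, sq_abs]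
  rw [← h]
  simp only [PiLp.inner_apply, RCLike.inner_apply, conj_trivial, mul_comm]

lemma measurable_noise (p : Fin n) :
    Measurable fun ξ : Fin n → Fin d → ℝ => (WithLp.toLp 2 (ξ p) : Pt d) :=
  (WithLp.measurable_toLp 2 _).comp (measurable_pi_apply p)

/-- The noise is moderate with high probability. -/
lemma exists_good_event (hD : ∀ j, IsNoise κ σ (D j)) (f : Fin n → Fin k) (v : Fin n → Pt d)
    {O N T : ℝ} (hv : ∑ p, ‖v p‖ ^ 2 = O) (hT0 : 0 ≤ T)
    (hT : ∫⁻ ξ, ENNReal.ofReal (tail N fun p => (WithLp.toLp 2 (ξ p) : Pt d)) ∂noiseLaw n D ≤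
      ENNReal.ofReal T) :
    ∃ G : Set (Fin n → Fin d → ℝ), MeasurableSet G ∧ 99 / 100 ≤ noiseLaw n D G ∧ ∀ ξ ∈ G,
      ∑ p, ‖(WithLp.toLp 2 (ξ p) : Pt d)‖ ^ 2 ≤ 400 * (σ ^ 2 * (n * d)) ∧
      ∑ i, ‖∑ p ∈ fiber f i, (WithLp.toLp 2 (ξ p) : Pt d)‖ ^ 2 / mass f i ≤
        400 * (σ ^ 2 * (k * d)) ∧
      (∑ p, inner ℝ (v p) (WithLp.toLp 2 (ξ p) : Pt d)) ^ 2 ≤ 400 * (σ ^ 2 * O) ∧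
      tail N (fun p => (WithLp.toLp 2 (ξ p) : Pt d)) ≤ 400 * T := by
  have := isProbabilityMeasure_noiseLaw n hD
  have hm := measurable_noise (n := n) (d := d)
  set g₁ := fun ξ : Fin n → Fin d → ℝ => ∑ p, ‖(WithLp.toLp 2 (ξ p) : Pt d)‖ ^ 2
  set g₂ := fun ξ : Fin n → Fin d → ℝ =>
    ∑ i, ‖∑ p ∈ fiber f i, (WithLp.toLp 2 (ξ p) : Pt d)‖ ^ 2 / mass f i
  set g₃ := fun ξ : Fin n → Fin d → ℝ =>
    (∑ p, inner ℝ (v p) (WithLp.toLp 2 (ξ p) : Pt d)) ^ 2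
  set g₄ := fun ξ : Fin n → Fin d → ℝ => tail N (fun p => (WithLp.toLp 2 (ξ p) : Pt d))
  have m₁ : Measurable g₁ := Finset.measurable_sum _ fun p _ => (hm p).norm.pow_const 2
  have m₂ : Measurable g₂ := Finset.measurable_sum _ fun i _ =>
    ((Finset.measurable_sum _ fun p _ => hm p).norm.pow_const 2).div_const _
  have m₃ : Measurable g₃ :=
    (Finset.measurable_sum _ fun p _ => measurable_const.inner (hm p)).pow_const 2
  have m₄ : Measurable g₄ := Finset.measurable_sum _ fun p _ =>
    Measurable.ite (measurableSet_le measurable_const (((hm p).norm.pow_const 2).const_mul _))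
      ((hm p).norm.pow_const 2) measurable_const
  have b₁ := measure_lt_le_of_lintegral_le _ m₁ (lintegral_sum_norm_sq n hD) (by positivity)
  have b₂ := measure_lt_le_of_lintegral_le _ m₂ (lintegral_sum_norm_fiber_sq hD f) (by positivity)
  have b₃ := measure_lt_le_of_lintegral_le _ m₃ (lintegral_sum_inner_sq hD v).le (by positivity)
  have b₄ := measure_lt_le_of_lintegral_le _ m₄ hT hT0
  rw [hv] at b₃
  set B₁ := {ξ | 400 * (σ ^ 2 * (n * d)) < g₁ ξ}
  set B₂ := {ξ | 400 * (σ ^ 2 * (k * d)) < g₂ ξ}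
  set B₃ := {ξ | 400 * (σ ^ 2 * O) < g₃ ξ}
  set B₄ := {ξ | 400 * T < g₄ ξ}
  have hB : MeasurableSet (B₁ ∪ B₂ ∪ B₃ ∪ B₄) :=
    (((measurableSet_lt measurable_const m₁).union (measurableSet_lt measurable_const m₂)).union
      (measurableSet_lt measurable_const m₃)).union (measurableSet_lt measurable_const m₄)
  -- Four exceptional events of probability `1/400` use up the allowed `1/100`.
  have hBle : noiseLaw n D (B₁ ∪ B₂ ∪ B₃ ∪ B₄) ≤ 1 / 400 + 1 / 400 + 1 / 400 + 1 / 400 :=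
    (measure_union_le _ _).trans (add_le_add ((measure_union_le _ _).trans
      (add_le_add ((measure_union_le _ _).trans (add_le_add b₁ b₂)) b₃)) b₄)
  refine ⟨(B₁ ∪ B₂ ∪ B₃ ∪ B₄)ᶜ, hB.compl, ?_, fun ξ hξ => ?_⟩
  · rw [prob_compl_eq_one_sub hB]
    refine le_trans ?_ (tsub_le_tsub_left hBle 1)
    refine ENNReal.le_sub_of_add_le_left (by finiteness) (le_of_eq ?_)
    rw [← ENNReal.toReal_eq_toReal_iff' (by finiteness) (by finiteness)]
    rw [ENNReal.toReal_add (by finiteness) (by finiteness), ENNReal.toReal_add (by finiteness)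
      (by finiteness), ENNReal.toReal_add (by finiteness) (by finiteness),
      ENNReal.toReal_add (by finiteness) (by finiteness)]
    simp only [ENNReal.toReal_div, ENNReal.toReal_one, ENNReal.toReal_ofNat]
    norm_num
  · simp only [Set.mem_compl_iff, Set.mem_union, not_or] at hξ
    exact ⟨not_lt.1 hξ.1.1.1, not_lt.1 hξ.1.1.2, not_lt.1 hξ.1.2, not_lt.1 hξ.2⟩

end Event

/-! ### The choice of the constants -/

section Constants

/-- The tail of the noise at the scale of the separation of the clusters. -/
lemma tail_const_le {n d k r : ℕ} {κ σ α O c : ℝ} (hκ : 0 < κ) (hd : 1 ≤ d) (hk : 2 ≤ k)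
    (hα : 1 ≤ α) (hα2 : α ≤ 2) (hασ : α = 1 → σ = 0) (hO : 0 < O) (hc : 0 ≤ c)
    (hr : c * (1 / 2) ^ r ≤ 1 / 400) :
    n * d * (n * d ^ 2 / O) * (c * σ ^ 4 * Real.exp
      (-((4 * κ * (r + 2) + 1) * Real.log (k * d / √(α - 1)) / (4 * κ)))) ≤
      (α - 1) * (σ ^ 2 * n * d / O) ^ 2 * O / 400 := by
  rcases hα.eq_or_lt with rfl | hα
  · simp [hασ rfl]
  have hd1 : (1 : ℝ) ≤ d := by exact_mod_cast hd
  have hk2 : (2 : ℝ) ≤ k := by exact_mod_cast hk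
  have hkd : 2 ≤ (k * d : ℝ) := by nlinarith
  have hs0 : 0 < √(α - 1) := Real.sqrt_pos.2 (by linarith)
  have hs1 : √(α - 1) ≤ 1 := Real.sqrt_le_one.2 (by linarith)
  set lg := Real.log (k * d / √(α - 1)) with hlg
  have hlg0 : 0 ≤ lg := by
    refine Real.log_nonneg ?_
    rw [le_div_iff₀ hs0]
    linarith
  set z := √(α - 1) / (k * d) with hz
  have hz0 : 0 ≤ z := by positivity
  have hz2 : z ≤ 1 / 2 := by
    rw [hz, div_le_iff₀ (by linarith)]
    linarith
  have hexp : Real.exp (-lg) = z := by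
    rw [Real.exp_neg, hlg, Real.exp_log (by positivity), inv_div]
  -- Of the `r + 2` factors `z = exp (-lg) ≤ 1/2`, two provide `(α - 1) / (k d)²` and the other `r`
  -- beat the constant `c`.
  have h1 : Real.exp (-((4 * κ * (r + 2) + 1) * lg / (4 * κ))) ≤ z ^ 2 * (1 / 2) ^ r := by
    have h2 : Real.exp (-((4 * κ * (r + 2) + 1) * lg / (4 * κ))) ≤ Real.exp (-lg) ^ (r + 2) := by
      rw [← Real.exp_nat_mul]
      refine Real.exp_le_exp.2 ?_
      have h3 : (r + 2) * lg ≤ (4 * κ * (r + 2) + 1) * lg / (4 * κ) := by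
        rw [le_div_iff₀ (by positivity)]
        linarith
      push_cast
      linarith
    refine h2.trans ?_
    rw [hexp, pow_add, mul_comm]
    gcongr
  have hzz : z ^ 2 = (α - 1) / (k * d) ^ 2 := by
    rw [hz, div_pow, Real.sq_sqrt (by linarith)]
  calc _ ≤ n * d * (n * d ^ 2 / O) * (c * σ ^ 4 * (z ^ 2 * (1 / 2) ^ r)) := by gcongr
    _ = n ^ 2 * d ^ 3 / O * σ ^ 4 * z ^ 2 * (c * (1 / 2) ^ r) := by ring
    _ ≤ n ^ 2 * d ^ 3 / O * σ ^ 4 * z ^ 2 * (1 / 400) := by gcongr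
    _ = n ^ 2 * σ ^ 4 * (α - 1) / O / 400 * (d / k ^ 2) := by
        rw [hzz]
        field_simp
    _ ≤ n ^ 2 * σ ^ 4 * (α - 1) / O / 400 * d ^ 2 := by
        have h5 : (d : ℝ) / k ^ 2 ≤ d ^ 2 := by
          refine (div_le_self (by linarith) (by nlinarith)).trans (by nlinarith)
        refine mul_le_mul_of_nonneg_left h5 ?_
        have : 0 ≤ α - 1 := by linarith
        positivity
    _ = _ := by
        field_simp

/-- The number of samples for each part. -/
noncomputable def sampleSize (ε α : ℝ) : ℕ :=
  ⌈16 * (4 + 2 * (2 + 8 * (α - 1) / (ε / 2000))) / (ε / 2000)⌉₊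

lemma sampleSize_le {ε α : ℝ} (hε : 0 < ε) (hε1 : ε < 1) (hα : 1 ≤ α) :
    (sampleSize ε α : ℝ) ≤ 256001 / ε + 1024000000 * (α - 1) / ε ^ 2 := by
  have hα1 : 0 ≤ α - 1 := by linarith
  have h1 := (Nat.ceil_lt_add_one (show 0 ≤ 16 * (4 + 2 * (2 + 8 * (α - 1) / (ε / 2000))) /
    (ε / 2000) by positivity)).le
  refine h1.trans ?_
  have h2 : 16 * (4 + 2 * (2 + 8 * (α - 1) / (ε / 2000))) / (ε / 2000) =
      256000 / ε + 1024000000 * (α - 1) / ε ^ 2 := by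
    field_simp
    ring
  have h3 : 1 ≤ 1 / ε := by
    rw [le_div_iff₀ hε]
    linarith
  rw [h2]
  have h4 : 256001 / ε = 256000 / ε + 1 / ε := by ring
  linarith

lemma le_mul_sampleSize {ε α : ℝ} (hε : 0 < ε) :
    16 * (4 + 2 * (2 + 8 * (α - 1) / (ε / 2000))) ≤ ε / 2000 * sampleSize ε α := by
  rw [← div_le_iff₀' (by positivity)]
  exact Nat.le_ceil _

/-- The slack is at most `ε` and `log k ≥ 1/2`, so the claimed size exceeds a multiple of the size
`k m` that is actually used. -/
lemma size_le_sizeBound {n d k : ℕ} {ε α σ O : ℝ} (hε : 0 < ε) (hε1 : ε < 1) (hα : 1 ≤ α)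
    (hk : 2 ≤ k) (hO : 0 < O) (hs : 0 < slack n d ε α σ O) :
    (k * sampleSize ε α : ℝ) ≤ 10 ^ 10 * sizeBound n d k ε α σ O := by
  have hα1 : 0 ≤ α - 1 := by linarith
  have hsε : slack n d ε α σ O ≤ ε := by
    rw [slack]
    have : 0 ≤ √(α - 1) * σ ^ 2 * n * d / (α * O) := by positivity
    linarith
  have hlog : 1 / 2 ≤ Real.log k := by
    have h1 : Real.log 2 ≤ Real.log k := Real.log_le_log (by norm_num) (by exact_mod_cast hk)
    linarith [Real.log_two_gt_d9]
  have hk0 : (0 : ℝ) ≤ k := Nat.cast_nonneg k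
  have h1 : k * (1 / 2) / ε ≤ k * Real.log k / slack n d ε α σ O := by gcongr
  have h2 : (α - 1) * k * (1 / 2) / ε ^ 2 ≤
      (α - 1) * k * Real.log k / slack n d ε α σ O ^ 2 := by gcongr
  have h3 := mul_le_mul_of_nonneg_left (sampleSize_le hε hε1 hα) hk0
  rw [sizeBound]
  have h4 : k * (256001 / ε + 1024000000 * (α - 1) / ε ^ 2) =
      512002 * (k * (1 / 2) / ε) + 2048000000 * ((α - 1) * k * (1 / 2) / ε ^ 2) := by ring
  have h5 : 0 ≤ k * (1 / 2) / ε := by positivity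
  have h6 : 0 ≤ (α - 1) * k * (1 / 2) / ε ^ 2 := by positivity
  linarith

lemma le_noiseTerm {n d k : ℕ} {α σ O : ℝ} (hα : 1 ≤ α) (hα2 : α ≤ 2) (hO : 0 < O) :
    8000 * (σ ^ 2 * k * d / O + √(α - 1) / 2 * (√(σ ^ 2 * k * d / O) + σ ^ 2 * n * d / O)) ≤
      8000 * noiseTerm n d k α σ O := by
  rw [noiseTerm]
  have h1 : √(σ ^ 2 * k * d * O) / O = √(σ ^ 2 * k * d / O) := by
    have h2 : σ ^ 2 * k * d * O = σ ^ 2 * k * d / O * O ^ 2 := by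
      field_simp
    rw [h2, Real.sqrt_mul (by positivity), Real.sqrt_sq hO.le, mul_div_cancel_right₀ _ hO.ne']
  rw [add_div, h1]
  gcongr

/-- The form in which positivity of the slack is used for existence: the relative tail is of order
`ε²`. -/
lemma slack_sq_le {n d : ℕ} {ε α σ O : ℝ} (hα : 1 ≤ α) (hα2 : α ≤ 2) (hO : 0 < O)
    (hs : 0 < slack n d ε α σ O) : (α - 1) * (σ ^ 2 * n * d / O) ^ 2 ≤ 4 * ε ^ 2 := by
  have h1 : √(α - 1) * (σ ^ 2 * n * d / O) ≤ 2 * ε := by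
    have h2 : √(α - 1) * σ ^ 2 * n * d / (α * O) = √(α - 1) * (σ ^ 2 * n * d / O) / α := by
      field_simp
    rw [slack, h2, sub_pos, div_lt_iff₀ (by linarith)] at hs
    have hε : 0 < ε * α := lt_of_le_of_lt (by positivity) hs
    have hε' : 0 < ε := pos_of_mul_pos_left hε (by linarith)
    nlinarith
  have h3 := pow_le_pow_left₀ (by positivity) h1 2
  rw [mul_pow, Real.sq_sqrt (by linarith), mul_pow] at h3
  linarith

end Constants

end NoisyCoreset

theorem mainTheorem3 (κ : ℝ) (hκ : 0 < κ) :
    ∃ A K L : ℝ, 0 < A ∧ 0 < K ∧ 0 < L ∧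
      ∀ (n d k : ℕ) (ε α σ : ℝ), 1 ≤ d → 2 ≤ k → 0 < ε → ε < 1 → 1 ≤ α → α ≤ 2 → 0 ≤ σ →
        ∃ 𝒜 : CoresetAlg n d,
          ∀ (P : Dataset n d) (OPT : ℝ) (D : Fin d → Measure ℝ),
            0 < OPT → opt 1 P k = ENNReal.ofReal OPT →
            σ ^ 2 ≤ OPT / (n * d) →
            DataAssumption A α σ P k →
            0 < slack n d ε α σ OPT →
            (∀ j, IsNoise κ σ (D j)) →
            (∀ ξ : Fin n → Fin d → ℝ, ∀ w ∈ (𝒜.weights (observed P ξ)).support,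
              (size w : ℝ) ≤ K * sizeBound n d k ε α σ OPT) ∧
            (99 / 100 : ℝ≥0∞) ≤ ∫⁻ ξ, (𝒜.weights (observed P ξ)).toOuterMeasure
              {w | errAlpha w (observed P ξ) (observed P ξ) k α ≤ (ε : EReal) ∧
                errAlpha w (observed P ξ) P k α ≤
                  ((ε + L * noiseTerm n d k α σ OPT : ℝ) : EReal) ∧
                quality w (observed P ξ) P k α ≤
                  ENNReal.ofReal ((1 + ε + L * noiseTerm n d k α σ OPT) * α)}
              ∂(noiseLaw n D) := by
  -- `r` is the number of spare powers of `1/2` that absorb the constant of the fourth moment bound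
  -- and the factor `400` of Markov's inequality.
  obtain ⟨r, hr⟩ : ∃ r : ℕ, 24576 * (κ ^ 4 + κ ^ 2) * (1 / 2 : ℝ) ^ r ≤ 1 / 400 := by
    have hc : 0 < 24576 * (κ ^ 4 + κ ^ 2) := by positivity
    obtain ⟨r, hr⟩ := exists_pow_lt_of_lt_one
      (show 0 < 1 / 400 / (24576 * (κ ^ 4 + κ ^ 2)) by positivity)
      (show (1 / 2 : ℝ) < 1 by norm_num)
    rw [lt_div_iff₀ hc] at hr
    exact ⟨r, by linarith⟩
  set t : ℝ := 4 * κ * (r + 2) + 1 with ht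
  have ht1 : 1 ≤ t := by
    have : 0 ≤ 4 * κ * (r + 2) := by positivity
    linarith
  have ha1 : 1 ≤ t ^ 2 := one_le_pow₀ ht1
  -- The factor `t ^ 2` in the stability constant puts the threshold of the tail at `t * lg`
  -- standard deviations.
  refine ⟨4 * 10 ^ 14 * t ^ 2, 10 ^ 10, 8000, by positivity, by positivity, by norm_num, ?_⟩
  intro n d k ε α σ hd hk hε hε1 hα hα2 hσ
  set lam := 2 + 8 * (α - 1) / (ε / 2000) with hlam
  obtain ⟨𝒜, h𝒜⟩ := exists_algorithm n d k (sampleSize ε α) lam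
  refine ⟨𝒜, fun P O D hO hopt hσO hdata hslack hD => ⟨fun ξ w hw => ?_, ?_⟩⟩
  · obtain ⟨w', hw', hsize, -⟩ := h𝒜 (observed P ξ)
    rw [hw', PMF.support_pure, Set.mem_singleton_iff] at hw
    rw [hw]
    refine le_trans ?_ (size_le_sizeBound hε hε1 hα hk hO hslack)
    exact_mod_cast hsize
  · obtain ⟨hασ, f, c, hsum, hsep⟩ := exists_isSeparated hd hk ha1 hα hO hopt hdata
    set lg := Real.log (k * d / √(α - 1)) with hlg
    have hN : O + t ^ 2 * (σ ^ 2 * n * d * lg ^ 2) = O + (t * lg) ^ 2 * (σ ^ 2 * n * d) := by ring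
    rw [hN] at hsep
    have hα1 : 0 ≤ α - 1 := by linarith
    have hd1 : (1 : ℝ) ≤ d := by exact_mod_cast hd
    have hk1 : (1 : ℝ) ≤ k := by exact_mod_cast (by omega : 1 ≤ k)
    have hlam2 : 2 ≤ lam := by
      have : 0 ≤ 8 * (α - 1) / (ε / 2000) := by positivity
      linarith
    have hτ1 : σ ^ 2 * n * d / O ≤ 1 := by
      rw [div_le_one hO]
      rcases Nat.eq_zero_or_pos n with rfl | hn
      · simpa using hO.le
      · have hn0 : (0 : ℝ) < n := by exact_mod_cast hn
        rw [le_div_iff₀ (by positivity)] at hσO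
        linarith
    have hσ2 : σ ^ 2 ≤ O := by
      rcases Nat.eq_zero_or_pos n with rfl | hn
      -- For `n = 0` the right side of `hσO` is a division by zero, hence `0`, and `σ = 0`.
      · simp at hσO
        simp [hσO, hO.le]
      · have hn0 : (1 : ℝ) ≤ n := by exact_mod_cast hn
        exact hσO.trans (div_le_self hO.le (by nlinarith))
    have htail := (lintegral_tail_noise_le n hκ hσ hD (u := t * lg) hO).trans
      (ENNReal.ofReal_le_ofReal (tail_const_le (n := n) hκ hd hk hα hα2 hασ hO (by positivity) hr))
    obtain ⟨G, hGm, hG, hGξ⟩ := exists_good_event hD f (fun p => P p - c (f p)) hsum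
      (by positivity) htail
    refine hG.trans ?_
    -- The algorithm is deterministic, so on `G` the inner probability is `1`, and elsewhere it is
    -- bounded below by `0`.
    rw [← lintegral_indicator_one hGm]
    refine lintegral_mono fun ξ => ?_
    by_cases hξ : ξ ∈ G
    swap
    · rw [Set.indicator_of_notMem hξ]
      exact bot_le
    rw [Set.indicator_of_mem hξ]
    obtain ⟨h1, h2, h3, h4⟩ := hGξ ξ hξ
    have hem := le_mul_sampleSize (α := α) hε
    rw [← hlam] at hem
    have hlm : lam ≤ sampleSize ε α := by
      have : ε / 2000 * (sampleSize ε α : ℝ) ≤ 1 * sampleSize ε α :=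
        mul_le_mul_of_nonneg_right (by linarith) (Nat.cast_nonneg _)
      linarith
    have hm : 0 < sampleSize ε α := by
      have : (0 : ℝ) < sampleSize ε α := by linarith
      exact_mod_cast this
    have hmε : (sampleSize ε α : ℝ) * ε ^ 2 ≤ 2 * 10 ^ 9 := by
      have h5 := mul_le_mul_of_nonneg_right (sampleSize_le hε hε1 hα) (sq_nonneg ε)
      have h6 : (256001 / ε + 1024000000 * (α - 1) / ε ^ 2) * ε ^ 2 =
          256001 * ε + 1024000000 * (α - 1) := by
        field_simp
      linarith
    have hON : O ≤ O + (t * lg) ^ 2 * (σ ^ 2 * n * d) := le_add_of_nonneg_right (by positivity)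
    have hϑO : σ ^ 2 * k * d / O * O = σ ^ 2 * k * d := div_mul_cancel₀ _ hO.ne'
    have hτO : σ ^ 2 * n * d / O * O = σ ^ 2 * n * d := div_mul_cancel₀ _ hO.ne'
    have hcr : σ ^ 2 * O ≤ σ ^ 2 * k * d / O * O ^ 2 := by
      have h5 : σ ^ 2 * k * d / O * O ^ 2 = σ ^ 2 * O * (k * d) := by
        field_simp
      rw [h5]
      exact le_mul_of_one_le_right (by positivity) (one_le_mul_of_one_le_of_one_le hk1 hd1)
    obtain ⟨hex, hbd⟩ := deterministic_bounds hk
      (P := P) (X := observed P ξ) (ξ := fun p => WithLp.toLp 2 (ξ p)) rfl hε rfl hα hα2 hlam hem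
      hlm hm hmε hO hON hopt hsep hsum (τ := σ ^ 2 * n * d / O) (ϑ := σ ^ 2 * k * d / O)
      (by positivity) hτ1 (by positivity) (slack_sq_le hα hα2 hO hslack)
      (by
        rw [mul_assoc, hτO]
        linarith)
      (by
        rw [mul_assoc, hϑO]
        linarith)
      (by linarith)
      (by
        have := mul_le_mul_of_nonneg_right hσ2 hO.le
        linarith)
      (by linarith)
    obtain ⟨w, hw, -, hgood⟩ := h𝒜 (observed P ξ)
    obtain ⟨π, s, hs, rfl⟩ := hgood hex
    have hb := hbd π s hs
    set η := 8000 * (σ ^ 2 * k * d / O +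
      √(α - 1) / 2 * (√(σ ^ 2 * k * d / O) + σ ^ 2 * n * d / O)) with hη
    have hη0 : 0 ≤ η := by positivity
    have hηn : η ≤ 8000 * noiseTerm n d k α σ O := le_noiseTerm hα hα2 hO
    rw [hw, PMF.toOuterMeasure_pure_apply, if_pos]
    · exact le_rfl
    · refine ⟨errAlpha_le hε.le fun C hC => (hb C hC).1, ?_, ?_⟩
      · refine (errAlpha_le (by linarith) fun C hC => (hb C hC).2).trans ?_
        exact_mod_cast add_le_add_right hηn ε
      · refine (quality_le (by linarith) fun C hC => (hb C hC).2).trans ?_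
        refine ENNReal.ofReal_le_ofReal (mul_le_mul_of_nonneg_right (by linarith) (by linarith))
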